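/- Let $p\ge 1$, $m\ge 1$ and $n$ be integers with $2m<n$, let $\Theta=(\theta_{uv})$ be a positive definite $p\times p$ covariance matrix, and let $\mathbf X_1,\dots,\mathbf X_n$ be i.i.d. with law $P=\mathcal N_p(0,\Theta)$. Let $$f(\Theta)=a_0+\sum_{r=1}^m\ \sum_{1\le u_i\le v_i\le p,\ i\in[r]} a_{u_1v_1,\dots,u_rv_r}\,\theta_{u_1v_1}\cdots\theta_{u_rv_r}$$ be a real polynomial of degree at most $m$ in the entries of $\Theta$, and assume $f(\Theta)=0$. Put $$\breve h(\mathbf x_1,\dots,\mathbf x_m)=a_0+\sum_{r=1}^m\ \sum_{1\le u_i\le v_i\le p,\ i\in[r]} a_{u_1v_1,\dots,u_rv_r}\prod_{i=1}^r x_{i,u_i}x_{i,v_i},\qquad h(\mathbf x_1,\dots,\mathbf x_m)=\frac1{m!}\sum_{\pi\in\mathcal S_m}\breve h(\mathbf x_{\pi_1},\dots,\mathbf x_{\pi_m}),$$ $$U_n=\binom nm^{-1}\sum_{1\le i_1<\dots<i_m\le n}h(\mathbf X_{i_1},\dots,\mathbf X_{i_m}),\qquad g(\mathbf x)=\mathbb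 E[h(\mathbf x,\mathbf X_2,\dots,\mathbf X_m)],$$ $\sigma_g^2=\operatorname{var}[g(\mathbf X_1)]$ and $\sigma_h^2=\operatorname{var}[h(\mathbf X_1,\dots,\mathbf X_m)]$, and assume $\sigma_g>0$. For $1\le r\le m$ let $$\pi_r(h)(\mathbf x_1,\dots,\mathbf x_r)=(\delta_{\mathbf x_1}-P)\times\cdots\times(\delta_{\mathbf x_r}-P)\times P^{m-r}\,h,\qquad U_n^{(r)}=\binom nr^{-1}\sum_{1\le i_1<\dots<i_r\le n}\pi_r(h)(\mathbf X_{i_1},\dots,\mathbf X_{i_r}),$$ where $Q_1\times\cdots\times Q_m\,h$ denotes the integral of $h$ against the product of the (signed) measures $Q_i$. Then there are absolute constants $C_1,C_2>0$ (depending on none of $p,m,n,f,\Theta,x$) such that for every $x\in\mathbb R$ $$\left|P\!\left(\frac{\sqrt n}{m\sigma_g}U_n\le x\right)-\Phi(x)\right|\le C_1\frac{\mathbb E|g(\mathbf X_1)|^3}{\sqrt n\,\sigma_g^3}+P\!\left(\left|\frac{\sqrt n}{m\sigma_g}\sum_{r=2}^m\binom mr U_n^{(r)}\right|>\frac{|x|+1}{3}\right)+C_2e^{-|x|/6}\,\frac{(\sqrt2+2)(m-1)\sigma_h}{\sqrt{m(n-m+1)}\,\sigma_g},$$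 where $\Phi$ is the standard normal distribution function. -/

import Mathlib

open MeasureTheory ProbabilityTheory

noncomputable section

namespace GaussUStat

/-- Pairs `(u, v)` of coordinates with `u ≤ v`. -/
abbrev UpperPair (p : ℕ) : Type := {q : Fin p × Fin p // q.1 ≤ q.2}

/-- A real polynomial in the entries `θ_{uv}`, `u ≤ v`, of a symmetric `p × p` matrix, written as
`a₀ + ∑_{r=1}^m ∑_{(u₁,v₁),…,(u_r,v_r)} a_{u₁v₁,…,u_rv_r} θ_{u₁v₁} ⋯ θ_{u_rv_r}`.
The index `r : Fin m` stands for the terms of degree `r + 1`. -/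
structure CovPoly (p m : ℕ) where
  /-- the constant term -/
  a₀ : ℝ
  /-- the coefficients of the products of `r + 1` entries -/
  a : (r : Fin m) → (Fin (r.val + 1) → UpperPair p) → ℝ

/-- The value `f(Θ)`. -/
def CovPoly.eval {p m : ℕ} (f : CovPoly p m) (Θ : Matrix (Fin p) (Fin p) ℝ) : ℝ :=
  f.a₀ + ∑ r : Fin m, ∑ w : Fin (r.val + 1) → UpperPair p,
    f.a r w * ∏ i, Θ (w i).val.1 (w i).val.2

/-- `θ̂_{uv}(x) = x_u x_v`. -/
def thetaHat {p : ℕ} (q : UpperPair p) (x : EuclideanSpace ℝ (Fin p)) : ℝ :=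
  x q.val.1 * x q.val.2

/-- The unsymmetrized kernel: in each product, `θ_{u_i v_i}` is replaced by
`θ̂_{u_i v_i}(x_i)`. -/
def CovPoly.preKernel {p m : ℕ} (f : CovPoly p m)
    (x : Fin m → EuclideanSpace ℝ (Fin p)) : ℝ :=
  f.a₀ + ∑ r : Fin m, ∑ w : Fin (r.val + 1) → UpperPair p,
    f.a r w * ∏ i, thetaHat (w i) (x (Fin.castLE r.isLt i))

/-- The symmetric kernel `h`. -/
def CovPoly.kernel {p m : ℕ} (f : CovPoly p m)
    (x : Fin m → EuclideanSpace ℝ (Fin p)) : ℝ :=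
  ((m.factorial : ℝ))⁻¹ * ∑ π : Equiv.Perm (Fin m), f.preKernel (fun i => x (π i))

open Classical in
/-- The index set `I_{n,r}` of tuples `i₁ < ⋯ < i_r`. -/
def indexSet (n r : ℕ) : Finset (Fin r → Fin n) :=
  Finset.univ.filter fun i => StrictMono i

/-- The complete U-statistic of the data `X₁, …, X_n` with a kernel `k` in `r` arguments. -/
def uStat {E Ω : Type*} {n r : ℕ} (k : (Fin r → E) → ℝ) (X : Fin n → Ω → E) (ω : Ω) : ℝ :=
  ((n.choose r : ℝ))⁻¹ * ∑ i ∈ indexSet n r, k (fun j => X (i j) ω)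

section Kernel

variable {E : Type*} [MeasurableSpace E] {m : ℕ}

/-- The projection kernel `g(x) = 𝔼[h(x, X₂, …, X_m)]` for `X_i` i.i.d. with law `P`
(the first of the `m` integration variables is not used). -/
def projKernel (P : Measure E) (h : (Fin m → E) → ℝ) (x : E) : ℝ :=
  ∫ y, h (fun i => if i.val = 0 then x else y i) ∂(Measure.pi fun _ : Fin m => P)

/-- `Q₁ × ⋯ × Q_m Ψ` where `Q_i = δ_{x_i}` for `i ∈ A ⊆ [r]` and `Q_i = P` otherwise. -/
def mixedMean (P : Measure E) (Ψ : (Fin m → E) → ℝ) {r : ℕ} (A : Finset (Fin r))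
    (x : Fin r → E) : ℝ :=
  ∫ y, Ψ (fun i => if hi : i.val < r then (if ⟨i.val, hi⟩ ∈ A then x ⟨i.val, hi⟩ else y i)
    else y i) ∂(Measure.pi fun _ : Fin m => P)

/-- The Hoeffding projection
`π_r(Ψ)(x₁, …, x_r) = (δ_{x₁} - P) × ⋯ × (δ_{x_r} - P) × P^{m-r} Ψ`, the product of signed
measures being expanded by multilinearity. -/
def hoeffdingProj (P : Measure E) (Ψ : (Fin m → E) → ℝ) (r : ℕ) (x : Fin r → E) : ℝ :=
  ∑ A : Finset (Fin r), (-1 : ℝ) ^ (r - A.card) * mixedMean P Ψ A x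

/-- The standard deviation `σ_g` of `g(X)`. -/
def sigmaG (P : Measure E) (h : (Fin m → E) → ℝ) : ℝ :=
  Real.sqrt (variance (projKernel P h) P)

/-- The standard deviation `σ_h` of `h(X₁, …, X_m)`. -/
def sigmaH (P : Measure E) (h : (Fin m → E) → ℝ) : ℝ :=
  Real.sqrt (variance h (Measure.pi fun _ : Fin m => P))

/-- `𝔼|g|³`. -/
def absThirdMomentG (P : Measure E) (h : (Fin m → E) → ℝ) : ℝ :=
  ∫ x, |projKernel P h x| ^ 3 ∂P

/-- The remainder `∑_{r=2}^m (m choose r) U_n^{(r)}` of the Hoeffding decomposition, where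
`U_n^{(r)}` is the U-statistic with kernel `π_r(h)`. -/
def hoeffdingRemainder {Ω : Type*} {n : ℕ} (P : Measure E) (h : (Fin m → E) → ℝ)
    (X : Fin n → Ω → E) (ω : Ω) : ℝ :=
  ∑ r ∈ Finset.Icc 2 m, (m.choose r : ℝ) * uStat (hoeffdingProj P h r) X ω

end Kernel

end GaussUStat

end

/-!
By the Hoeffding decomposition, `√n U_n / (m σ_g) = W + Δ`, where `W` is the standardized sum of the
`g(X_i)` and `Δ` is the normalized remainder. The events `{W + Δ ≤ x}` and `{W ≤ x}` differ only
where `|W - x| ≤ |Δ|`, hence, off `{|Δ| > (|x| + 1) / 3}`, only where `W` is comparable to `x`.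
There Stein's method, applied to a function of slope one on `[x - |Δ|, x + |Δ|]` weighted by
`exp (W / 2)` as in Chen and Shao's randomized concentration inequality, bounds the probability by
`exp (-|x| / 6)` times the `L²` norms of `Δ` and of the differences between `Δ` and its
leave-one-out versions. Those norms are computed by the orthogonality of the Hoeffding projections,
which makes the second moment of `Δ` a sum over `r ≥ 2` of terms of order `n ^ (1 - r)`. The
comparison of `W` with the normal law is the Berry-Esseen theorem, proved through Stein's equation
and a concentration inequality for the leave-one-out sums.
-/

namespace BerryEsseen

open Real (exp exp_pos)

/-! ### Truncation at level one -/

/-- Truncation of a real number at level one: `s` if `|s| ≤ 1`, and `0` otherwise. Unlike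
`ProbabilityTheory.truncation`, it is odd. -/
noncomputable def trunc (s : ℝ) : ℝ := if |s| ≤ 1 then s else 0

lemma trunc_of_abs_le_one {s : ℝ} (h : |s| ≤ 1) : trunc s = s := if_pos h

lemma trunc_of_one_lt_abs {s : ℝ} (h : 1 < |s|) : trunc s = 0 := if_neg (not_le.2 h)

lemma trunc_eq_self_or_eq_zero (s : ℝ) : trunc s = s ∨ trunc s = 0 := by
  unfold trunc; split_ifs <;> simp

lemma abs_trunc_le_one (s : ℝ) : |trunc s| ≤ 1 := by
  unfold trunc; split_ifs with h <;> simp [h]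

lemma abs_trunc_le_abs (s : ℝ) : |trunc s| ≤ |s| := by
  rcases trunc_eq_self_or_eq_zero s with h | h <;> simp [h]

lemma trunc_neg (s : ℝ) : trunc (-s) = -trunc s := by
  unfold trunc; rw [abs_neg]; split_ifs <;> simp

@[fun_prop]
lemma measurable_trunc : Measurable trunc :=
  Measurable.ite (measurableSet_le (by fun_prop) (by fun_prop)) measurable_id measurable_const

lemma exp_trunc_le (s : ℝ) : exp (trunc s) ≤ 1 + s + 2 * s ^ 2 := by
  rcases le_or_gt |s| 1 with h | h
  · rw [trunc_of_abs_le_one h]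
    have := (abs_le.1 (Real.abs_exp_sub_one_sub_id_le h)).2
    nlinarith [sq_nonneg s]
  · rw [trunc_of_one_lt_abs h, Real.exp_zero]
    have h_sq : |s| ≤ s ^ 2 := by rw [← sq_abs]; nlinarith
    nlinarith [neg_abs_le s]

lemma abs_mul_exp_trunc_sub_one_le (s : ℝ) : |s * (exp (trunc s) - 1)| ≤ 2 * s ^ 2 := by
  have h := Real.abs_exp_sub_one_le (abs_trunc_le_one s)
  rw [abs_mul, ← sq_abs]
  nlinarith [abs_nonneg s, abs_trunc_le_abs s]

lemma exp_trunc_le_three (s : ℝ) : exp (trunc s) ≤ 3 :=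
  (Real.exp_le_exp.2 ((le_abs_self _).trans (abs_trunc_le_one s))).trans
    (by linarith [Real.exp_one_lt_d9])

/-- A substitute for `s ^ 2` which agrees with it for `|s| ≤ min δ 1` and never exceeds
`δ * |s|`. -/
noncomputable def truncSq (δ s : ℝ) : ℝ := |trunc s| * min |trunc s| δ

@[fun_prop]
lemma measurable_truncSq (δ : ℝ) : Measurable (truncSq δ) := by unfold truncSq; fun_prop

lemma truncSq_nonneg {δ : ℝ} (hδ : 0 ≤ δ) (s : ℝ) : 0 ≤ truncSq δ s :=
  mul_nonneg (abs_nonneg _) (le_min (abs_nonneg _) hδ)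

lemma truncSq_le {δ : ℝ} (hδ : 0 ≤ δ) (s : ℝ) : truncSq δ s ≤ δ * |s| := by
  rw [truncSq, mul_comm]
  exact mul_le_mul (min_le_right _ _) (abs_trunc_le_abs s) (abs_nonneg _) hδ

lemma le_truncSq {δ : ℝ} (hδ : 0 < δ) (s : ℝ) :
    s ^ 2 - (1 + 1 / (4 * δ)) * |s| ^ 3 ≤ truncSq δ s := by
  have h_cube : 0 ≤ |s| ^ 3 := by positivity
  have h_div : 0 ≤ |s| ^ 3 / (4 * δ) := by positivity
  have h_split : (1 + 1 / (4 * δ)) * |s| ^ 3 = |s| ^ 3 + |s| ^ 3 / (4 * δ) := by ring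
  rw [h_split, ← sq_abs, truncSq]
  rcases le_or_gt |s| 1 with h | h
  · rw [trunc_of_abs_le_one h]
    rcases le_total |s| δ with hsδ | hsδ
    · rw [min_eq_left hsδ]
      nlinarith
    · rw [min_eq_right hsδ]
      have h_amgm : |s| ^ 2 - |s| * δ ≤ |s| ^ 3 / (4 * δ) := by
        rw [le_div_iff₀ (by positivity)]
        nlinarith [mul_nonneg (abs_nonneg s) (sq_nonneg (|s| - 2 * δ))]
      linarith
  · rw [trunc_of_one_lt_abs h]
    have : |s| ^ 2 ≤ |s| ^ 3 := pow_le_pow_right₀ h.le (by norm_num)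
    simp only [abs_zero, zero_mul]
    linarith

/-! ### The exponentially tilted test function -/

/-- The test function `exp (w / 2) * (w - x + d + δ)`, the linear factor being clipped to
`[0, 2 d + 2 δ]`. It is the Stein test function behind the non-uniform concentration inequality:
monotone, and of slope at least `exp (w / 2)` on `|w - x| ≤ d`. -/
noncomputable def tiltClip (x δ d w : ℝ) : ℝ :=
  exp (w / 2) * min (max (w - x + d + δ) 0) (2 * d + 2 * δ)

section TiltClip

variable {x δ d w s : ℝ}

lemma continuous_tiltClip (x δ : ℝ) : Continuous fun q : ℝ × ℝ => tiltClip x δ q.1 q.2 := by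
  unfold tiltClip; fun_prop

lemma tiltClip_nonneg (hδ : 0 ≤ δ) (hd : 0 ≤ d) : 0 ≤ tiltClip x δ d w :=
  mul_nonneg (exp_pos _).le (le_min (le_max_right _ _) (by positivity))

lemma tiltClip_le (x δ d w : ℝ) : tiltClip x δ d w ≤ exp (w / 2) * (2 * d + 2 * δ) :=
  mul_le_mul_of_nonneg_left (min_le_right _ _) (exp_pos _).le

lemma monotone_tiltClip (hδ : 0 ≤ δ) (hd : 0 ≤ d) : Monotone (tiltClip x δ d) := by
  intro w w' h
  unfold tiltClip
  refine mul_le_mul (Real.exp_le_exp.2 (by linarith)) (by gcongr) ?_ (exp_pos _).le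
  exact le_min (le_max_right _ _) (by positivity)

lemma abs_tiltClip_sub_le (x δ d d' w : ℝ) :
    |tiltClip x δ d w - tiltClip x δ d' w| ≤ exp (w / 2) * (2 * |d - d'|) := by
  unfold tiltClip
  rw [← mul_sub, abs_mul, abs_of_pos (exp_pos _)]
  refine mul_le_mul_of_nonneg_left ?_ (exp_pos _).le
  refine (abs_min_sub_min_le_max _ _ _ _).trans (max_le ?_ ?_)
  · refine (abs_max_sub_max_le_max _ _ _ _).trans (max_le ?_ ?_)
    · rw [show w - x + d + δ - (w - x + d' + δ) = d - d' by ring]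
      linarith [abs_nonneg (d - d')]
    · simp
  · rw [show 2 * d + 2 * δ - (2 * d' + 2 * δ) = 2 * (d - d') by ring, abs_mul, abs_two]

lemma tiltClip_of_abs_sub_le (hδ : 0 ≤ δ) (hw : |w - x| ≤ d) :
    tiltClip x δ d w = exp (w / 2) * (w - x + d + δ) := by
  obtain ⟨hl, hr⟩ := abs_le.1 hw
  rw [tiltClip, max_eq_left (by linarith), min_eq_left (by linarith)]

lemma exp_mul_min_le_tiltClip_sub_tiltClip_sub (hδ : 0 ≤ δ) (hw : |w - x| ≤ d) (hs : 0 ≤ s) :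
    exp (w / 2) * min s δ ≤ tiltClip x δ d w - tiltClip x δ d (w - s) := by
  obtain ⟨hl, hr⟩ := abs_le.1 hw
  have h_exp : exp ((w - s) / 2) ≤ exp (w / 2) := Real.exp_le_exp.2 (by linarith)
  have h_clip : min (max (w - s - x + d + δ) 0) (2 * d + 2 * δ) ≤ w - x + d + δ - min s δ :=
    (min_le_left _ _).trans (max_le (by linarith [min_le_left s δ])
      (by linarith [min_le_right s δ]))
  have h_clip_nonneg : 0 ≤ min (max (w - s - x + d + δ) 0) (2 * d + 2 * δ) :=
    le_min (le_max_right _ _) (by linarith)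
  have h_mul := mul_le_mul h_exp h_clip h_clip_nonneg (exp_pos _).le
  rw [tiltClip_of_abs_sub_le hδ hw]
  unfold tiltClip
  linarith

lemma exp_mul_min_le_tiltClip_add_sub_tiltClip (hδ : 0 ≤ δ) (hw : |w - x| ≤ d) (hs : 0 ≤ s) :
    exp (w / 2) * min s δ ≤ tiltClip x δ d (w + s) - tiltClip x δ d w := by
  obtain ⟨hl, hr⟩ := abs_le.1 hw
  have h_exp : exp (w / 2) ≤ exp ((w + s) / 2) := Real.exp_le_exp.2 (by linarith)
  have h_clip : w - x + d + δ + min s δ ≤ min (max (w + s - x + d + δ) 0) (2 * d + 2 * δ) :=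
    le_min ((by linarith [min_le_left s δ] : _ ≤ w + s - x + d + δ).trans (le_max_left _ _))
      (by linarith [min_le_right s δ])
  have h_min : 0 ≤ min s δ := le_min hs hδ
  have h_mul := mul_le_mul h_exp h_clip (by linarith) (exp_pos _).le
  rw [tiltClip_of_abs_sub_le hδ hw]
  unfold tiltClip
  linarith

lemma mul_tiltClip_sub_nonneg (hδ : 0 ≤ δ) (hd : 0 ≤ d) (w s : ℝ) :
    0 ≤ s * (tiltClip x δ d w - tiltClip x δ d (w - trunc s)) := by
  rcases trunc_eq_self_or_eq_zero s with h | h <;> rw [h]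
  · rcases le_total 0 s with hs | hs
    · exact mul_nonneg hs (sub_nonneg.2 (monotone_tiltClip hδ hd (by linarith)))
    · exact mul_nonneg_of_nonpos_of_nonpos hs
        (sub_nonpos.2 (monotone_tiltClip hδ hd (by linarith)))
  · simp

lemma exp_mul_truncSq_le_mul_tiltClip_sub (hδ : 0 ≤ δ) (hw : |w - x| ≤ d) (s : ℝ) :
    exp (w / 2) * truncSq δ s ≤ s * (tiltClip x δ d w - tiltClip x δ d (w - trunc s)) := by
  unfold truncSq
  rcases trunc_eq_self_or_eq_zero s with h | h <;> rw [h]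
  · rcases le_total 0 s with hs | hs
    · have := exp_mul_min_le_tiltClip_sub_tiltClip_sub hδ hw hs
      rw [abs_of_nonneg hs]; nlinarith
    · have := exp_mul_min_le_tiltClip_add_sub_tiltClip hδ hw (neg_nonneg.2 hs)
      rw [abs_of_nonpos hs, sub_eq_add_neg w s]; nlinarith
  · simp

end TiltClip

/-! ### Integral inequalities -/

section Integral

variable {Ω : Type*} [MeasurableSpace Ω] {μ : Measure Ω}

lemma exp_half_sq (t : ℝ) : exp (t / 2) ^ 2 = exp t := by
  rw [Real.exp_half, Real.sq_sqrt (exp_pos t).le]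

lemma integrable_fun_mul {f g : Ω → ℝ} (hf : MemLp f 2 μ) (hg : MemLp g 2 μ) :
    Integrable (fun ω => f ω * g ω) μ := hf.integrable_mul hg

lemma integral_abs_mul_le_sqrt_mul_sqrt {f g : Ω → ℝ} (hf : MemLp f 2 μ) (hg : MemLp g 2 μ) :
    ∫ ω, |f ω * g ω| ∂μ ≤ √(∫ ω, f ω ^ 2 ∂μ) * √(∫ ω, g ω ^ 2 ∂μ) := by
  have h := integral_mul_le_Lp_mul_Lq_of_nonneg (μ := μ) (f := fun ω => |f ω|)
    (g := fun ω => |g ω|) Real.HolderConjugate.two_two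
    (.of_forall fun _ => abs_nonneg _) (.of_forall fun _ => abs_nonneg _)
    (by rw [ENNReal.ofReal_ofNat]; exact hf.abs) (by rw [ENNReal.ofReal_ofNat]; exact hg.abs)
  simpa [abs_mul, Real.sqrt_eq_rpow] using h

lemma integral_abs_le_sqrt [IsProbabilityMeasure μ] {f : Ω → ℝ} (hf : MemLp f 2 μ) :
    ∫ ω, |f ω| ∂μ ≤ √(∫ ω, f ω ^ 2 ∂μ) := by
  simpa using integral_abs_mul_le_sqrt_mul_sqrt hf (memLp_const (1 : ℝ))

lemma measureReal_le_integral [IsFiniteMeasure μ] {A : Set Ω} {f : Ω → ℝ}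
    (hA : MeasurableSet A) (hf : Integrable f μ) (hf0 : ∀ ω, 0 ≤ f ω) (hfA : ∀ ω ∈ A, 1 ≤ f ω) :
    μ.real A ≤ ∫ ω, f ω ∂μ := by
  rw [← integral_indicator_one hA]
  exact integral_mono ((integrable_const 1).indicator hA) hf
    (Set.indicator_le' hfA fun ω _ => hf0 ω)

lemma memLp_mul_exp_half {X T : Ω → ℝ} {c : ℝ} (hX : MemLp X 2 μ) (hT : Measurable T)
    (hTc : ∀ ω, T ω ≤ c) : MemLp (fun ω => X ω * exp (T ω / 2)) 2 μ := by
  refine (hX.const_mul (exp (c / 2))).mono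
    (hX.aestronglyMeasurable.mul (hT.div_const 2).exp.aestronglyMeasurable)
    (.of_forall fun ω => ?_)
  rw [norm_mul, norm_mul, Real.norm_of_nonneg (exp_pos _).le, Real.norm_of_nonneg (exp_pos _).le,
    mul_comm]
  exact mul_le_mul_of_nonneg_right (Real.exp_le_exp.2 (by linarith [hTc ω])) (norm_nonneg _)

lemma memLp_tiltClip [IsFiniteMeasure μ] {S Δ : Ω → ℝ} {c δ : ℝ} (hδ : 0 ≤ δ)
    (hS : Measurable S) (hSc : ∀ ω, S ω ≤ c) (hΔ : Measurable Δ) (hΔ2 : MemLp Δ 2 μ) (x : ℝ) :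
    MemLp (fun ω => tiltClip x δ |Δ ω| (S ω)) 2 μ := by
  have h_dom : MemLp (fun ω => (2 * |Δ ω| + 2 * δ) * exp (S ω / 2)) 2 μ :=
    memLp_mul_exp_half ((hΔ2.abs.const_mul 2).add (memLp_const (2 * δ))) hS hSc
  refine h_dom.mono' ?_ (.of_forall fun ω => ?_)
  · exact ((continuous_tiltClip x δ).measurable.comp (hΔ.abs.prodMk hS)).aestronglyMeasurable
  · rw [Real.norm_of_nonneg (tiltClip_nonneg hδ (abs_nonneg _)), mul_comm]
    exact tiltClip_le _ _ _ _

lemma sqrt_integral_exp_half_sq_le {T : Ω → ℝ} (hT : ∫ ω, exp (T ω) ∂μ ≤ exp 2) :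
    √(∫ ω, exp (T ω / 2) ^ 2 ∂μ) ≤ exp 1 := by
  simp only [exp_half_sq]
  refine (Real.sqrt_le_sqrt hT).trans_eq ?_
  rw [← Real.exp_half, div_self two_ne_zero]

end Integral

/-! ### Standardized sums -/

section StdSum

variable {Ω ι : Type*} [Fintype ι]

/-- The sum of the truncated summands. -/
noncomputable def truncSum (ξ : ι → Ω → ℝ) (ω : Ω) : ℝ := ∑ i, trunc (ξ i ω)

lemma truncSum_le_card (ξ : ι → Ω → ℝ) (ω : Ω) : truncSum ξ ω ≤ Fintype.card ι := by
  refine (Finset.sum_le_card_nsmul _ _ 1 fun i _ =>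
    (le_abs_self _).trans (abs_trunc_le_one (ξ i ω))).trans ?_
  simp

lemma truncSum_sub_le_card_add_one (ξ : ι → Ω → ℝ) (i : ι) (ω : Ω) :
    truncSum ξ ω - trunc (ξ i ω) ≤ Fintype.card ι + 1 := by
  linarith [truncSum_le_card ξ ω, (abs_le.1 (abs_trunc_le_one (ξ i ω))).1]

lemma truncSum_neg (ξ : ι → Ω → ℝ) (ω : Ω) : truncSum (fun i ω => -ξ i ω) ω = -truncSum ξ ω := by
  simp only [truncSum, trunc_neg, Finset.sum_neg_distrib]

variable [MeasurableSpace Ω] {μ : Measure Ω} {ξ : ι → Ω → ℝ}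

/-- Independent centred summands with finite third moments whose variances add up to one: the
setting of the Berry-Esseen theorem. -/
structure IsStdSum (ξ : ι → Ω → ℝ) (μ : Measure Ω) : Prop where
  measurable : ∀ i, Measurable (ξ i)
  indep : iIndepFun ξ μ
  memLp : ∀ i, MemLp (ξ i) 3 μ
  mean : ∀ i, ∫ ω, ξ i ω ∂μ = 0
  var : ∑ i, ∫ ω, ξ i ω ^ 2 ∂μ = 1

/-- The Lyapunov ratio `∑ 𝔼|ξ_i|³`, which bounds the error in the normal approximation of a
standardized sum. -/
noncomputable def lyapunov (ξ : ι → Ω → ℝ) (μ : Measure Ω) : ℝ := ∑ i, ∫ ω, |ξ i ω| ^ 3 ∂μ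

lemma lyapunov_neg (ξ : ι → Ω → ℝ) (μ : Measure Ω) :
    lyapunov (fun i ω => -ξ i ω) μ = lyapunov ξ μ := by
  simp [lyapunov]

namespace IsStdSum

lemma neg (h : IsStdSum ξ μ) : IsStdSum (fun i ω => -ξ i ω) μ where
  measurable i := (h.measurable i).neg
  indep := h.indep.comp (fun _ x => -x) fun _ => measurable_neg
  memLp i := (h.memLp i).neg
  mean i := by rw [integral_neg, h.mean, neg_zero]
  var := by simpa using h.var

lemma isProbabilityMeasure (h : IsStdSum ξ μ) : IsProbabilityMeasure μ :=
  h.indep.isProbabilityMeasure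

lemma memLp_two (h : IsStdSum ξ μ) (i : ι) : MemLp (ξ i) 2 μ := by
  have := h.isProbabilityMeasure
  exact (h.memLp i).mono_exponent (by norm_num)

lemma integrable (h : IsStdSum ξ μ) (i : ι) : Integrable (ξ i) μ := by
  have := h.isProbabilityMeasure
  exact (h.memLp_two i).integrable (by norm_num)

lemma integrable_sq (h : IsStdSum ξ μ) (i : ι) : Integrable (fun ω => ξ i ω ^ 2) μ :=
  (h.memLp_two i).integrable_sq

lemma integrable_cube (h : IsStdSum ξ μ) (i : ι) : Integrable (fun ω => |ξ i ω| ^ 3) μ := by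
  simpa using (h.memLp i).integrable_norm_pow (by norm_num : (3 : ℕ) ≠ 0)

lemma measurable_truncSum (h : IsStdSum ξ μ) : Measurable (truncSum ξ) := by
  have := h.measurable
  unfold truncSum
  fun_prop

-- The factors `exp (2 𝔼 ξ_k²)` multiply to `exp 2` because the variances add up to one.
lemma abs_integral_prod_le (h : IsStdSum ξ μ) {u : ι → ℝ → ℝ} (hu : ∀ k, Measurable (u k))
    {a : ι → ℝ} (hua : ∀ k, |∫ ω, u k (ξ k ω) ∂μ| ≤ a k * exp (2 * ∫ ω, ξ k ω ^ 2 ∂μ)) :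
    |∫ ω, ∏ k, u k (ξ k ω) ∂μ| ≤ (∏ k, a k) * exp 2 := by
  rw [h.indep.integral_fun_prod_comp (fun i => (h.measurable i).aemeasurable)
    (fun i => (hu i).aestronglyMeasurable), Finset.abs_prod]
  refine (Finset.prod_le_prod (fun _ _ => abs_nonneg _) fun k _ => hua k).trans_eq ?_
  rw [Finset.prod_mul_distrib, ← Real.exp_sum, ← Finset.mul_sum, h.var, mul_one]

lemma abs_integral_exp_trunc_le (h : IsStdSum ξ μ) (i : ι) :
    |∫ ω, exp (trunc (ξ i ω)) ∂μ| ≤ exp (2 * ∫ ω, ξ i ω ^ 2 ∂μ) := by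
  have := h.isProbabilityMeasure
  have h_lin : Integrable (fun ω => 1 + ξ i ω) μ := (integrable_const 1).add (h.integrable i)
  have h_sq : Integrable (fun ω => 2 * ξ i ω ^ 2) μ := (h.integrable_sq i).const_mul 2
  rw [abs_of_nonneg (integral_nonneg fun _ => (exp_pos _).le)]
  calc ∫ ω, exp (trunc (ξ i ω)) ∂μ
      ≤ ∫ ω, (1 + ξ i ω + 2 * ξ i ω ^ 2) ∂μ :=
        integral_mono_of_nonneg (.of_forall fun _ => (exp_pos _).le)
          (h_lin.add h_sq) (.of_forall fun ω => exp_trunc_le _)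
    _ = 2 * (∫ ω, ξ i ω ^ 2 ∂μ) + 1 := by
        rw [integral_add h_lin h_sq, integral_add (integrable_const 1) (h.integrable i), h.mean,
          integral_const_mul]
        simp [add_comm]
    _ ≤ _ := Real.add_one_le_exp _

lemma abs_integral_mul_exp_trunc_le (h : IsStdSum ξ μ) (i : ι) :
    |∫ ω, ξ i ω * exp (trunc (ξ i ω)) ∂μ| ≤ 2 * ∫ ω, ξ i ω ^ 2 ∂μ := by
  have hb : Integrable (fun ω => ξ i ω * (exp (trunc (ξ i ω)) - 1)) μ := by
    refine ((h.integrable_sq i).const_mul 2).mono' ?_ (.of_forall fun ω => ?_)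
    · exact (by have := h.measurable i; fun_prop : Measurable _).aestronglyMeasurable
    · exact abs_mul_exp_trunc_sub_one_le _
  have h_center : ∫ ω, ξ i ω * exp (trunc (ξ i ω)) ∂μ
      = ∫ ω, ξ i ω * (exp (trunc (ξ i ω)) - 1) ∂μ := by
    have : (fun ω => ξ i ω * exp (trunc (ξ i ω)))
        = fun ω => ξ i ω * (exp (trunc (ξ i ω)) - 1) + ξ i ω := by ext; ring
    rw [this, integral_add hb (h.integrable i), h.mean, add_zero]
  rw [h_center]
  refine abs_integral_le_integral_abs.trans ?_
  rw [← integral_const_mul]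
  exact integral_mono hb.abs ((h.integrable_sq i).const_mul 2)
    fun ω => abs_mul_exp_trunc_sub_one_le _

lemma abs_integral_sq_mul_exp_trunc_le (h : IsStdSum ξ μ) (i : ι) :
    |∫ ω, ξ i ω ^ 2 * exp (trunc (ξ i ω)) ∂μ| ≤ 3 * ∫ ω, ξ i ω ^ 2 ∂μ := by
  rw [abs_of_nonneg (integral_nonneg fun _ => by positivity), ← integral_const_mul]
  refine integral_mono_of_nonneg (.of_forall fun _ => by positivity)
    ((h.integrable_sq i).const_mul 3) (.of_forall fun ω => ?_)
  exact (mul_le_mul_of_nonneg_left (exp_trunc_le_three _) (sq_nonneg _)).trans_eq (mul_comm _ _)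

lemma integral_exp_truncSum_le (h : IsStdSum ξ μ) : ∫ ω, exp (truncSum ξ ω) ∂μ ≤ exp 2 := by
  have := h.abs_integral_prod_le (u := fun _ s => exp (trunc s)) (a := 1)
    (fun _ => by fun_prop) (fun k => by simpa using h.abs_integral_exp_trunc_le k)
  simp only [truncSum, Real.exp_sum]
  simpa using (le_abs_self _).trans this

lemma integral_exp_truncSum_sub_le (h : IsStdSum ξ μ) (i : ι) :
    ∫ ω, exp (truncSum ξ ω - trunc (ξ i ω)) ∂μ ≤ exp 2 := by
  classical
  have := h.isProbabilityMeasure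
  have key := h.abs_integral_prod_le (u := fun k s => if k = i then 1 else exp (trunc s))
    (a := 1) (fun k => by split_ifs <;> fun_prop) (fun k => by
      by_cases hk : k = i
      · simp only [hk, if_true, integral_const, probReal_univ, Pi.one_apply, one_mul]
        simpa using Real.one_le_exp (by positivity)
      · simpa [hk] using h.abs_integral_exp_trunc_le k)
  have h_prod : ∀ ω, exp (truncSum ξ ω - trunc (ξ i ω))
      = ∏ k, if k = i then 1 else exp (trunc (ξ k ω)) := by
    intro ω
    rw [truncSum, ← Finset.add_sum_erase _ _ (Finset.mem_univ i), add_sub_cancel_left,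
      Real.exp_sum, ← Finset.mul_prod_erase _ _ (Finset.mem_univ i), if_pos rfl, one_mul]
    exact Finset.prod_congr rfl fun k hk => by rw [if_neg (Finset.ne_of_mem_erase hk)]
  simp only [h_prod]
  simpa using (le_abs_self _).trans key

lemma abs_integral_mul_mul_exp_truncSum_le (h : IsStdSum ξ μ) {i j : ι} (hij : i ≠ j) :
    |∫ ω, ξ i ω * ξ j ω * exp (truncSum ξ ω) ∂μ|
      ≤ 4 * (∫ ω, ξ i ω ^ 2 ∂μ) * (∫ ω, ξ j ω ^ 2 ∂μ) * exp 2 := by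
  classical
  have h_exp : ∀ k, 1 ≤ exp (2 * ∫ ω, ξ k ω ^ 2 ∂μ) := fun k => Real.one_le_exp (by positivity)
  have key := h.abs_integral_prod_le
    (u := fun k s => (if k = i then s else 1) * (if k = j then s else 1) * exp (trunc s))
    (a := fun k => (if k = i then 2 * ∫ ω, ξ k ω ^ 2 ∂μ else 1)
      * (if k = j then 2 * ∫ ω, ξ k ω ^ 2 ∂μ else 1))
    (fun k => by split_ifs <;> fun_prop) (fun k => by
      have h_var : 0 ≤ ∫ ω, ξ k ω ^ 2 ∂μ := by positivity
      by_cases hi : k = i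
      · subst hi
        simp only [if_true, hij, if_false, mul_one]
        nlinarith [h.abs_integral_mul_exp_trunc_le k, h_exp k]
      · by_cases hj : k = j
        · subst hj
          simp only [if_true, hi, if_false, one_mul]
          nlinarith [h.abs_integral_mul_exp_trunc_le k, h_exp k]
        · simpa [hi, hj] using h.abs_integral_exp_trunc_le k)
  simp only [Finset.prod_mul_distrib, Finset.prod_ite_eq', Finset.mem_univ, if_true,
    ← Real.exp_sum] at key
  simp only [truncSum]
  convert key using 1
  ring

lemma abs_integral_sq_mul_exp_truncSum_le (h : IsStdSum ξ μ) (i : ι) :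
    |∫ ω, ξ i ω * ξ i ω * exp (truncSum ξ ω) ∂μ| ≤ 3 * (∫ ω, ξ i ω ^ 2 ∂μ) * exp 2 := by
  classical
  have h_exp : ∀ k, 1 ≤ exp (2 * ∫ ω, ξ k ω ^ 2 ∂μ) := fun k => Real.one_le_exp (by positivity)
  have key := h.abs_integral_prod_le
    (u := fun k s => (if k = i then s ^ 2 else 1) * exp (trunc s))
    (a := fun k => if k = i then 3 * ∫ ω, ξ k ω ^ 2 ∂μ else 1)
    (fun k => by split_ifs <;> fun_prop) (fun k => by
      have h_var : 0 ≤ ∫ ω, ξ k ω ^ 2 ∂μ := by positivity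
      by_cases hi : k = i
      · subst hi
        simp only [if_true]
        nlinarith [h.abs_integral_sq_mul_exp_trunc_le k, h_exp k]
      · simpa [hi] using h.abs_integral_exp_trunc_le k)
  simp only [Finset.prod_mul_distrib, Finset.prod_ite_eq', Finset.mem_univ, if_true,
    ← Real.exp_sum] at key
  simpa only [truncSum, sq] using key

lemma integrable_mul_mul_exp_truncSum (h : IsStdSum ξ μ) (i j : ι) :
    Integrable (fun ω => ξ i ω * ξ j ω * exp (truncSum ξ ω)) μ := by
  refine ((h.memLp_two i).integrable_mul (h.memLp_two j)).mul_bdd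
    (c := exp (Fintype.card ι)) h.measurable_truncSum.exp.aestronglyMeasurable
    (.of_forall fun ω => ?_)
  rw [Real.norm_of_nonneg (exp_pos _).le]
  exact Real.exp_le_exp.2 (truncSum_le_card ξ ω)

lemma integral_sum_sq_mul_exp_truncSum_le (h : IsStdSum ξ μ) :
    ∫ ω, (∑ i, ξ i ω) ^ 2 * exp (truncSum ξ ω) ∂μ ≤ 7 * exp 2 := by
  classical
  have h_var : ∀ i, 0 ≤ ∫ ω, ξ i ω ^ 2 ∂μ := fun i => by positivity
  simp only [sq (∑ i, ξ i _), Finset.sum_mul_sum]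
  simp only [Finset.sum_mul]
  rw [integral_finsetSum _ fun i _ => integrable_finsetSum _ fun j _ =>
    h.integrable_mul_mul_exp_truncSum i j]
  simp only [integral_finsetSum _ fun j _ => h.integrable_mul_mul_exp_truncSum _ j]
  calc ∑ i, ∑ j, ∫ ω, ξ i ω * ξ j ω * exp (truncSum ξ ω) ∂μ
      ≤ ∑ i, ∑ j, ((if i = j then 3 * (∫ ω, ξ i ω ^ 2 ∂μ) * exp 2 else 0)
        + 4 * (∫ ω, ξ i ω ^ 2 ∂μ) * (∫ ω, ξ j ω ^ 2 ∂μ) * exp 2) := by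
        refine Finset.sum_le_sum fun i _ => Finset.sum_le_sum fun j _ => ?_
        have h_off : 0 ≤ 4 * (∫ ω, ξ i ω ^ 2 ∂μ) * (∫ ω, ξ j ω ^ 2 ∂μ) * exp 2 :=
          mul_nonneg (mul_nonneg (mul_nonneg zero_le_four (h_var i)) (h_var j)) (exp_pos _).le
        split_ifs with hij
        · subst hij
          linarith [(le_abs_self _).trans (h.abs_integral_sq_mul_exp_truncSum_le i)]
        · rw [zero_add]
          exact (le_abs_self _).trans (h.abs_integral_mul_mul_exp_truncSum_le hij)
    _ = 7 * exp 2 := by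
        simp only [Finset.sum_add_distrib, Finset.sum_ite_eq, Finset.mem_univ, if_true,
          ← Finset.sum_mul, ← Finset.mul_sum, h.var]
        ring

end IsStdSum

end StdSum

/-! ### The randomized concentration inequality -/

section Concentration

variable {Ω ι : Type*} [Fintype ι]

/-- A proxy for the variance of the sum of the `ξ i` whose own fluctuations are at most `δ`. -/
noncomputable def truncSqSum (ξ : ι → Ω → ℝ) (δ : ℝ) (ω : Ω) : ℝ := ∑ i, truncSq δ (ξ i ω)

/-- The weight `exp (truncSum ξ / 2)` restricted to the event that the truncated sum lies within
`|Δ|` of `x`; its mean is the exponentially tilted probability of that event. -/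
noncomputable def tiltedIndicator (ξ : ι → Ω → ℝ) (Δ : Ω → ℝ) (x : ℝ) : Ω → ℝ :=
  {ω | |truncSum ξ ω - x| ≤ |Δ ω|}.indicator fun ω => exp (truncSum ξ ω / 2)

lemma tiltedIndicator_nonneg (ξ : ι → Ω → ℝ) (Δ : Ω → ℝ) (x : ℝ) (ω : Ω) :
    0 ≤ tiltedIndicator ξ Δ x ω :=
  Set.indicator_nonneg (fun _ _ => (exp_pos _).le) ω

lemma tiltedIndicator_le (ξ : ι → Ω → ℝ) (Δ : Ω → ℝ) (x : ℝ) (ω : Ω) :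
    tiltedIndicator ξ Δ x ω ≤ exp (truncSum ξ ω / 2) :=
  Set.indicator_le_self' (fun _ _ => (exp_pos _).le) ω

lemma tiltedIndicator_mul_truncSqSum_le {δ : ℝ} (hδ : 0 ≤ δ) (ξ : ι → Ω → ℝ) (Δ : Ω → ℝ) (x : ℝ)
    (ω : Ω) : tiltedIndicator ξ Δ x ω * truncSqSum ξ δ ω ≤ ∑ i, ξ i ω *
      (tiltClip x δ |Δ ω| (truncSum ξ ω) - tiltClip x δ |Δ ω| (truncSum ξ ω - trunc (ξ i ω))) := by
  by_cases hω : |truncSum ξ ω - x| ≤ |Δ ω|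
  · rw [tiltedIndicator, Set.indicator_of_mem (by exact hω), truncSqSum, Finset.mul_sum]
    exact Finset.sum_le_sum fun i _ => exp_mul_truncSq_le_mul_tiltClip_sub hδ hω _
  · rw [tiltedIndicator, Set.indicator_of_notMem (by exact hω), zero_mul]
    exact Finset.sum_nonneg fun i _ => mul_tiltClip_sub_nonneg hδ (abs_nonneg _) _ _

lemma one_le_sum_cube_add_tiltedIndicator {ξ : ι → Ω → ℝ} {Δ : Ω → ℝ} {x : ℝ} {ω : Ω}
    (h_near : |∑ i, ξ i ω - x| ≤ |Δ ω|) (h_small : |Δ ω| ≤ (x + 1) / 3) :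
    1 ≤ ∑ i, |ξ i ω| ^ 3 + exp (1 + -x / 3) * tiltedIndicator ξ Δ x ω := by
  by_cases hb : ∀ i, |ξ i ω| ≤ 1
  · have h_sum : truncSum ξ ω = ∑ i, ξ i ω :=
      Finset.sum_congr rfl fun i _ => trunc_of_abs_le_one (hb i)
    rw [tiltedIndicator, Set.indicator_of_mem (by simpa [h_sum] using h_near), ← Real.exp_add]
    have h_exponent : 0 ≤ 1 + -x / 3 + truncSum ξ ω / 2 := by
      rw [h_sum]; linarith [(abs_le.1 h_near).1]
    exact (Real.one_le_exp h_exponent).trans (le_add_of_nonneg_left (by positivity))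
  · push Not at hb
    obtain ⟨i, hi⟩ := hb
    calc 1 ≤ |ξ i ω| ^ 3 := one_le_pow₀ hi.le
      _ ≤ ∑ i, |ξ i ω| ^ 3 := Finset.single_le_sum (f := fun i => |ξ i ω| ^ 3)
          (fun _ _ => by positivity) (Finset.mem_univ i)
      _ ≤ _ := le_add_of_nonneg_right (mul_nonneg (exp_pos _).le (tiltedIndicator_nonneg _ _ _ _))

lemma fourteen_mul_exp_two_mul_exp_le (x : ℝ) : 14 * exp 2 * exp (-|x| / 3) ≤ 105 := by
  have h_two : exp 2 ≤ 15 / 2 := by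
    rw [show (2 : ℝ) = 1 + 1 by norm_num, Real.exp_add]
    nlinarith [Real.exp_one_lt_d9, exp_pos 1]
  have h_le : exp (-|x| / 3) ≤ 1 := Real.exp_le_one_iff.2 (by linarith [abs_nonneg x])
  nlinarith [exp_pos 2]

variable [MeasurableSpace Ω] {μ : Measure Ω} {ξ : ι → Ω → ℝ} {Δ : Ω → ℝ} {Δ' : ι → Ω → ℝ}
  {δ : ℝ}

/-- `Δ' i` is a leave-one-out version of the perturbation `Δ`: it is independent of `ξ i`, jointly
with the truncated sum of the other summands. -/
structure IsLeaveOneOut (ξ : ι → Ω → ℝ) (Δ : Ω → ℝ) (Δ' : ι → Ω → ℝ) (μ : Measure Ω) : Prop where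
  measurable : Measurable Δ
  measurable_loo : ∀ i, Measurable (Δ' i)
  memLp : MemLp Δ 2 μ
  memLp_loo : ∀ i, MemLp (Δ' i) 2 μ
  indep : ∀ i, IndepFun (ξ i) (fun ω => (truncSum ξ ω - trunc (ξ i ω), Δ' i ω)) μ

/-- The size of a perturbation `Δ` as it enters Berry-Esseen bounds for nonlinear statistics:
`‖Δ‖₂ + ∑ ‖ξ_i‖₂ ‖Δ - Δ'_i‖₂`. -/
noncomputable def looError (ξ : ι → Ω → ℝ) (Δ : Ω → ℝ) (Δ' : ι → Ω → ℝ) (μ : Measure Ω) : ℝ :=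
  √(∫ ω, Δ ω ^ 2 ∂μ) + ∑ i, √(∫ ω, ξ i ω ^ 2 ∂μ) * √(∫ ω, (Δ ω - Δ' i ω) ^ 2 ∂μ)

lemma looError_nonneg (ξ : ι → Ω → ℝ) (Δ : Ω → ℝ) (Δ' : ι → Ω → ℝ) (μ : Measure Ω) :
    0 ≤ looError ξ Δ Δ' μ := by
  unfold looError; positivity

lemma looError_neg (ξ : ι → Ω → ℝ) (Δ : Ω → ℝ) (Δ' : ι → Ω → ℝ) (μ : Measure Ω) :
    looError (fun i ω => -ξ i ω) Δ Δ' μ = looError ξ Δ Δ' μ := by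
  simp [looError]

lemma IsLeaveOneOut.neg (hΔ : IsLeaveOneOut ξ Δ Δ' μ) :
    IsLeaveOneOut (fun i ω => -ξ i ω) Δ Δ' μ where
  __ := hΔ
  indep i := by
    refine ((hΔ.indep i).comp (φ := fun s => -s) (ψ := fun q : ℝ × ℝ => (-q.1, q.2))
      measurable_neg (by fun_prop)).congr .rfl (.of_forall fun ω => ?_)
    simp only [Function.comp_def, truncSum_neg, trunc_neg]
    congr 1; ring

namespace IsStdSum

lemma memLp_truncSq (h : IsStdSum ξ μ) (hδ : 0 ≤ δ) (i : ι) :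
    MemLp (fun ω => truncSq δ (ξ i ω)) 2 μ := by
  refine ((h.memLp_two i).abs.const_mul δ).mono' ?_ (.of_forall fun ω => ?_)
  · exact ((measurable_truncSq δ).comp (h.measurable i)).aestronglyMeasurable
  · rw [Real.norm_of_nonneg (truncSq_nonneg hδ _)]
    exact truncSq_le hδ _

lemma memLp_truncSqSum (h : IsStdSum ξ μ) (hδ : 0 ≤ δ) : MemLp (truncSqSum ξ δ) 2 μ :=
  memLp_finsetSum Finset.univ fun i _ => h.memLp_truncSq hδ i

lemma half_le_integral_truncSqSum (h : IsStdSum ξ μ) (hδ0 : 0 < δ) (hδ : lyapunov ξ μ ≤ δ)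
    (hδ4 : δ ≤ 1 / 4) : 1 / 2 ≤ ∫ ω, truncSqSum ξ δ ω ∂μ := by
  have := h.isProbabilityMeasure
  unfold truncSqSum
  rw [integral_finsetSum _ fun i _ => (h.memLp_truncSq hδ0.le i).integrable one_le_two]
  have h_term : ∀ i, (∫ ω, ξ i ω ^ 2 ∂μ) - (1 + 1 / (4 * δ)) * ∫ ω, |ξ i ω| ^ 3 ∂μ
      ≤ ∫ ω, truncSq δ (ξ i ω) ∂μ := by
    intro i
    have h_cube := (h.integrable_cube i).const_mul (1 + 1 / (4 * δ))
    rw [← integral_const_mul, ← integral_sub (h.integrable_sq i) h_cube]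
    exact integral_mono ((h.integrable_sq i).sub h_cube)
      ((h.memLp_truncSq hδ0.le i).integrable one_le_two) fun ω => le_truncSq hδ0 _
  have h_sum := Finset.sum_le_sum fun i (_ : i ∈ Finset.univ) => h_term i
  rw [Finset.sum_sub_distrib, h.var, ← Finset.mul_sum] at h_sum
  refine le_trans ?_ h_sum
  have h_le : (1 + 1 / (4 * δ)) * lyapunov ξ μ ≤ δ + 1 / 4 :=
    (by gcongr : _ ≤ (1 + 1 / (4 * δ)) * δ).trans_eq (by field_simp)
  unfold lyapunov at h_le
  linarith

lemma integral_truncSqSum_sub_sq_le (h : IsStdSum ξ μ) (hδ : 0 ≤ δ) :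
    ∫ ω, (truncSqSum ξ δ ω - ∫ ω', truncSqSum ξ δ ω' ∂μ) ^ 2 ∂μ ≤ δ ^ 2 := by
  have := h.isProbabilityMeasure
  have h_fun : truncSqSum ξ δ = ∑ i, fun ω => truncSq δ (ξ i ω) := by
    ext ω; simp [truncSqSum]
  rw [← variance_eq_integral (h.memLp_truncSqSum hδ).aemeasurable, h_fun,
    IndepFun.variance_sum fun i _ => h.memLp_truncSq hδ i]
  · have h_term : ∀ i, Var[fun ω => truncSq δ (ξ i ω); μ] ≤ δ ^ 2 * ∫ ω, ξ i ω ^ 2 ∂μ := by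
      intro i
      refine (variance_le_expectation_sq (h.memLp_truncSq hδ i).aestronglyMeasurable).trans ?_
      rw [← integral_const_mul]
      refine integral_mono (h.memLp_truncSq hδ i).integrable_sq
        ((h.integrable_sq i).const_mul _) fun ω => ?_
      simp only [Pi.pow_apply]
      rw [← sq_abs (ξ i ω), ← mul_pow]
      exact pow_le_pow_left₀ (truncSq_nonneg hδ _) (truncSq_le hδ _) 2
    refine (Finset.sum_le_sum fun i _ => h_term i).trans_eq ?_
    rw [← Finset.mul_sum, h.var, mul_one]
  · exact fun i _ j _ hij =>
      (h.indep.indepFun hij).comp (measurable_truncSq δ) (measurable_truncSq δ)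

lemma measurable_truncSum_sub (h : IsStdSum ξ μ) (i : ι) :
    Measurable fun ω => truncSum ξ ω - trunc (ξ i ω) :=
  h.measurable_truncSum.sub (measurable_trunc.comp (h.measurable i))

lemma memLp_exp_half_truncSum (h : IsStdSum ξ μ) :
    MemLp (fun ω => exp (truncSum ξ ω / 2)) 2 μ := by
  have := h.isProbabilityMeasure
  simpa using memLp_mul_exp_half (memLp_const (1 : ℝ)) h.measurable_truncSum (truncSum_le_card ξ)

lemma memLp_tiltedIndicator (h : IsStdSum ξ μ) (hΔ : Measurable Δ) (x : ℝ) :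
    MemLp (tiltedIndicator ξ Δ x) 2 μ := by
  have h_meas := h.measurable_truncSum
  refine h.memLp_exp_half_truncSum.mono' ?_ (.of_forall fun ω => ?_)
  · exact ((h_meas.div_const 2).exp.indicator
      (measurableSet_le (by fun_prop) (by fun_prop))).aestronglyMeasurable
  · rw [Real.norm_of_nonneg (tiltedIndicator_nonneg _ _ _ _)]
    exact tiltedIndicator_le _ _ _ _

lemma integral_tiltedIndicator_le (h : IsStdSum ξ μ) (hδ0 : 0 < δ) (hδ : lyapunov ξ μ ≤ δ)
    (hδ4 : δ ≤ 1 / 4) (hΔ : Measurable Δ) (x : ℝ) :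
    1 / 2 * ∫ ω, tiltedIndicator ξ Δ x ω ∂μ
      ≤ ∫ ω, tiltedIndicator ξ Δ x ω * truncSqSum ξ δ ω ∂μ + exp 1 * δ := by
  have := h.isProbabilityMeasure
  set I := tiltedIndicator ξ Δ x
  set Y := truncSqSum ξ δ
  set EY := ∫ ω, Y ω ∂μ
  have hI : MemLp I 2 μ := h.memLp_tiltedIndicator hΔ x
  have hY : MemLp Y 2 μ := h.memLp_truncSqSum hδ0.le
  have hYc : MemLp (fun ω => Y ω - EY) 2 μ := hY.sub (memLp_const EY)
  have h_fluct : -∫ ω, I ω * (Y ω - EY) ∂μ ≤ exp 1 * δ := by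
    calc -∫ ω, I ω * (Y ω - EY) ∂μ
        ≤ ∫ ω, |exp (truncSum ξ ω / 2) * (Y ω - EY)| ∂μ := by
          rw [← integral_neg]
          refine integral_mono (integrable_fun_mul hI hYc).neg
            (integrable_fun_mul h.memLp_exp_half_truncSum hYc).abs fun ω => ?_
          refine (neg_le_abs _).trans ?_
          rw [abs_mul, abs_mul, abs_of_nonneg (tiltedIndicator_nonneg _ _ _ _), Real.abs_exp]
          exact mul_le_mul_of_nonneg_right (tiltedIndicator_le _ _ _ _) (abs_nonneg _)
      _ ≤ √(∫ ω, exp (truncSum ξ ω / 2) ^ 2 ∂μ) * √(∫ ω, (Y ω - EY) ^ 2 ∂μ) :=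
          integral_abs_mul_le_sqrt_mul_sqrt h.memLp_exp_half_truncSum hYc
      _ ≤ exp 1 * δ := mul_le_mul (sqrt_integral_exp_half_sq_le h.integral_exp_truncSum_le)
          ((Real.sqrt_le_left hδ0.le).2 (h.integral_truncSqSum_sub_sq_le hδ0.le))
          (Real.sqrt_nonneg _) (exp_pos _).le
  have h_split : ∫ ω, I ω * (Y ω - EY) ∂μ = ∫ ω, I ω * Y ω ∂μ - EY * ∫ ω, I ω ∂μ := by
    simp only [mul_sub]
    rw [integral_sub (integrable_fun_mul hI hY) ((hI.integrable one_le_two).mul_const _),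
      integral_mul_const, mul_comm EY]
  have h_half := mul_le_mul_of_nonneg_right (h.half_le_integral_truncSqSum hδ0 hδ hδ4)
    (integral_nonneg (tiltedIndicator_nonneg ξ Δ x) : 0 ≤ ∫ ω, I ω ∂μ)
  linarith

lemma memLp_tiltClip_truncSum (h : IsStdSum ξ μ) (hδ : 0 ≤ δ) (hΔm : Measurable Δ)
    (hΔ : MemLp Δ 2 μ) (x : ℝ) :
    MemLp (fun ω => tiltClip x δ |Δ ω| (truncSum ξ ω)) 2 μ := by
  have := h.isProbabilityMeasure
  exact memLp_tiltClip hδ h.measurable_truncSum (truncSum_le_card ξ) hΔm hΔ x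

lemma memLp_tiltClip_truncSum_sub (h : IsStdSum ξ μ) (hδ : 0 ≤ δ) (hΔm : Measurable Δ)
    (hΔ : MemLp Δ 2 μ) (x : ℝ) (i : ι) :
    MemLp (fun ω => tiltClip x δ |Δ ω| (truncSum ξ ω - trunc (ξ i ω))) 2 μ := by
  have := h.isProbabilityMeasure
  exact memLp_tiltClip hδ (h.measurable_truncSum_sub i) (truncSum_sub_le_card_add_one ξ i) hΔm hΔ x

lemma integral_mul_tiltClip_loo (h : IsStdSum ξ μ) (hΔ : IsLeaveOneOut ξ Δ Δ' μ) (x : ℝ)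
    (i : ι) : ∫ ω, ξ i ω * tiltClip x δ |Δ' i ω| (truncSum ξ ω - trunc (ξ i ω)) ∂μ = 0 := by
  have h_clip : Measurable fun q : ℝ × ℝ => tiltClip x δ |q.2| q.1 :=
    (continuous_tiltClip x δ).measurable.comp (measurable_snd.abs.prodMk measurable_fst)
  have h_indep := (hΔ.indep i).comp (φ := id) measurable_id h_clip
  have h_prod := h_indep.integral_fun_mul_eq_mul_integral (h.integrable i).aestronglyMeasurable
    (h_clip.comp ((h.measurable_truncSum_sub i).prodMk
      (hΔ.measurable_loo i))).aestronglyMeasurable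
  simp only [Function.comp_def, id] at h_prod
  rw [h_prod, h.mean, zero_mul]

lemma sqrt_integral_mul_exp_half_truncSum_sub_sq_le (h : IsStdSum ξ μ)
    (hΔ : IsLeaveOneOut ξ Δ Δ' μ) (i : ι) :
    √(∫ ω, (ξ i ω * exp ((truncSum ξ ω - trunc (ξ i ω)) / 2)) ^ 2 ∂μ)
      ≤ √(∫ ω, ξ i ω ^ 2 ∂μ) * exp 1 := by
  have h_indep := (hΔ.indep i).comp (φ := fun s => s ^ 2)
    (ψ := fun q : ℝ × ℝ => exp (q.1 / 2) ^ 2) (by fun_prop) (by fun_prop)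
  have h_prod := h_indep.integral_fun_mul_eq_mul_integral (h.integrable_sq i).aestronglyMeasurable
    (((h.measurable_truncSum_sub i).div_const 2).exp.pow_const 2).aestronglyMeasurable
  simp only [Function.comp_def] at h_prod
  simp only [mul_pow]
  rw [h_prod, Real.sqrt_mul (by positivity)]
  exact mul_le_mul_of_nonneg_left
    (sqrt_integral_exp_half_sq_le (h.integral_exp_truncSum_sub_le i)) (Real.sqrt_nonneg _)

lemma neg_integral_mul_tiltClip_le (h : IsStdSum ξ μ) (hδ : 0 ≤ δ)
    (hΔ : IsLeaveOneOut ξ Δ Δ' μ) (x : ℝ) (i : ι) :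
    -∫ ω, ξ i ω * tiltClip x δ |Δ ω| (truncSum ξ ω - trunc (ξ i ω)) ∂μ
      ≤ 2 * exp 1 * (√(∫ ω, ξ i ω ^ 2 ∂μ) * √(∫ ω, (Δ ω - Δ' i ω) ^ 2 ∂μ)) := by
  set S := fun ω => truncSum ξ ω - trunc (ξ i ω)
  have h_clip := h.memLp_tiltClip_truncSum_sub hδ hΔ.measurable hΔ.memLp x i
  have h_clip' := h.memLp_tiltClip_truncSum_sub hδ (hΔ.measurable_loo i) (hΔ.memLp_loo i) x i
  have h_diff : MemLp (fun ω => Δ ω - Δ' i ω) 2 μ := hΔ.memLp.sub (hΔ.memLp_loo i)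
  have h_tilt := memLp_mul_exp_half (h.memLp_two i) (h.measurable_truncSum_sub i)
    (truncSum_sub_le_card_add_one ξ i)
  calc -∫ ω, ξ i ω * tiltClip x δ |Δ ω| (S ω) ∂μ
      = ∫ ω, ξ i ω * (tiltClip x δ |Δ' i ω| (S ω) - tiltClip x δ |Δ ω| (S ω)) ∂μ := by
        simp only [mul_sub]
        rw [integral_sub (integrable_fun_mul (h.memLp_two i) h_clip')
          (integrable_fun_mul (h.memLp_two i) h_clip), h.integral_mul_tiltClip_loo hΔ, zero_sub]
    _ ≤ ∫ ω, 2 * |ξ i ω * exp (S ω / 2) * (Δ ω - Δ' i ω)| ∂μ := by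
        refine integral_mono (integrable_fun_mul (h.memLp_two i) (h_clip'.sub h_clip))
          ((integrable_fun_mul h_tilt h_diff).abs.const_mul 2) fun ω => ?_
        refine (le_abs_self _).trans ?_
        simp only [abs_mul, Real.abs_exp]
        have h_abs : |(|Δ' i ω| - |Δ ω|)| ≤ |Δ ω - Δ' i ω| :=
          (abs_abs_sub_abs_le_abs_sub _ _).trans_eq (abs_sub_comm _ _)
        have h_lip : |tiltClip x δ |Δ' i ω| (S ω) - tiltClip x δ |Δ ω| (S ω)|
            ≤ exp (S ω / 2) * (2 * |Δ ω - Δ' i ω|) :=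
          (abs_tiltClip_sub_le _ _ _ _ _).trans (by gcongr)
        linarith [mul_le_mul_of_nonneg_left h_lip (abs_nonneg (ξ i ω))]
    _ ≤ 2 * ((√(∫ ω, ξ i ω ^ 2 ∂μ) * exp 1) * √(∫ ω, (Δ ω - Δ' i ω) ^ 2 ∂μ)) := by
        rw [integral_const_mul]
        exact mul_le_mul_of_nonneg_left ((integral_abs_mul_le_sqrt_mul_sqrt h_tilt h_diff).trans
          (mul_le_mul_of_nonneg_right (h.sqrt_integral_mul_exp_half_truncSum_sub_sq_le hΔ i)
            (Real.sqrt_nonneg _))) zero_le_two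
    _ = _ := by ring

lemma memLp_sum (h : IsStdSum ξ μ) : MemLp (fun ω => ∑ i, ξ i ω) 2 μ :=
  memLp_finsetSum Finset.univ fun i _ => h.memLp_two i

lemma sqrt_integral_sum_mul_exp_half_sq_le (h : IsStdSum ξ μ) :
    √(∫ ω, ((∑ i, ξ i ω) * exp (truncSum ξ ω / 2)) ^ 2 ∂μ) ≤ 3 * exp 1 := by
  simp only [mul_pow, exp_half_sq]
  rw [Real.sqrt_le_left (by positivity)]
  refine h.integral_sum_sq_mul_exp_truncSum_le.trans ?_
  rw [mul_pow, ← Real.exp_nat_mul]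
  norm_num [exp_pos]

lemma integral_sum_mul_tiltClip_le (h : IsStdSum ξ μ) (hδ : 0 ≤ δ) (hΔm : Measurable Δ)
    (hΔ : MemLp Δ 2 μ) (x : ℝ) :
    ∫ ω, (∑ i, ξ i ω) * tiltClip x δ |Δ ω| (truncSum ξ ω) ∂μ
      ≤ 6 * exp 1 * (√(∫ ω, Δ ω ^ 2 ∂μ) + δ) := by
  have := h.isProbabilityMeasure
  set V := fun ω => (∑ i, ξ i ω) * exp (truncSum ξ ω / 2)
  have hV : MemLp V 2 μ := memLp_mul_exp_half h.memLp_sum h.measurable_truncSum (truncSum_le_card ξ)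
  have hV1 : Integrable (fun ω => 2 * δ * |V ω|) μ :=
    (hV.integrable one_le_two).abs.const_mul (2 * δ)
  have hVΔ : Integrable (fun ω => 2 * |V ω * Δ ω|) μ := (integrable_fun_mul hV hΔ).abs.const_mul 2
  calc ∫ ω, (∑ i, ξ i ω) * tiltClip x δ |Δ ω| (truncSum ξ ω) ∂μ
      ≤ ∫ ω, (2 * |V ω * Δ ω| + 2 * δ * |V ω|) ∂μ := by
        refine integral_mono (integrable_fun_mul h.memLp_sum
          (h.memLp_tiltClip_truncSum hδ hΔm hΔ x)) (hVΔ.add hV1) fun ω => ?_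
        refine (le_abs_self _).trans ?_
        simp only [V, abs_mul, Real.abs_exp]
        rw [abs_of_nonneg (tiltClip_nonneg hδ (abs_nonneg _))]
        linarith [mul_le_mul_of_nonneg_left (tiltClip_le x δ |Δ ω| (truncSum ξ ω))
          (abs_nonneg (∑ i, ξ i ω))]
    _ ≤ 2 * (3 * exp 1 * √(∫ ω, Δ ω ^ 2 ∂μ)) + 2 * δ * (3 * exp 1) := by
        have h_sqrt : √(∫ ω, V ω ^ 2 ∂μ) ≤ 3 * exp 1 := h.sqrt_integral_sum_mul_exp_half_sq_le
        rw [integral_add hVΔ hV1, integral_const_mul, integral_const_mul]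
        gcongr
        · exact (integral_abs_mul_le_sqrt_mul_sqrt hV hΔ).trans (by gcongr)
        · exact (integral_abs_le_sqrt hV).trans h_sqrt
    _ = _ := by ring

lemma integral_tiltedIndicator_mul_truncSqSum_le (h : IsStdSum ξ μ) (hδ : 0 ≤ δ)
    (hΔ : IsLeaveOneOut ξ Δ Δ' μ) (x : ℝ) :
    ∫ ω, tiltedIndicator ξ Δ x ω * truncSqSum ξ δ ω ∂μ
      ≤ 6 * exp 1 * (√(∫ ω, Δ ω ^ 2 ∂μ) + δ)
      + 2 * exp 1 * ∑ i, √(∫ ω, ξ i ω ^ 2 ∂μ) * √(∫ ω, (Δ ω - Δ' i ω) ^ 2 ∂μ) := by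
  set f := fun ω => tiltClip x δ |Δ ω| (truncSum ξ ω)
  set f' := fun i ω => tiltClip x δ |Δ ω| (truncSum ξ ω - trunc (ξ i ω))
  have hf : MemLp f 2 μ := h.memLp_tiltClip_truncSum hδ hΔ.measurable hΔ.memLp x
  have hf' : ∀ i, MemLp (f' i) 2 μ :=
    h.memLp_tiltClip_truncSum_sub hδ hΔ.measurable hΔ.memLp x
  have h_int : ∀ i, Integrable (fun ω => ξ i ω * (f ω - f' i ω)) μ := fun i =>
    integrable_fun_mul (h.memLp_two i) (hf.sub (hf' i))
  calc ∫ ω, tiltedIndicator ξ Δ x ω * truncSqSum ξ δ ω ∂μ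
      ≤ ∫ ω, ∑ i, ξ i ω * (f ω - f' i ω) ∂μ :=
        integral_mono (integrable_fun_mul (h.memLp_tiltedIndicator hΔ.measurable x)
          (h.memLp_truncSqSum hδ)) (integrable_finsetSum _ fun i _ => h_int i)
          (tiltedIndicator_mul_truncSqSum_le hδ ξ Δ x)
    _ = ∑ i, (∫ ω, ξ i ω * f ω ∂μ + -∫ ω, ξ i ω * f' i ω ∂μ) := by
        rw [integral_finsetSum _ fun i _ => h_int i]
        refine Finset.sum_congr rfl fun i _ => ?_
        simp only [mul_sub]
        rw [integral_sub (integrable_fun_mul (h.memLp_two i) hf)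
          (integrable_fun_mul (h.memLp_two i) (hf' i)), sub_eq_add_neg]
    _ ≤ _ := by
        rw [Finset.sum_add_distrib, Finset.mul_sum,
          ← integral_finsetSum _ fun i _ => integrable_fun_mul (h.memLp_two i) hf]
        simp only [← Finset.sum_mul]
        exact add_le_add (h.integral_sum_mul_tiltClip_le hδ hΔ.measurable hΔ.memLp x)
          (Finset.sum_le_sum fun i _ => h.neg_integral_mul_tiltClip_le hδ hΔ x i)

theorem tilted_concentration (h : IsStdSum ξ μ) (hδ0 : 0 < δ) (hδ : lyapunov ξ μ ≤ δ)
    (hδ4 : δ ≤ 1 / 4) (hΔ : IsLeaveOneOut ξ Δ Δ' μ) (x : ℝ) :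
    ∫ ω, tiltedIndicator ξ Δ x ω ∂μ ≤ 14 * exp 1 * (looError ξ Δ Δ' μ + δ) := by
  have h_half := h.integral_tiltedIndicator_le hδ0 hδ hδ4 hΔ.measurable x
  have h_up := h.integral_tiltedIndicator_mul_truncSqSum_le hδ0.le hΔ x
  have h_norm : 0 ≤ exp 1 * √(∫ ω, Δ ω ^ 2 ∂μ) := by positivity
  have h_loo : 0 ≤ exp 1 *
      ∑ i, √(∫ ω, ξ i ω ^ 2 ∂μ) * √(∫ ω, (Δ ω - Δ' i ω) ^ 2 ∂μ) := by positivity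
  unfold looError
  linarith

lemma measurable_sum (h : IsStdSum ξ μ) : Measurable fun ω => ∑ i, ξ i ω :=
  Finset.measurable_fun_sum _ fun i _ => h.measurable i

lemma concentration_of_nonneg (h : IsStdSum ξ μ) (hδ0 : 0 < δ) (hδ : lyapunov ξ μ ≤ δ)
    (hδ4 : δ ≤ 1 / 4) (hΔ : IsLeaveOneOut ξ Δ Δ' μ) (x : ℝ) :
    μ.real {ω | |∑ i, ξ i ω - x| ≤ |Δ ω| ∧ |Δ ω| ≤ (x + 1) / 3}
      ≤ δ + 14 * exp 2 * exp (-x / 3) * (looError ξ Δ Δ' μ + δ) := by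
  have := h.isProbabilityMeasure
  have h_sum := h.measurable_sum
  have h_meas := hΔ.measurable
  have h_cube : Integrable (fun ω => ∑ i, |ξ i ω| ^ 3) μ :=
    integrable_finsetSum _ fun i _ => h.integrable_cube i
  have h_tilt : Integrable (fun ω => exp (1 + -x / 3) * tiltedIndicator ξ Δ x ω) μ :=
    ((h.memLp_tiltedIndicator hΔ.measurable x).integrable one_le_two).const_mul _
  calc μ.real {ω | |∑ i, ξ i ω - x| ≤ |Δ ω| ∧ |Δ ω| ≤ (x + 1) / 3}
      ≤ ∫ ω, (∑ i, |ξ i ω| ^ 3 + exp (1 + -x / 3) * tiltedIndicator ξ Δ x ω) ∂μ := by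
        refine measureReal_le_integral ?_ (h_cube.add h_tilt) (fun ω => ?_)
          fun ω hω => one_le_sum_cube_add_tiltedIndicator hω.1 hω.2
        · exact (measurableSet_le (f := fun ω => |∑ i, ξ i ω - x|) (g := fun ω => |Δ ω|)
            (by fun_prop) (by fun_prop)).inter
            (measurableSet_le (f := fun ω => |Δ ω|) (by fun_prop) measurable_const)
        · have := tiltedIndicator_nonneg ξ Δ x ω
          positivity
    _ = lyapunov ξ μ + exp (1 + -x / 3) * ∫ ω, tiltedIndicator ξ Δ x ω ∂μ := by
        rw [integral_add h_cube h_tilt, integral_const_mul,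
          integral_finsetSum _ fun i _ => h.integrable_cube i, lyapunov]
    _ ≤ δ + exp (1 + -x / 3) * (14 * exp 1 * (looError ξ Δ Δ' μ + δ)) := by
        gcongr
        exact h.tilted_concentration hδ0 hδ hδ4 hΔ x
    _ = _ := by
        rw [show (2 : ℝ) = 1 + 1 by norm_num, Real.exp_add 1 1, Real.exp_add]; ring

theorem concentration (h : IsStdSum ξ μ) (hδ0 : 0 < δ) (hδ : lyapunov ξ μ ≤ δ)
    (hδ4 : δ ≤ 1 / 4) (hΔ : IsLeaveOneOut ξ Δ Δ' μ) (x : ℝ) :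
    μ.real {ω | |∑ i, ξ i ω - x| ≤ |Δ ω| ∧ |Δ ω| ≤ (|x| + 1) / 3}
      ≤ δ + 14 * exp 2 * exp (-|x| / 3) * (looError ξ Δ Δ' μ + δ) := by
  rcases le_total 0 x with hx | hx
  · rw [abs_of_nonneg hx]
    exact h.concentration_of_nonneg hδ0 hδ hδ4 hΔ x
  · rw [abs_of_nonpos hx, ← looError_neg]
    have key := h.neg.concentration_of_nonneg hδ0 (by rwa [lyapunov_neg]) hδ4 hΔ.neg (-x)
    have h_abs : ∀ ω, |∑ i, -ξ i ω - -x| = |∑ i, ξ i ω - x| := fun ω => by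
      rw [Finset.sum_neg_distrib, ← neg_sub', abs_neg]
    simpa only [h_abs] using key

lemma indepFun_comp_erase [DecidableEq ι] (h : IsStdSum ξ μ) (i : ι) {α : Type*}
    [MeasurableSpace α] {F : ({j // j ∈ Finset.univ.erase i} → ℝ) → α} (hF : Measurable F) :
    IndepFun (ξ i) (fun ω => F fun j => ξ j ω) μ := by
  have h_indep := h.indep.indepFun_finset {i} (Finset.univ.erase i) (by simp) h.measurable
  have h_eval : Measurable fun q : {j // j ∈ ({i} : Finset ι)} → ℝ =>
      q ⟨i, Finset.mem_singleton_self i⟩ := measurable_pi_apply _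
  exact h_indep.comp h_eval hF

lemma indepFun_truncSum_sub (h : IsStdSum ξ μ) (i : ι) (c : ℝ) :
    IndepFun (ξ i) (fun ω => (truncSum ξ ω - trunc (ξ i ω), c)) μ := by
  classical
  have h_indep := h.indepFun_comp_erase i (F := fun q => (∑ j, trunc (q j), c)) (by fun_prop)
  refine h_indep.congr .rfl (.of_forall fun ω => ?_)
  simp only [truncSum]
  rw [← Finset.add_sum_erase _ _ (Finset.mem_univ i), add_sub_cancel_left,
    Finset.sum_coe_sort (Finset.univ.erase i) fun j => trunc (ξ j ω)]

lemma indepFun_sum_sub (h : IsStdSum ξ μ) (i : ι) :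
    IndepFun (ξ i) (fun ω => ∑ j, ξ j ω - ξ i ω) μ := by
  classical
  have h_indep := h.indepFun_comp_erase i (F := fun q => ∑ j, q j) (by fun_prop)
  refine h_indep.congr .rfl (.of_forall fun ω => ?_)
  simp only
  rw [← Finset.add_sum_erase _ _ (Finset.mem_univ i), add_sub_cancel_left,
    Finset.sum_coe_sort (Finset.univ.erase i) fun j => ξ j ω]

lemma isLeaveOneOut_const (h : IsStdSum ξ μ) (d : ℝ) :
    IsLeaveOneOut ξ (fun _ => d) (fun _ _ => d) μ := by
  have := h.isProbabilityMeasure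
  exact ⟨measurable_const, fun _ => measurable_const, memLp_const d, fun _ => memLp_const d,
    fun i => h.indepFun_truncSum_sub i d⟩

theorem uniform_concentration (h : IsStdSum ξ μ) (hδ0 : 0 < δ) (hδ : lyapunov ξ μ ≤ δ) (x : ℝ)
    {d : ℝ} (hd : 0 ≤ d) : μ.real {ω | |∑ i, ξ i ω - x| ≤ d} ≤ 110 * (d + δ) := by
  have := h.isProbabilityMeasure
  by_cases hδ4 : δ ≤ 1 / 4
  swap
  · exact measureReal_le_one.trans (by linarith [not_le.1 hδ4])
  by_cases hd3 : d ≤ 1 / 3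
  swap
  · exact measureReal_le_one.trans (by linarith [not_le.1 hd3])
  have h_loo : looError ξ (fun _ => d) (fun _ _ => d) μ = d := by
    simp [looError, Real.sqrt_sq hd]
  have key := h.concentration hδ0 hδ hδ4 (h.isLeaveOneOut_const d) x
  rw [h_loo] at key
  have h_small : d ≤ (|x| + 1) / 3 := by linarith [abs_nonneg x]
  simp only [abs_of_nonneg hd, h_small, and_true] at key
  nlinarith [fourteen_mul_exp_two_mul_exp_le x]

lemma half_le_measureReal_abs_le (h : IsStdSum ξ μ) (hδ0 : 0 < δ) {i : ι}
    (hi : ∫ ω, |ξ i ω| ∂μ ≤ δ) : 1 / 2 ≤ μ.real {ω | |ξ i ω| ≤ 2 * δ} := by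
  have := h.isProbabilityMeasure
  have h_meas := h.measurable i
  have h_markov := mul_meas_ge_le_integral_of_nonneg (μ := μ) (f := fun ω => |ξ i ω|)
    (.of_forall fun ω => abs_nonneg _) (h.integrable i).abs (2 * δ)
  have h_compl : {ω | |ξ i ω| ≤ 2 * δ} = {ω | 2 * δ < |ξ i ω|}ᶜ := by ext; simp
  rw [h_compl, probReal_compl_eq_one_sub (measurableSet_lt (by fun_prop) (by fun_prop))]
  have h_le : μ.real {ω | 2 * δ < |ξ i ω|} ≤ μ.real {ω | 2 * δ ≤ |ξ i ω|} :=
    measureReal_mono fun ω hω => (show 2 * δ < |ξ i ω| from hω).le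
  nlinarith

end IsStdSum

lemma measureReal_mul_measureReal_le_of_indepFun [IsFiniteMeasure μ] {X Y : Ω → ℝ}
    (hXY : IndepFun X Y μ) (x a d : ℝ) :
    μ.real {ω | |X ω| ≤ a} * μ.real {ω | |Y ω - x| ≤ d}
      ≤ μ.real {ω | |Y ω + X ω - x| ≤ d + a} := by
  have h_prod := hXY.measure_inter_preimage_eq_mul {s | |s| ≤ a} {w | |w - x| ≤ d}
    (measurableSet_le (by fun_prop) (by fun_prop)) (measurableSet_le (by fun_prop) (by fun_prop))
  have h_real := congrArg ENNReal.toReal h_prod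
  rw [ENNReal.toReal_mul] at h_real
  refine h_real.ge.trans (measureReal_mono fun ω ⟨hX, hY⟩ => ?_)
  simp only [Set.mem_preimage, Set.mem_ofPred_eq] at hX hY ⊢
  calc |Y ω + X ω - x| = |Y ω - x + X ω| := by ring_nf
    _ ≤ d + a := (abs_add_le _ _).trans (add_le_add hY hX)

theorem IsStdSum.uniform_concentration_sub (h : IsStdSum ξ μ) (hδ0 : 0 < δ)
    (hδ : lyapunov ξ μ ≤ δ) {i : ι} (hi : ∫ ω, |ξ i ω| ∂μ ≤ δ) (x : ℝ) {d : ℝ} (hd : 0 ≤ d) :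
    μ.real {ω | |∑ j, ξ j ω - ξ i ω - x| ≤ d} ≤ 660 * (d + δ) := by
  have := h.isProbabilityMeasure
  have h_half := h.half_le_measureReal_abs_le hδ0 hi
  have h_split := measureReal_mul_measureReal_le_of_indepFun (h.indepFun_sum_sub i) x (2 * δ) d
  simp only [sub_add_cancel] at h_split
  have h_unif := h.uniform_concentration hδ0 hδ x (d := d + 2 * δ) (by positivity)
  have h_nonneg : 0 ≤ μ.real {ω | |∑ j, ξ j ω - ξ i ω - x| ≤ d} := measureReal_nonneg
  nlinarith

end Concentration

/-! ### The Stein equation -/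

/-- The unnormalized standard normal density. -/
noncomputable def bell (t : ℝ) : ℝ := exp (-(1 / 2) * t ^ 2)

lemma bell_pos (t : ℝ) : 0 < bell t := exp_pos _

@[fun_prop]
lemma continuous_bell : Continuous bell := by unfold bell; fun_prop

lemma integrable_bell : Integrable bell := integrable_exp_neg_mul_sq (by norm_num)

lemma integral_bell_le : ∫ t, bell t ≤ 3 := by
  unfold bell
  rw [integral_gaussian, Real.sqrt_le_left (by norm_num)]
  nlinarith [Real.pi_le_four]

lemma bell_neg (t : ℝ) : bell (-t) = bell t := by simp [bell]

lemma hasDerivAt_bell (t : ℝ) : HasDerivAt bell (-(t * bell t)) t := by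
  refine ((hasDerivAt_pow 2 t).const_mul (-(1 / 2) : ℝ)).exp.congr_deriv ?_
  simp only [bell]
  push_cast
  ring

lemma gaussianPDFReal_eq_bell (t : ℝ) : gaussianPDFReal 0 1 t = (√(2 * Real.pi))⁻¹ * bell t := by
  simp only [gaussianPDFReal, bell, NNReal.coe_one, mul_one, sub_zero]
  congr 2
  ring

lemma setIntegral_Ioi_bell_le {w : ℝ} (hw : 0 ≤ w) : ∫ t in Set.Ioi w, bell t ≤ 3 * bell w := by
  have h_int : Integrable fun t => bell w * bell (t - w) :=
    (integrable_bell.comp_sub_right w).const_mul _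
  calc ∫ t in Set.Ioi w, bell t ≤ ∫ t in Set.Ioi w, bell w * bell (t - w) := by
        refine setIntegral_mono_on integrable_bell.integrableOn h_int.integrableOn
          measurableSet_Ioi fun t ht => ?_
        unfold bell
        rw [← Real.exp_add]
        refine Real.exp_le_exp.2 ?_
        nlinarith [mul_nonneg hw (sub_nonneg.2 (Set.mem_Ioi.1 ht).le)]
    _ ≤ ∫ t, bell w * bell (t - w) :=
        setIntegral_le_integral h_int (.of_forall fun t => (mul_pos (bell_pos _) (bell_pos _)).le)
    _ = bell w * ∫ t, bell t := by rw [integral_const_mul, integral_sub_right_eq_self bell w]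
    _ ≤ 3 * bell w := by nlinarith [bell_pos w, integral_bell_le]

lemma mul_setIntegral_Ioi_bell_le (w : ℝ) : w * ∫ t in Set.Ioi w, bell t ≤ bell w := by
  have h_int : Integrable fun t => t * bell t := integrable_mul_exp_neg_mul_sq (by norm_num)
  have h_tendsto : Filter.Tendsto bell Filter.atTop (nhds 0) :=
    Real.tendsto_exp_atBot.comp
      ((Filter.tendsto_pow_atTop two_ne_zero).const_mul_atTop_of_neg (by norm_num))
  have h_ftc := integral_Ioi_of_hasDerivAt_of_tendsto' (a := w) (fun t _ => hasDerivAt_bell t)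
    h_int.neg.integrableOn h_tendsto
  rw [integral_neg, zero_sub, neg_inj] at h_ftc
  rw [← h_ftc, ← integral_const_mul]
  exact setIntegral_mono_on (integrable_bell.const_mul w).integrableOn h_int.integrableOn
    measurableSet_Ioi fun t ht =>
      mul_le_mul_of_nonneg_right (Set.mem_Ioi.1 ht).le (bell_pos t).le

lemma setIntegral_Iic_bell (w : ℝ) : ∫ t in Set.Iic w, bell t = ∫ t in Set.Ioi (-w), bell t := by
  rw [← integral_comp_neg_Iic]; simp [bell_neg]

/-- The function `φ` minus its standard normal mean: the right-hand side of the Stein equation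
`f' w - w * f w = φ w - 𝔼 φ(Z)`. -/
noncomputable def steinRhs (φ : ℝ → ℝ) (w : ℝ) : ℝ := φ w - ∫ t, φ t ∂gaussianReal 0 1

/-- The bounded solution `f` of the Stein equation `f' w - w * f w = steinRhs φ w`. -/
noncomputable def steinSolution (φ : ℝ → ℝ) (w : ℝ) : ℝ :=
  (bell w)⁻¹ * ∫ t in Set.Iic w, steinRhs φ t * bell t

/-- The derivative of `steinSolution φ`, as given by the Stein equation. -/
noncomputable def steinDeriv (φ : ℝ → ℝ) (w : ℝ) : ℝ := w * steinSolution φ w + steinRhs φ w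

section SteinSolution

variable {φ : ℝ → ℝ} (hφ : Continuous φ) (hφ01 : ∀ t, φ t ∈ Set.Icc 0 1)

include hφ in
@[fun_prop]
lemma continuous_steinRhs : Continuous (steinRhs φ) := by unfold steinRhs; fun_prop

include hφ hφ01 in
lemma integrable_comp_of_mem_Icc {Ω : Type*} [MeasurableSpace Ω] {μ : Measure Ω}
    [IsFiniteMeasure μ] {X : Ω → ℝ} (hX : Measurable X) : Integrable (fun ω => φ (X ω)) μ :=
  Integrable.of_bound (hφ.measurable.comp hX).aestronglyMeasurable 1 (.of_forall fun ω => by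
    rw [Real.norm_of_nonneg (hφ01 _).1]; exact (hφ01 _).2)

include hφ hφ01 in
lemma abs_steinRhs_le_one (t : ℝ) : |steinRhs φ t| ≤ 1 := by
  have h_nonneg : 0 ≤ ∫ t, φ t ∂gaussianReal 0 1 := integral_nonneg fun t => (hφ01 t).1
  have h_le : ∫ t, φ t ∂gaussianReal 0 1 ≤ 1 := by
    refine (integral_mono (integrable_comp_of_mem_Icc hφ hφ01 measurable_id) (integrable_const 1)
      fun t => (hφ01 t).2).trans ?_
    simp
  unfold steinRhs
  exact abs_le.2 ⟨by linarith [(hφ01 t).1], by linarith [(hφ01 t).2]⟩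

include hφ hφ01 in
lemma norm_steinRhs_mul_bell_le (t : ℝ) : ‖steinRhs φ t * bell t‖ ≤ bell t := by
  rw [norm_mul, Real.norm_of_nonneg (bell_pos t).le]
  exact mul_le_of_le_one_left (bell_pos t).le (abs_steinRhs_le_one hφ hφ01 t)

include hφ hφ01 in
lemma integrable_steinRhs_mul_bell : Integrable fun t => steinRhs φ t * bell t :=
  integrable_bell.mono' (by fun_prop : Continuous _).aestronglyMeasurable
    (.of_forall (norm_steinRhs_mul_bell_le hφ hφ01))

include hφ hφ01 in
lemma integral_steinRhs_mul_bell : ∫ t, steinRhs φ t * bell t = 0 := by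
  have h_mean : ∫ t, steinRhs φ t ∂gaussianReal 0 1 = 0 := by
    have h_int : Integrable φ (gaussianReal 0 1) :=
      integrable_comp_of_mem_Icc hφ hφ01 measurable_id
    unfold steinRhs
    rw [integral_sub h_int (integrable_const _)]
    simp
  rw [integral_gaussianReal_eq_integral_smul one_ne_zero] at h_mean
  simp only [gaussianPDFReal_eq_bell, smul_eq_mul, mul_assoc, integral_const_mul] at h_mean
  simp only [mul_comm _ (bell _)]
  exact (mul_eq_zero.1 h_mean).resolve_left (by positivity)

include hφ hφ01 in
lemma hasDerivAt_setIntegral_Iic_steinRhs (w : ℝ) :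
    HasDerivAt (fun v => ∫ t in Set.Iic v, steinRhs φ t * bell t) (steinRhs φ w * bell w) w := by
  have h_int := integrable_steinRhs_mul_bell hφ hφ01
  have h_cont : Continuous fun t => steinRhs φ t * bell t := by fun_prop
  have h_eq : (fun v => ∫ t in Set.Iic v, steinRhs φ t * bell t) = fun v =>
      (∫ t in Set.Iic 0, steinRhs φ t * bell t) + ∫ t in (0 : ℝ)..v, steinRhs φ t * bell t := by
    ext v
    rw [← intervalIntegral.integral_Iic_sub_Iic h_int.integrableOn h_int.integrableOn]
    ring
  rw [h_eq]
  exact (intervalIntegral.integral_hasDerivAt_right (h_cont.intervalIntegrable _ _)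
    (h_cont.stronglyMeasurableAtFilter _ _) h_cont.continuousAt).const_add _

include hφ hφ01 in
lemma abs_setIntegral_Iic_steinRhs_le (w : ℝ) :
    |∫ t in Set.Iic w, steinRhs φ t * bell t| ≤ ∫ t in Set.Ioi |w|, bell t := by
  have h_int := integrable_steinRhs_mul_bell hφ hφ01
  have h_bound (s : Set ℝ) : |∫ t in s, steinRhs φ t * bell t| ≤ ∫ t in s, bell t :=
    norm_integral_le_of_norm_le integrable_bell.integrableOn
      (.of_forall (norm_steinRhs_mul_bell_le hφ hφ01))
  rcases le_total 0 w with hw | hw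
  · have h_flip : ∫ t in Set.Iic w, steinRhs φ t * bell t
        = -∫ t in Set.Ioi w, steinRhs φ t * bell t := by
      rw [eq_neg_iff_add_eq_zero, ← integral_steinRhs_mul_bell hφ hφ01]
      exact intervalIntegral.integral_Iic_add_Ioi h_int.integrableOn h_int.integrableOn
    rw [h_flip, abs_neg, abs_of_nonneg hw]
    exact h_bound _
  · rw [abs_of_nonpos hw, ← setIntegral_Iic_bell]
    exact h_bound _

include hφ hφ01 in
lemma hasDerivAt_steinSolution (w : ℝ) : HasDerivAt (steinSolution φ) (steinDeriv φ w) w := by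
  have h_inv := (hasDerivAt_bell w).inv (bell_pos w).ne'
  refine (h_inv.mul (hasDerivAt_setIntegral_Iic_steinRhs hφ hφ01 w)).congr_deriv ?_
  unfold steinDeriv steinSolution
  have h_ne := (bell_pos w).ne'
  simp only [Pi.inv_apply]
  field_simp

include hφ hφ01 in
lemma continuous_steinSolution : Continuous (steinSolution φ) :=
  continuous_iff_continuousAt.2 fun w => (hasDerivAt_steinSolution hφ hφ01 w).continuousAt

include hφ hφ01 in
lemma continuous_steinDeriv : Continuous (steinDeriv φ) := by
  have := continuous_steinSolution hφ hφ01
  unfold steinDeriv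
  fun_prop

include hφ hφ01 in
lemma abs_steinSolution_le (w : ℝ) : |steinSolution φ w| ≤ 3 := by
  have h_tail := setIntegral_Ioi_bell_le (abs_nonneg w)
  rw [steinSolution, abs_mul, abs_of_pos (inv_pos.2 (bell_pos w)), inv_mul_le_iff₀ (bell_pos w)]
  refine (abs_setIntegral_Iic_steinRhs_le hφ hφ01 w).trans (h_tail.trans_eq ?_)
  simp [bell, mul_comm]

include hφ hφ01 in
lemma abs_mul_steinSolution_le_one (w : ℝ) : |w * steinSolution φ w| ≤ 1 := by
  rw [steinSolution, mul_left_comm, abs_mul, abs_of_pos (inv_pos.2 (bell_pos w)),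
    inv_mul_le_iff₀ (bell_pos w), abs_mul]
  refine (mul_le_mul_of_nonneg_left (abs_setIntegral_Iic_steinRhs_le hφ hφ01 w)
    (abs_nonneg w)).trans ((mul_setIntegral_Ioi_bell_le |w|).trans_eq ?_)
  simp [bell]

include hφ hφ01 in
lemma abs_steinDeriv_le_two (w : ℝ) : |steinDeriv φ w| ≤ 2 := by
  refine (abs_add_le _ _).trans ?_
  linarith [abs_mul_steinSolution_le_one hφ hφ01 w, abs_steinRhs_le_one hφ hφ01 w]

include hφ hφ01 in
lemma abs_steinSolution_sub_le (a b : ℝ) :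
    |steinSolution φ b - steinSolution φ a| ≤ 2 * |b - a| := by
  simpa using Convex.norm_image_sub_le_of_norm_hasDerivWithin_le (C := 2) (s := Set.univ)
    (fun w _ => (hasDerivAt_steinSolution hφ hφ01 w).hasDerivWithinAt)
    (fun w _ => abs_steinDeriv_le_two hφ hφ01 w) convex_univ (Set.mem_univ a) (Set.mem_univ b)

include hφ hφ01 in
lemma abs_steinDeriv_add_sub_le (w s : ℝ) :
    |steinDeriv φ (w + s) - steinDeriv φ w| ≤ (2 * |w| + 3) * |s| + |φ (w + s) - φ w| := by
  have h_eq : steinDeriv φ (w + s) - steinDeriv φ w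
      = w * (steinSolution φ (w + s) - steinSolution φ w) + s * steinSolution φ (w + s)
        + (φ (w + s) - φ w) := by
    unfold steinDeriv steinRhs; ring
  have h_lip := abs_steinSolution_sub_le hφ hφ01 w (w + s)
  rw [add_sub_cancel_left] at h_lip
  rw [h_eq]
  refine (abs_add_three _ _ _).trans ?_
  rw [abs_mul, abs_mul]
  nlinarith [abs_nonneg w, abs_nonneg s, abs_steinSolution_le hφ hφ01 (w + s)]

include hφ hφ01 in
lemma abs_steinSolution_add_sub_sub_le {w u H : ℝ}
    (hH : ∀ s, |s| ≤ |u| → |φ (w + s) - φ w| ≤ H) :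
    |steinSolution φ (w + u) - steinSolution φ w - u * steinDeriv φ w|
      ≤ |u| * ((2 * |w| + 3) * |u| + H) := by
  have h_mvt := Convex.norm_image_sub_le_of_norm_hasDerivWithin_le
    (f := fun s => steinSolution φ (w + s) - s * steinDeriv φ w)
    (f' := fun s => steinDeriv φ (w + s) - steinDeriv φ w)
    (C := (2 * |w| + 3) * |u| + H) (s := Set.Icc (-|u|) |u|)
    (fun s _ => by
      have h_id := (hasDerivAt_id s).mul_const (steinDeriv φ w)
      rw [one_mul] at h_id
      exact (((hasDerivAt_steinSolution hφ hφ01 (w + s)).comp_const_add w s).sub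
        h_id).hasDerivWithinAt)
    (fun s hs => (abs_steinDeriv_add_sub_le hφ hφ01 w s).trans
      (add_le_add (mul_le_mul_of_nonneg_left (abs_le.2 hs) (by positivity))
        (hH s (abs_le.2 hs)))) (convex_Icc _ _)
    (x := 0) (y := u) ⟨by simp, by simp⟩ ⟨neg_abs_le u, le_abs_self u⟩
  simp only [add_zero, zero_mul, sub_zero, Real.norm_eq_abs] at h_mvt
  rw [sub_right_comm]
  exact h_mvt.trans_eq (mul_comm _ _)

end SteinSolution

/-! ### Smoothed indicators -/

/-- For `α > 0`, the function equal to `1` on `(-∞, z]`, to `0` on `[z + α, ∞)`, and linear in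
between. -/
noncomputable def ramp (z α w : ℝ) : ℝ := max 0 (min 1 ((z + α - w) / α))

lemma continuous_ramp (z α : ℝ) : Continuous (ramp z α) := by unfold ramp; fun_prop

lemma ramp_mem_Icc (z α w : ℝ) : ramp z α w ∈ Set.Icc 0 1 :=
  ⟨le_max_left _ _, max_le zero_le_one (min_le_left _ _)⟩

lemma ramp_of_le {z α w : ℝ} (hα : 0 < α) (hw : w ≤ z) : ramp z α w = 1 := by
  unfold ramp
  rw [min_eq_left ((one_le_div hα).2 (by linarith)), max_eq_right zero_le_one]

lemma ramp_of_ge {z α w : ℝ} (hα : 0 < α) (hw : z + α ≤ w) : ramp z α w = 0 := by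
  unfold ramp
  exact max_eq_left ((min_le_right _ _).trans (div_nonpos_of_nonpos_of_nonneg (by linarith) hα.le))

lemma abs_ramp_sub_le_div {α : ℝ} (hα : 0 < α) (z w w' : ℝ) :
    |ramp z α w' - ramp z α w| ≤ |w' - w| / α := by
  unfold ramp
  refine (abs_max_sub_max_le_max _ _ _ _).trans (max_le (by rw [sub_self, abs_zero]; positivity) ?_)
  refine (abs_min_sub_min_le_max _ _ _ _).trans (max_le (by rw [sub_self, abs_zero]; positivity) ?_)
  rw [← sub_div, show z + α - w' - (z + α - w) = -(w' - w) by ring, abs_div, abs_neg,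
    abs_of_pos hα]

/-- A bound for the increments of `ramp z α` at `w` over distances up to `|u|`. It vanishes unless
`w` lies within `|u|` of `[z, z + α]`. -/
noncomputable def rampIncr (z α u w : ℝ) : ℝ :=
  {v : ℝ × ℝ | |v.2 - (z + α / 2)| ≤ α / 2 + |v.1|}.indicator
    (fun v => min 1 (|v.1| / α)) (u, w)

@[fun_prop]
lemma measurable_rampIncr (z α : ℝ) : Measurable fun v : ℝ × ℝ => rampIncr z α v.1 v.2 := by
  unfold rampIncr
  exact Measurable.indicator (by fun_prop) (measurableSet_le (by fun_prop) (by fun_prop))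

lemma rampIncr_nonneg {α : ℝ} (hα : 0 < α) (z u w : ℝ) : 0 ≤ rampIncr z α u w :=
  Set.indicator_nonneg (fun _ _ => le_min zero_le_one (by positivity)) _

lemma rampIncr_le_one (z α u w : ℝ) : rampIncr z α u w ≤ 1 :=
  Set.indicator_le' (fun _ _ => min_le_left _ _) (fun _ _ => zero_le_one) _

lemma integrable_rampIncr {Ω : Type*} [MeasurableSpace Ω] {μ : Measure Ω} [IsFiniteMeasure μ]
    {α : ℝ} (hα : 0 < α) (z : ℝ) {X Y : Ω → ℝ} (hX : Measurable X) (hY : Measurable Y) :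
    Integrable (fun ω => rampIncr z α (X ω) (Y ω)) μ :=
  Integrable.of_bound ((measurable_rampIncr z α).comp (hX.prodMk hY)).aestronglyMeasurable 1
    (.of_forall fun ω => by
      rw [Real.norm_of_nonneg (rampIncr_nonneg hα _ _ _)]; exact rampIncr_le_one _ _ _ _)

lemma abs_ramp_sub_le {α : ℝ} (hα : 0 < α) (z : ℝ) {s u : ℝ} (hs : |s| ≤ |u|) (w : ℝ) :
    |ramp z α (w + s) - ramp z α w| ≤ rampIncr z α u w := by
  obtain ⟨hs_lower, hs_upper⟩ := abs_le.1 hs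
  by_cases h_near : |w - (z + α / 2)| ≤ α / 2 + |u|
  · have h_mem : (u, w) ∈ {v : ℝ × ℝ | |v.2 - (z + α / 2)| ≤ α / 2 + |v.1|} := h_near
    rw [rampIncr, Set.indicator_of_mem h_mem]
    refine le_min (abs_le.2 ⟨?_, ?_⟩) ((abs_ramp_sub_le_div hα z w (w + s)).trans ?_)
    · linarith [(ramp_mem_Icc z α (w + s)).1, (ramp_mem_Icc z α w).2]
    · linarith [(ramp_mem_Icc z α w).1, (ramp_mem_Icc z α (w + s)).2]
    · rw [add_sub_cancel_left]; gcongr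
  · have h_notMem : (u, w) ∉ {v : ℝ × ℝ | |v.2 - (z + α / 2)| ≤ α / 2 + |v.1|} := h_near
    rw [rampIncr, Set.indicator_of_notMem h_notMem]
    rcases lt_abs.1 (not_le.1 h_near) with h_right | h_left
    · rw [ramp_of_ge hα (by linarith), ramp_of_ge hα (by linarith)]; simp
    · rw [ramp_of_le hα (by linarith), ramp_of_le hα (by linarith)]; simp

section RampExpectation

variable {Ω : Type*} [MeasurableSpace Ω] {μ : Measure Ω} [IsFiniteMeasure μ] {W : Ω → ℝ}

lemma measureReal_le_integral_ramp (hW : Measurable W) (z : ℝ) {α : ℝ} (hα : 0 < α) :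
    μ.real {ω | W ω ≤ z} ≤ ∫ ω, ramp z α (W ω) ∂μ :=
  measureReal_le_integral (measurableSet_le hW measurable_const)
    (integrable_comp_of_mem_Icc (continuous_ramp z α) (ramp_mem_Icc z α) hW)
    (fun _ => (ramp_mem_Icc _ _ _).1) fun _ hω => (ramp_of_le hα hω).ge

lemma integral_ramp_le_measureReal (hW : Measurable W) (z : ℝ) {α : ℝ} (hα : 0 < α) :
    ∫ ω, ramp z α (W ω) ∂μ ≤ μ.real {ω | W ω ≤ z + α} := by
  have h_meas : MeasurableSet {ω | W ω ≤ z + α} := measurableSet_le hW measurable_const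
  rw [← integral_indicator_one h_meas]
  refine integral_mono (integrable_comp_of_mem_Icc (continuous_ramp z α) (ramp_mem_Icc z α) hW)
    ((integrable_const 1).indicator h_meas) fun ω => ?_
  by_cases hω : ω ∈ {ω | W ω ≤ z + α}
  · simpa [hω] using (ramp_mem_Icc z α (W ω)).2
  · simp only [Set.indicator_of_notMem hω]
    exact (ramp_of_ge hα (not_le.1 hω).le).le

end RampExpectation

lemma gaussianPDFReal_le_one (t : ℝ) : gaussianPDFReal 0 1 t ≤ 1 := by
  have h_bell : bell t ≤ 1 := Real.exp_le_one_iff.2 (by nlinarith [sq_nonneg t])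
  have h_sqrt : (√(2 * Real.pi))⁻¹ ≤ 1 := inv_le_one_of_one_le₀ (by
    rw [Real.one_le_sqrt]; nlinarith [Real.pi_gt_three])
  rw [gaussianPDFReal_eq_bell]
  exact mul_le_one₀ h_sqrt (bell_pos t).le h_bell

lemma gaussianReal_Ioc_le (a : ℝ) {d : ℝ} (hd : 0 ≤ d) :
    (gaussianReal 0 1).real (Set.Ioc a (a + d)) ≤ d := by
  rw [measureReal_def, gaussianReal_apply_eq_integral _ one_ne_zero,
    ENNReal.toReal_ofReal (integral_nonneg fun t => gaussianPDFReal_nonneg _ _ _)]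
  refine (setIntegral_mono_on (integrable_gaussianPDFReal 0 1).integrableOn
    (integrableOn_const (C := (1 : ℝ)) (by simp)) measurableSet_Ioc
    fun t _ => gaussianPDFReal_le_one t).trans_eq ?_
  simp [hd]

lemma cdf_gaussianReal_add_le (a : ℝ) {d : ℝ} (hd : 0 ≤ d) :
    cdf (gaussianReal 0 1) (a + d) ≤ cdf (gaussianReal 0 1) a + d := by
  rw [cdf_eq_real, cdf_eq_real, ← Set.Iic_union_Ioc_eq_Iic (by linarith : a ≤ a + d)]
  exact (measureReal_union_le _ _).trans (by linarith [gaussianReal_Ioc_le a hd])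

/-! ### The Berry-Esseen theorem -/

lemma integral_le_of_indepFun {Ω : Type*} [MeasurableSpace Ω] {μ : Measure Ω}
    [IsProbabilityMeasure μ] {X Y : Ω → ℝ} (hX : Measurable X) (hY : Measurable Y)
    (hXY : IndepFun X Y μ) {Ψ : ℝ × ℝ → ℝ} (hΨ : Measurable Ψ) {B : ℝ → ℝ} (hB : Measurable B)
    (h_int : Integrable (fun ω => Ψ (X ω, Y ω)) μ) (hB_int : Integrable (fun ω => B (X ω)) μ)
    (h_le : ∀ a, ∫ ω, Ψ (a, Y ω) ∂μ ≤ B a) :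
    ∫ ω, Ψ (X ω, Y ω) ∂μ ≤ ∫ ω, B (X ω) ∂μ := by
  have := Measure.isProbabilityMeasure_map hX.aemeasurable (μ := μ)
  have := Measure.isProbabilityMeasure_map hY.aemeasurable (μ := μ)
  have h_law := hXY.map_prod_eq_prod_map_map hX.aemeasurable hY.aemeasurable
  have hXY_meas : Measurable fun ω => (X ω, Y ω) := hX.prodMk hY
  have h_int' : Integrable Ψ ((μ.map X).prod (μ.map Y)) := by
    rw [← h_law, integrable_map_measure hΨ.aestronglyMeasurable hXY_meas.aemeasurable]
    exact h_int
  have h_fubini : ∫ ω, Ψ (X ω, Y ω) ∂μ = ∫ a, ∫ b, Ψ (a, b) ∂μ.map Y ∂μ.map X := by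
    rw [← integral_prod _ h_int', ← h_law,
      integral_map hXY_meas.aemeasurable hΨ.aestronglyMeasurable]
  rw [h_fubini, ← integral_map hX.aemeasurable hB.aestronglyMeasurable]
  refine integral_mono h_int'.integral_prod_left
    ((integrable_map_measure hB.aestronglyMeasurable hX.aemeasurable).2 hB_int) fun a => ?_
  have hΨa : Measurable fun b => Ψ (a, b) := by fun_prop
  exact (integral_map hY.aemeasurable hΨa.aestronglyMeasurable).trans_le (h_le a)

namespace IsStdSum

variable {Ω ι : Type*} [MeasurableSpace Ω] [Fintype ι] {μ : Measure Ω} {ξ : ι → Ω → ℝ}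

lemma integral_sum_sq (h : IsStdSum ξ μ) : ∫ ω, (∑ i, ξ i ω) ^ 2 ∂μ = 1 := by
  have := h.isProbabilityMeasure
  have h_var := IndepFun.variance_sum (μ := μ) (s := Finset.univ) (X := ξ)
    (fun i _ => h.memLp_two i) fun i _ j _ hij => h.indep.indepFun hij
  have h_mean : ∫ ω, ∑ i, ξ i ω ∂μ = 0 := by
    rw [integral_finsetSum _ fun i _ => h.integrable i]
    exact Finset.sum_eq_zero fun i _ => h.mean i
  have h_fun : (∑ i, ξ i) = fun ω => ∑ i, ξ i ω := by ext; simp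
  rw [h_fun, variance_of_integral_eq_zero h.measurable_sum.aemeasurable h_mean] at h_var
  rw [h_var, ← h.var]
  exact Finset.sum_congr rfl fun i _ =>
    variance_of_integral_eq_zero (h.measurable i).aemeasurable (h.mean i)

lemma integral_sq_le_one (h : IsStdSum ξ μ) (i : ι) : ∫ ω, ξ i ω ^ 2 ∂μ ≤ 1 := by
  rw [← h.var]
  exact Finset.single_le_sum (f := fun i => ∫ ω, ξ i ω ^ 2 ∂μ) (fun _ _ => by positivity)
    (Finset.mem_univ i)

-- `s ^ 3 - 3 / 2 * σ * s ^ 2 + σ ^ 3 / 2 = (s - σ) ^ 2 * (2 * s + σ) / 2`.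
lemma sqrt_integral_sq_pow_three_le (h : IsStdSum ξ μ) (i : ι) :
    √(∫ ω, ξ i ω ^ 2 ∂μ) ^ 3 ≤ ∫ ω, |ξ i ω| ^ 3 ∂μ := by
  have := h.isProbabilityMeasure
  set σ := √(∫ ω, ξ i ω ^ 2 ∂μ)
  have : 0 ≤ σ := Real.sqrt_nonneg _
  have hσ2 : σ ^ 2 = ∫ ω, ξ i ω ^ 2 ∂μ := Real.sq_sqrt (by positivity)
  have h_tangent : ∫ ω, (3 / 2 * σ * ξ i ω ^ 2 - σ ^ 3 / 2) ∂μ ≤ ∫ ω, |ξ i ω| ^ 3 ∂μ := by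
    refine integral_mono (((h.integrable_sq i).const_mul _).sub (integrable_const _))
      (h.integrable_cube i) fun ω => ?_
    simp only
    rw [← sq_abs]
    nlinarith [mul_nonneg (sq_nonneg (|ξ i ω| - σ))
      (by positivity : 0 ≤ 2 * |ξ i ω| + σ)]
  rw [integral_sub ((h.integrable_sq i).const_mul _) (integrable_const _), integral_const_mul,
    ← hσ2] at h_tangent
  simp only [integral_const, probReal_univ, smul_eq_mul, one_mul] at h_tangent
  nlinarith

lemma lyapunov_pos (h : IsStdSum ξ μ) : 0 < lyapunov ξ μ := by
  obtain ⟨i, -, hi⟩ := Finset.exists_ne_zero_of_sum_ne_zero (h.var ▸ one_ne_zero)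
  have : 0 < √(∫ ω, ξ i ω ^ 2 ∂μ) :=
    Real.sqrt_pos.2 (lt_of_le_of_ne (integral_nonneg fun ω => sq_nonneg _) hi.symm)
  calc 0 < √(∫ ω, ξ i ω ^ 2 ∂μ) ^ 3 := by positivity
    _ ≤ ∫ ω, |ξ i ω| ^ 3 ∂μ := h.sqrt_integral_sq_pow_three_le i
    _ ≤ lyapunov ξ μ := Finset.single_le_sum (f := fun i => ∫ ω, |ξ i ω| ^ 3 ∂μ)
        (fun j _ => integral_nonneg fun ω => by positivity) (Finset.mem_univ i)

lemma integral_sq_mul_integral_abs_le (h : IsStdSum ξ μ) (i : ι) :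
    (∫ ω, ξ i ω ^ 2 ∂μ) * ∫ ω, |ξ i ω| ∂μ ≤ ∫ ω, |ξ i ω| ^ 3 ∂μ := by
  have := h.isProbabilityMeasure
  refine (mul_le_mul_of_nonneg_left (integral_abs_le_sqrt (h.memLp_two i)) (by positivity)).trans
    (le_trans (le_of_eq ?_) (h.sqrt_integral_sq_pow_three_le i))
  rw [pow_succ, Real.sq_sqrt (by positivity)]

lemma integral_abs_sum_sub_le_two (h : IsStdSum ξ μ) (i : ι) :
    ∫ ω, |∑ j, ξ j ω - ξ i ω| ∂μ ≤ 2 := by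
  have := h.isProbabilityMeasure
  have h_int := h.memLp_sum.integrable (by norm_num)
  have h_sum : ∫ ω, |∑ j, ξ j ω| ∂μ ≤ 1 := by
    simpa [h.integral_sum_sq] using integral_abs_le_sqrt h.memLp_sum
  have h_term : ∫ ω, |ξ i ω| ∂μ ≤ 1 := (integral_abs_le_sqrt (h.memLp_two i)).trans
    (Real.sqrt_le_one.2 (h.integral_sq_le_one i))
  calc ∫ ω, |∑ j, ξ j ω - ξ i ω| ∂μ ≤ ∫ ω, (|∑ j, ξ j ω| + |ξ i ω|) ∂μ :=
        integral_mono (h_int.sub (h.integrable i)).abs (h_int.abs.add (h.integrable i).abs)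
          fun ω => abs_sub _ _
    _ ≤ 2 := by rw [integral_add h_int.abs (h.integrable i).abs]; linarith

variable {δ : ℝ}

lemma integral_rampIncr_le (h : IsStdSum ξ μ) (hδ0 : 0 < δ) (hδ : lyapunov ξ μ ≤ δ) {i : ι}
    (hi : ∫ ω, |ξ i ω| ∂μ ≤ δ) (z u : ℝ) :
    ∫ ω, rampIncr z δ u (∑ j, ξ j ω - ξ i ω) ∂μ ≤ 1650 * |u| := by
  have h_conc := h.uniform_concentration_sub hδ0 hδ hi (z + δ / 2) (d := δ / 2 + |u|)
    (by positivity)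
  have h_meas : MeasurableSet {ω | |∑ j, ξ j ω - ξ i ω - (z + δ / 2)| ≤ δ / 2 + |u|} := by
    have := h.measurable
    exact measurableSet_le (by fun_prop) (by fun_prop)
  have h_eq : (fun ω => rampIncr z δ u (∑ j, ξ j ω - ξ i ω))
      = {ω | |∑ j, ξ j ω - ξ i ω - (z + δ / 2)| ≤ δ / 2 + |u|}.indicator
        (fun _ => min 1 (|u| / δ)) := rfl
  rw [h_eq, integral_indicator_const _ h_meas, smul_eq_mul]
  have h_min : 0 ≤ min 1 (|u| / δ) := le_min zero_le_one (by positivity)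
  have h_min_mul_abs : min 1 (|u| / δ) * |u| ≤ |u| :=
    mul_le_of_le_one_left (abs_nonneg _) (min_le_left _ _)
  have h_min_mul : min 1 (|u| / δ) * δ ≤ |u| := by
    refine (mul_le_mul_of_nonneg_right (min_le_right _ _) hδ0.le).trans_eq ?_
    field_simp
  refine (mul_le_mul_of_nonneg_right h_conc h_min).trans ?_
  nlinarith

end IsStdSum

/-- A bound for the increments of the derivative of the Stein solution for the smoothed indicator
`ramp z δ`, at the point `w` and over distances up to `|u|`. -/
noncomputable def steinIncr (z δ u w : ℝ) : ℝ := (2 * |w| + 3) * |u| + rampIncr z δ u w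

section SteinIncr

variable {δ : ℝ} (hδ0 : 0 < δ) (z : ℝ)

@[fun_prop]
lemma measurable_steinIncr (z δ : ℝ) : Measurable fun v : ℝ × ℝ => steinIncr z δ v.1 v.2 := by
  unfold steinIncr; fun_prop

include hδ0 in
lemma abs_steinDeriv_ramp_sub_le (u w : ℝ) :
    |steinDeriv (ramp z δ) (w + u) - steinDeriv (ramp z δ) w| ≤ steinIncr z δ u w :=
  (abs_steinDeriv_add_sub_le (continuous_ramp z δ) (ramp_mem_Icc z δ) w u).trans
    (add_le_add le_rfl (abs_ramp_sub_le hδ0 z le_rfl w))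

include hδ0 in
lemma abs_steinSolution_ramp_sub_le (u w : ℝ) :
    |steinSolution (ramp z δ) (w + u) - steinSolution (ramp z δ) w - u * steinDeriv (ramp z δ) w|
      ≤ |u| * steinIncr z δ u w :=
  abs_steinSolution_add_sub_sub_le (continuous_ramp z δ) (ramp_mem_Icc z δ)
    fun _ hs => abs_ramp_sub_le hδ0 z hs w

end SteinIncr

section SteinIntegrability

variable {Ω : Type*} [MeasurableSpace Ω] {μ : Measure Ω} {φ : ℝ → ℝ} (hφ : Continuous φ)
  (hφ01 : ∀ t, φ t ∈ Set.Icc 0 1) {Z V : Ω → ℝ}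

include hφ hφ01 in
lemma integrable_mul_steinSolution (hZ : Integrable Z μ) (hV : Measurable V) :
    Integrable (fun ω => Z ω * steinSolution φ (V ω)) μ :=
  hZ.mul_bdd (c := 3)
    ((continuous_steinSolution hφ hφ01).measurable.comp hV).aestronglyMeasurable
    (.of_forall fun _ => abs_steinSolution_le hφ hφ01 _)

include hφ hφ01 in
lemma integrable_mul_steinDeriv (hZ : Integrable Z μ) (hV : Measurable V) :
    Integrable (fun ω => Z ω * steinDeriv φ (V ω)) μ :=
  hZ.mul_bdd (c := 2)
    ((continuous_steinDeriv hφ hφ01).measurable.comp hV).aestronglyMeasurable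
    (.of_forall fun _ => abs_steinDeriv_le_two hφ hφ01 _)

include hφ hφ01 in
lemma integrable_steinDeriv [IsFiniteMeasure μ] (hV : Measurable V) :
    Integrable (fun ω => steinDeriv φ (V ω)) μ := by
  simpa using integrable_mul_steinDeriv hφ hφ01 (integrable_const 1) hV

end SteinIntegrability

namespace IsStdSum

variable {Ω ι : Type*} [MeasurableSpace Ω] [Fintype ι] {μ : Measure Ω} {ξ : ι → Ω → ℝ} {δ : ℝ}

lemma measurable_sum_sub (h : IsStdSum ξ μ) (i : ι) :
    Measurable fun ω => ∑ j, ξ j ω - ξ i ω := h.measurable_sum.sub (h.measurable i)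

lemma integrable_abs_sum_sub (h : IsStdSum ξ μ) (i : ι) :
    Integrable (fun ω => |∑ j, ξ j ω - ξ i ω|) μ := by
  have := h.isProbabilityMeasure
  exact ((h.memLp_sum.integrable (by norm_num)).sub (h.integrable i)).abs

lemma integral_steinIncr_le (h : IsStdSum ξ μ) (hδ0 : 0 < δ) (hδ : lyapunov ξ μ ≤ δ) {i : ι}
    (hi : ∫ ω, |ξ i ω| ∂μ ≤ δ) (z u : ℝ) :
    ∫ ω, steinIncr z δ u (∑ j, ξ j ω - ξ i ω) ∂μ ≤ 1657 * |u| := by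
  have := h.isProbabilityMeasure
  have h_abs := (h.integrable_abs_sum_sub i).const_mul 2
  have h_lin : Integrable (fun ω => 2 * |∑ j, ξ j ω - ξ i ω| + 3) μ :=
    h_abs.add (integrable_const 3)
  have h_ramp := h.integral_rampIncr_le hδ0 hδ hi z u
  unfold steinIncr
  rw [integral_add (h_lin.mul_const _)
    (integrable_rampIncr hδ0 z measurable_const (h.measurable_sum_sub i)), integral_mul_const,
    integral_add h_abs (integrable_const 3), integral_const_mul]
  simp only [integral_const, probReal_univ, smul_eq_mul, one_mul]
  nlinarith [abs_nonneg u, h.integral_abs_sum_sub_le_two i]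

lemma integrable_pow_mul_steinIncr (h : IsStdSum ξ μ) (hδ0 : 0 < δ) (z : ℝ) {i : ι} {k : ℕ}
    (hk : Integrable (fun ω => |ξ i ω| ^ k) μ) (hk' : Integrable (fun ω => |ξ i ω| ^ (k + 1)) μ) :
    Integrable (fun ω => |ξ i ω| ^ k * steinIncr z δ (ξ i ω) (∑ j, ξ j ω - ξ i ω)) μ := by
  have := h.isProbabilityMeasure
  have h_indep : IndepFun (fun ω => |ξ i ω| ^ (k + 1))
      (fun ω => 2 * |∑ j, ξ j ω - ξ i ω| + 3) μ :=
    (h.indepFun_sum_sub i).comp (φ := fun s => |s| ^ (k + 1)) (ψ := fun s => 2 * |s| + 3)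
      (by fun_prop) (by fun_prop)
  have h_lin := h_indep.integrable_mul hk'
    (((h.integrable_abs_sum_sub i).const_mul 2).add (integrable_const 3))
  have h_ramp := hk.mul_bdd (c := 1) (integrable_rampIncr hδ0 z (h.measurable i)
      (h.measurable_sum_sub i)).aestronglyMeasurable (.of_forall fun ω => by
    rw [Real.norm_of_nonneg (rampIncr_nonneg hδ0 _ _ _)]; exact rampIncr_le_one _ _ _ _)
  refine (h_lin.add h_ramp).congr (.of_forall fun ω => ?_)
  simp only [steinIncr, Pi.add_apply, Pi.mul_apply]
  ring

lemma integral_pow_mul_steinIncr_le (h : IsStdSum ξ μ) (hδ0 : 0 < δ) (hδ : lyapunov ξ μ ≤ δ)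
    {i : ι} (hi : ∫ ω, |ξ i ω| ∂μ ≤ δ) (z : ℝ) {k : ℕ}
    (hk : Integrable (fun ω => |ξ i ω| ^ k) μ) (hk' : Integrable (fun ω => |ξ i ω| ^ (k + 1)) μ) :
    ∫ ω, |ξ i ω| ^ k * steinIncr z δ (ξ i ω) (∑ j, ξ j ω - ξ i ω) ∂μ
      ≤ 1657 * ∫ ω, |ξ i ω| ^ (k + 1) ∂μ := by
  have := h.isProbabilityMeasure
  rw [← integral_const_mul]
  refine integral_le_of_indepFun (Ψ := fun v => |v.1| ^ k * steinIncr z δ v.1 v.2)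
    (B := fun s => 1657 * |s| ^ (k + 1)) (h.measurable i) (h.measurable_sum_sub i)
    (h.indepFun_sum_sub i) (by fun_prop) (by fun_prop)
    (h.integrable_pow_mul_steinIncr hδ0 z hk hk') (hk'.const_mul _) fun a => ?_
  simp only [integral_const_mul]
  calc |a| ^ k * ∫ ω, steinIncr z δ a (∑ j, ξ j ω - ξ i ω) ∂μ ≤ |a| ^ k * (1657 * |a|) :=
        mul_le_mul_of_nonneg_left (h.integral_steinIncr_le hδ0 hδ hi z a) (by positivity)
    _ = 1657 * |a| ^ (k + 1) := by ring

lemma integral_mul_steinSolution_sum_sub (h : IsStdSum ξ μ) {φ : ℝ → ℝ} (hφ : Continuous φ)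
    (hφ01 : ∀ t, φ t ∈ Set.Icc 0 1) (i : ι) :
    ∫ ω, ξ i ω * steinSolution φ (∑ j, ξ j ω - ξ i ω) ∂μ = 0 := by
  have h_meas := (continuous_steinSolution hφ hφ01).measurable
  have h_prod := ((h.indepFun_sum_sub i).comp (φ := id) measurable_id
    h_meas).integral_fun_mul_eq_mul_integral (h.integrable i).aestronglyMeasurable
    (h_meas.comp (h.measurable_sum_sub i)).aestronglyMeasurable
  simp only [Function.comp_def, id] at h_prod
  rw [h_prod, h.mean, zero_mul]

lemma integral_sq_mul_steinDeriv_sum_sub (h : IsStdSum ξ μ) {φ : ℝ → ℝ} (hφ : Continuous φ)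
    (hφ01 : ∀ t, φ t ∈ Set.Icc 0 1) (i : ι) :
    ∫ ω, ξ i ω ^ 2 * steinDeriv φ (∑ j, ξ j ω - ξ i ω) ∂μ
      = (∫ ω, ξ i ω ^ 2 ∂μ) * ∫ ω, steinDeriv φ (∑ j, ξ j ω - ξ i ω) ∂μ := by
  have h_meas := (continuous_steinDeriv hφ hφ01).measurable
  simpa only [Function.comp_def] using ((h.indepFun_sum_sub i).comp (φ := fun s => s ^ 2)
    (by fun_prop) h_meas).integral_fun_mul_eq_mul_integral
    (h.integrable_sq i).aestronglyMeasurable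
    (h_meas.comp (h.measurable_sum_sub i)).aestronglyMeasurable

lemma abs_integral_mul_steinSolution_sub_le (h : IsStdSum ξ μ) (hδ0 : 0 < δ)
    (hδ : lyapunov ξ μ ≤ δ) {i : ι} (hi : ∫ ω, |ξ i ω| ∂μ ≤ δ) (z : ℝ) :
    |∫ ω, ξ i ω * steinSolution (ramp z δ) (∑ j, ξ j ω) ∂μ
      - (∫ ω, ξ i ω ^ 2 ∂μ) * ∫ ω, steinDeriv (ramp z δ) (∑ j, ξ j ω - ξ i ω) ∂μ|
      ≤ 1657 * ∫ ω, |ξ i ω| ^ 3 ∂μ := by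
  have hφ := continuous_ramp z δ
  have hφ01 := ramp_mem_Icc z δ
  have h_loo := h.measurable_sum_sub i
  set f := steinSolution (ramp z δ)
  set f' := steinDeriv (ramp z δ)
  have hk : Integrable (fun ω => |ξ i ω| ^ 2) μ := by simpa using h.integrable_sq i
  have h_mul := integrable_mul_steinSolution hφ hφ01 (h.integrable i) h.measurable_sum
  have h_mul_loo := integrable_mul_steinSolution hφ hφ01 (h.integrable i) h_loo
  have h_eq : ∫ ω, (ξ i ω * f (∑ j, ξ j ω) - ξ i ω * f (∑ j, ξ j ω - ξ i ω)
      - ξ i ω ^ 2 * f' (∑ j, ξ j ω - ξ i ω)) ∂μ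
      = ∫ ω, ξ i ω * f (∑ j, ξ j ω) ∂μ
        - (∫ ω, ξ i ω ^ 2 ∂μ) * ∫ ω, f' (∑ j, ξ j ω - ξ i ω) ∂μ := by
    have h_diff : Integrable
        (fun ω => ξ i ω * f (∑ j, ξ j ω) - ξ i ω * f (∑ j, ξ j ω - ξ i ω)) μ := h_mul.sub h_mul_loo
    rw [integral_sub h_diff (integrable_mul_steinDeriv hφ hφ01 (h.integrable_sq i) h_loo),
      integral_sub h_mul h_mul_loo, h.integral_mul_steinSolution_sum_sub hφ hφ01,
      h.integral_sq_mul_steinDeriv_sum_sub hφ hφ01, sub_zero]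
  rw [← h_eq]
  refine abs_integral_le_integral_abs.trans ((integral_mono_of_nonneg
    (.of_forall fun _ => abs_nonneg _)
    (h.integrable_pow_mul_steinIncr hδ0 z hk (h.integrable_cube i)) (.of_forall fun ω => ?_)).trans
    (h.integral_pow_mul_steinIncr_le hδ0 hδ hi z hk (h.integrable_cube i)))
  have h_taylor := abs_steinSolution_ramp_sub_le hδ0 z (ξ i ω) (∑ j, ξ j ω - ξ i ω)
  rw [sub_add_cancel] at h_taylor
  calc |ξ i ω * f (∑ j, ξ j ω) - ξ i ω * f (∑ j, ξ j ω - ξ i ω)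
          - ξ i ω ^ 2 * f' (∑ j, ξ j ω - ξ i ω)|
      = |ξ i ω| * |f (∑ j, ξ j ω) - f (∑ j, ξ j ω - ξ i ω)
          - ξ i ω * f' (∑ j, ξ j ω - ξ i ω)| := by rw [← abs_mul]; congr 1; ring
    _ ≤ |ξ i ω| * (|ξ i ω| * steinIncr z δ (ξ i ω) (∑ j, ξ j ω - ξ i ω)) :=
        mul_le_mul_of_nonneg_left h_taylor (abs_nonneg _)
    _ = |ξ i ω| ^ 2 * steinIncr z δ (ξ i ω) (∑ j, ξ j ω - ξ i ω) := by ring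

lemma abs_integral_steinDeriv_sub_le (h : IsStdSum ξ μ) (hδ0 : 0 < δ)
    (hδ : lyapunov ξ μ ≤ δ) {i : ι} (hi : ∫ ω, |ξ i ω| ∂μ ≤ δ) (z : ℝ) :
    |∫ ω, steinDeriv (ramp z δ) (∑ j, ξ j ω) ∂μ
      - ∫ ω, steinDeriv (ramp z δ) (∑ j, ξ j ω - ξ i ω) ∂μ| ≤ 1657 * ∫ ω, |ξ i ω| ∂μ := by
  have := h.isProbabilityMeasure
  have hφ := continuous_ramp z δ
  have hφ01 := ramp_mem_Icc z δ
  have hk : Integrable (fun ω => |ξ i ω| ^ 0) μ := by simp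
  have hk' : Integrable (fun ω => |ξ i ω| ^ (0 + 1)) μ := by simpa using (h.integrable i).abs
  have h_bound := h.integral_pow_mul_steinIncr_le hδ0 hδ hi z hk hk'
  have h_int := h.integrable_pow_mul_steinIncr hδ0 z hk hk'
  simp only [pow_zero, one_mul, zero_add, pow_one] at h_bound h_int
  rw [← integral_sub (integrable_steinDeriv hφ hφ01 h.measurable_sum)
    (integrable_steinDeriv hφ hφ01 (h.measurable_sum_sub i))]
  refine abs_integral_le_integral_abs.trans ((integral_mono_of_nonneg
    (.of_forall fun _ => abs_nonneg _) h_int (.of_forall fun ω => ?_)).trans h_bound)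
  simpa only [sub_add_cancel] using
    abs_steinDeriv_ramp_sub_le hδ0 z (ξ i ω) (∑ j, ξ j ω - ξ i ω)

lemma abs_integral_stein_term_le (h : IsStdSum ξ μ) (hδ0 : 0 < δ)
    (hδ : lyapunov ξ μ ≤ δ) {i : ι} (hi : ∫ ω, |ξ i ω| ∂μ ≤ δ) (z : ℝ) :
    |∫ ω, ξ i ω * steinSolution (ramp z δ) (∑ j, ξ j ω) ∂μ
      - (∫ ω, ξ i ω ^ 2 ∂μ) * ∫ ω, steinDeriv (ramp z δ) (∑ j, ξ j ω) ∂μ|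
      ≤ 3314 * ∫ ω, |ξ i ω| ^ 3 ∂μ := by
  have h_sq : 0 ≤ ∫ ω, ξ i ω ^ 2 ∂μ := by positivity
  have h_taylor := h.abs_integral_mul_steinSolution_sub_le hδ0 hδ hi z
  have h_deriv := mul_le_mul_of_nonneg_left (h.abs_integral_steinDeriv_sub_le hδ0 hδ hi z) h_sq
  have h_tri := abs_sub_le (∫ ω, ξ i ω * steinSolution (ramp z δ) (∑ j, ξ j ω) ∂μ)
    ((∫ ω, ξ i ω ^ 2 ∂μ) * ∫ ω, steinDeriv (ramp z δ) (∑ j, ξ j ω - ξ i ω) ∂μ)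
    ((∫ ω, ξ i ω ^ 2 ∂μ) * ∫ ω, steinDeriv (ramp z δ) (∑ j, ξ j ω) ∂μ)
  rw [← mul_sub, abs_mul, abs_of_nonneg h_sq, abs_sub_comm (∫ ω, steinDeriv _ _ ∂μ)] at h_tri
  linarith [h.integral_sq_mul_integral_abs_le i]

lemma integral_sub_integral_gaussianReal_eq (h : IsStdSum ξ μ) {φ : ℝ → ℝ} (hφ : Continuous φ)
    (hφ01 : ∀ t, φ t ∈ Set.Icc 0 1) :
    ∫ ω, φ (∑ i, ξ i ω) ∂μ - ∫ t, φ t ∂gaussianReal 0 1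
      = -∑ i, (∫ ω, ξ i ω * steinSolution φ (∑ j, ξ j ω) ∂μ
        - (∫ ω, ξ i ω ^ 2 ∂μ) * ∫ ω, steinDeriv φ (∑ j, ξ j ω) ∂μ) := by
  have := h.isProbabilityMeasure
  have h_mul := integrable_mul_steinSolution hφ hφ01 (h.memLp_sum.integrable (by norm_num))
    h.measurable_sum
  have hφ_int := integrable_comp_of_mem_Icc hφ hφ01 (μ := μ) h.measurable_sum
  have h_rhs : Integrable (fun ω => steinRhs φ (∑ j, ξ j ω)) μ := hφ_int.sub (integrable_const _)
  have h_deriv : ∫ ω, steinDeriv φ (∑ j, ξ j ω) ∂μ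
      = ∫ ω, (∑ j, ξ j ω) * steinSolution φ (∑ j, ξ j ω) ∂μ
        + (∫ ω, φ (∑ i, ξ i ω) ∂μ - ∫ t, φ t ∂gaussianReal 0 1) := by
    unfold steinDeriv
    rw [integral_add h_mul h_rhs]
    unfold steinRhs
    rw [integral_sub hφ_int (integrable_const _)]
    simp
  have h_sum : ∫ ω, (∑ j, ξ j ω) * steinSolution φ (∑ j, ξ j ω) ∂μ
      = ∑ i, ∫ ω, ξ i ω * steinSolution φ (∑ j, ξ j ω) ∂μ := by
    rw [← integral_finsetSum _ fun i _ =>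
      integrable_mul_steinSolution hφ hφ01 (h.integrable i) h.measurable_sum]
    simp only [Finset.sum_mul]
  rw [Finset.sum_sub_distrib, ← Finset.sum_mul, h.var, one_mul, h_deriv, h_sum]
  ring

lemma abs_integral_ramp_sub_le (h : IsStdSum ξ μ) (hδ0 : 0 < δ) (hδ : lyapunov ξ μ ≤ δ)
    (hi : ∀ i, ∫ ω, |ξ i ω| ∂μ ≤ δ) (z : ℝ) :
    |∫ ω, ramp z δ (∑ i, ξ i ω) ∂μ - ∫ t, ramp z δ t ∂gaussianReal 0 1| ≤ 3314 * δ := by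
  rw [h.integral_sub_integral_gaussianReal_eq (continuous_ramp z δ) (ramp_mem_Icc z δ), abs_neg]
  calc _ ≤ ∑ i, 3314 * ∫ ω, |ξ i ω| ^ 3 ∂μ := (Finset.abs_sum_le_sum_abs _ _).trans
        (Finset.sum_le_sum fun i _ => h.abs_integral_stein_term_le hδ0 hδ (hi i) z)
    _ = 3314 * lyapunov ξ μ := by rw [← Finset.mul_sum]; rfl
    _ ≤ 3314 * δ := by gcongr

theorem berry_esseen (h : IsStdSum ξ μ) (hδ0 : 0 < δ) (hδ : lyapunov ξ μ ≤ δ)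
    (hi : ∀ i, ∫ ω, |ξ i ω| ∂μ ≤ δ) (z : ℝ) :
    |μ.real {ω | ∑ i, ξ i ω ≤ z} - cdf (gaussianReal 0 1) z| ≤ 3315 * δ := by
  have := h.isProbabilityMeasure
  have h_cdf (a : ℝ) : (gaussianReal 0 1).real {t | t ≤ a} = cdf (gaussianReal 0 1) a := by
    rw [cdf_eq_real]; rfl
  have h_upper := measureReal_le_integral_ramp (μ := μ) h.measurable_sum z hδ0
  have h_lower := integral_ramp_le_measureReal (μ := μ) h.measurable_sum (z - δ) hδ0
  have h_gauss_upper := integral_ramp_le_measureReal (μ := gaussianReal 0 1) measurable_id z hδ0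
  have h_gauss_lower := measureReal_le_integral_ramp (μ := gaussianReal 0 1) measurable_id
    (z - δ) hδ0
  have h_stein_upper := (abs_le.1 (h.abs_integral_ramp_sub_le hδ0 hδ hi z)).2
  have h_stein_lower := (abs_le.1 (h.abs_integral_ramp_sub_le hδ0 hδ hi (z - δ))).1
  have h_shift_upper := cdf_gaussianReal_add_le z hδ0.le
  have h_shift_lower := cdf_gaussianReal_add_le (z - δ) hδ0.le
  simp only [id, h_cdf, sub_add_cancel] at *
  rw [abs_le]
  constructor <;> linarith

end IsStdSum

/-! ### Nonlinear statistics -/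

section NearLevel

variable {Ω : Type*} [MeasurableSpace Ω] {μ : Measure Ω} [IsFiniteMeasure μ]

lemma abs_measureReal_add_le_sub_le (W Δ : Ω → ℝ) (x : ℝ) :
    |μ.real {ω | W ω + Δ ω ≤ x} - μ.real {ω | W ω ≤ x}| ≤ μ.real {ω | |W ω - x| ≤ |Δ ω|} := by
  have h_upper : μ.real {ω | W ω + Δ ω ≤ x}
      ≤ μ.real {ω | W ω ≤ x} + μ.real {ω | |W ω - x| ≤ |Δ ω|} := by
    refine (measureReal_mono fun ω (hω : W ω + Δ ω ≤ x) => ?_).trans (measureReal_union_le _ _)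
    refine (le_or_gt (W ω) x).imp id fun hW => show |W ω - x| ≤ |Δ ω| from abs_le.2 ⟨?_, ?_⟩
    · linarith [abs_nonneg (Δ ω)]
    · linarith [neg_abs_le (Δ ω)]
  have h_lower : μ.real {ω | W ω ≤ x}
      ≤ μ.real {ω | W ω + Δ ω ≤ x} + μ.real {ω | |W ω - x| ≤ |Δ ω|} := by
    refine (measureReal_mono fun ω (hω : W ω ≤ x) => ?_).trans (measureReal_union_le _ _)
    refine (le_or_gt (W ω + Δ ω) x).imp id fun hW => show |W ω - x| ≤ |Δ ω| from abs_le.2 ⟨?_, ?_⟩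
    · linarith [le_abs_self (Δ ω)]
    · linarith [abs_nonneg (Δ ω)]
  exact abs_le.2 ⟨by linarith, by linarith⟩

lemma measureReal_abs_sub_le_abs_le (W Δ : Ω → ℝ) (x a : ℝ) :
    μ.real {ω | |W ω - x| ≤ |Δ ω|}
      ≤ μ.real {ω | a < |Δ ω|} + μ.real {ω | |W ω - x| ≤ |Δ ω| ∧ |Δ ω| ≤ a} := by
  refine (measureReal_mono fun ω hω => ?_).trans (measureReal_union_le _ _)
  exact (lt_or_ge a |Δ ω|).imp id fun hΔ => ⟨hω, hΔ⟩

end NearLevel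

theorem IsStdSum.nonlinear_berry_esseen {Ω ι : Type*} [MeasurableSpace Ω] [Fintype ι]
    {μ : Measure Ω} {ξ : ι → Ω → ℝ} (h : IsStdSum ξ μ) {δ : ℝ} (hδ0 : 0 < δ)
    (hδ : lyapunov ξ μ ≤ δ) (hi : ∀ i, ∫ ω, |ξ i ω| ∂μ ≤ δ) {Δ : Ω → ℝ} {Δ' : ι → Ω → ℝ}
    (hΔ : IsLeaveOneOut ξ Δ Δ' μ) (x : ℝ) :
    |μ.real {ω | ∑ i, ξ i ω + Δ ω ≤ x} - cdf (gaussianReal 0 1) x|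
      ≤ 3500 * δ + μ.real {ω | (|x| + 1) / 3 < |Δ ω|}
        + 14 * exp 2 * exp (-|x| / 3) * looError ξ Δ Δ' μ := by
  have := h.isProbabilityMeasure
  have h_err : 0 ≤ 14 * exp 2 * exp (-|x| / 3) * looError ξ Δ Δ' μ :=
    mul_nonneg (by positivity) (looError_nonneg ξ Δ Δ' μ)
  have h_tail : 0 ≤ μ.real {ω | (|x| + 1) / 3 < |Δ ω|} := measureReal_nonneg
  by_cases hδ4 : δ ≤ 1 / 4
  · have h_conc := h.concentration hδ0 hδ hδ4 hΔ x
    have h_near := measureReal_abs_sub_le_abs_le (μ := μ) (fun ω => ∑ i, ξ i ω) Δ x ((|x| + 1) / 3)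
    have h_shift := abs_measureReal_add_le_sub_le (μ := μ) (fun ω => ∑ i, ξ i ω) Δ x
    have h_linear := h.berry_esseen hδ0 hδ hi x
    have h_const := mul_le_mul_of_nonneg_right (fourteen_mul_exp_two_mul_exp_le x) hδ0.le
    rw [mul_add] at h_conc
    refine (abs_sub_le _ (μ.real {ω | ∑ i, ξ i ω ≤ x}) _).trans ?_
    linarith
  · have h_diff : |μ.real {ω | ∑ i, ξ i ω + Δ ω ≤ x} - cdf (gaussianReal 0 1) x| ≤ 1 :=
      (abs_sub_le_of_le_of_le measureReal_nonneg measureReal_le_one (cdf_nonneg _ x)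
        (cdf_le_one _ x)).trans_eq (sub_zero 1)
    linarith [not_le.1 hδ4]

end BerryEsseen

namespace GaussUStat

/-! ### The Hoeffding decomposition of a function of independent variables -/

section AlternatingSum

variable {α β : Type*}

/-- The Möbius transform `∑_{B ⊆ A} (-1)^{|A \ B|} a(B)` of a set function `a`, which turns the
conditional means of a function into the components of its Hoeffding decomposition. -/
noncomputable def alternatingSum (a : Finset α → ℝ) (A : Finset α) : ℝ :=
  ∑ B ∈ A.powerset, (-1 : ℝ) ^ (A.card - B.card) * a B

lemma alternatingSum_empty (a : Finset α → ℝ) : alternatingSum a ∅ = a ∅ := by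
  simp [alternatingSum]

lemma alternatingSum_insert [DecidableEq α] (a : Finset α → ℝ) {A : Finset α} {t : α}
    (ht : t ∉ A) :
    alternatingSum a (insert t A) = alternatingSum (fun B => a (insert t B) - a B) A := by
  unfold alternatingSum
  rw [Finset.sum_powerset_insert ht, add_comm, ← Finset.sum_add_distrib]
  refine Finset.sum_congr rfl fun B hB => ?_
  have hBA := Finset.mem_powerset.1 hB
  have h_card := Finset.card_le_card hBA
  rw [Finset.card_insert_of_notMem ht, Finset.card_insert_of_notMem fun htB => ht (hBA htB),
    Nat.add_sub_add_right, Nat.sub_add_comm h_card]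
  ring

lemma sum_powerset_alternatingSum (a : Finset α → ℝ) (S : Finset α) :
    ∑ A ∈ S.powerset, alternatingSum a A = a S := by
  classical
  induction S using Finset.induction_on generalizing a with
  | empty => simp [alternatingSum]
  | insert t S ht ih =>
    have h_insert : ∀ A ∈ S.powerset, alternatingSum a (insert t A)
        = alternatingSum (fun B => a (insert t B) - a B) A := fun A hA =>
      alternatingSum_insert a fun htA => ht (Finset.mem_powerset.1 hA htA)
    rw [Finset.sum_powerset_insert ht, Finset.sum_congr rfl h_insert, ih, ih, add_sub_cancel]

lemma sum_powerset_map {M : Type*} [AddCommMonoid M] (e : α ↪ β) (A : Finset α)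
    (F : Finset β → M) : ∑ B ∈ (A.map e).powerset, F B = ∑ B ∈ A.powerset, F (B.map e) := by
  refine (Finset.sum_bij (fun B _ => B.map e) ?_ ?_ ?_ fun _ _ => rfl).symm
  · exact fun B hB => Finset.mem_powerset.2 (Finset.map_subset_map.2 (Finset.mem_powerset.1 hB))
  · exact fun B _ B' _ hBB' => Finset.map_injective e hBB'
  · intro C hC
    obtain ⟨B, hB, rfl⟩ := Finset.subset_map_iff.1 (Finset.mem_powerset.1 hC)
    exact ⟨B, Finset.mem_powerset.2 hB, rfl⟩

lemma alternatingSum_map (e : α ↪ β) (a : Finset β → ℝ) (A : Finset α) :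
    alternatingSum a (A.map e) = alternatingSum (fun B => a (B.map e)) A := by
  simp only [alternatingSum, sum_powerset_map, Finset.card_map]

end AlternatingSum

section Pi

variable {E ι κ : Type*} [MeasurableSpace E] [Fintype ι] [Fintype κ] {P : Measure E}
  [IsProbabilityMeasure P]

lemma measurePreserving_comp_injective {e : κ → ι} (he : Function.Injective e) :
    MeasurePreserving (fun (x : ι → E) k => x (e k)) (Measure.pi fun _ => P)
      (Measure.pi fun _ => P) := by
  have h_indep := (iIndepFun_pi (μ := fun _ : ι => P) (X := fun _ => id)
    fun _ => aemeasurable_id).precomp he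
  have h_map := h_indep.map_fun_eq_pi_map fun k =>
    (measurable_pi_apply (X := fun _ : ι => E) (e k)).aemeasurable
  exact ⟨by fun_prop, h_map.trans <| congrArg Measure.pi <| funext fun k =>
    (measurePreserving_eval (fun _ : ι => P) (e k)).map_eq⟩

lemma integral_comp_eval {F : E → ℝ} (hF : AEStronglyMeasurable F P) (t : ι) :
    ∫ x : ι → E, F (x t) ∂(Measure.pi fun _ => P) = ∫ e, F e ∂P := by
  have h_eval := measurePreserving_eval (fun _ : ι => P) t
  have h_map := integral_map h_eval.measurable.aemeasurable (h_eval.map_eq.symm ▸ hF)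
  rw [← h_map, h_eval.map_eq]

variable [DecidableEq ι]

lemma measurePreserving_swap_piecewise (S : Finset ι) :
    MeasurePreserving (fun z : (ι → E) × (ι → E) => (S.piecewise z.2 z.1, S.piecewise z.1 z.2))
      ((Measure.pi fun _ => P).prod (Measure.pi fun _ => P))
      ((Measure.pi fun _ => P).prod (Measure.pi fun _ => P)) := by
  let e : ι ⊕ ι → ι ⊕ ι := Sum.elim (fun i => if i ∈ S then .inr i else .inl i)
    (fun i => if i ∈ S then .inl i else .inr i)
  have he : Function.Involutive e := by
    rintro (i | i) <;> by_cases hi : i ∈ S <;> simp [e, hi]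
  convert! ((measurePreserving_sumPiEquivProdPi fun _ : ι ⊕ ι => P).comp
    (measurePreserving_comp_injective he.injective)).comp
    (measurePreserving_sumPiEquivProdPi_symm fun _ : ι ⊕ ι => P) using 1
  ext z i <;> by_cases hi : i ∈ S <;>
    simp [e, hi, MeasurableEquiv.sumPiEquivProdPi, Equiv.sumPiEquivProdPi]

lemma measurePreserving_piecewise (S : Finset ι) :
    MeasurePreserving (fun z : (ι → E) × (ι → E) => S.piecewise z.1 z.2)
      ((Measure.pi fun _ => P).prod (Measure.pi fun _ => P)) (Measure.pi fun _ => P) :=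
  measurePreserving_snd.comp (measurePreserving_swap_piecewise S)

end Pi

lemma enorm_integral_rpow_le {α : Type*} [MeasurableSpace α] {ν : Measure α}
    [IsProbabilityMeasure ν] {p : ENNReal} (hp : 1 ≤ p) (hp_top : p ≠ ⊤) {f : α → ℝ}
    (hf : AEStronglyMeasurable f ν) :
    ‖∫ y, f y ∂ν‖ₑ ^ p.toReal ≤ ∫⁻ y, ‖f y‖ₑ ^ p.toReal ∂ν := by
  have hp0 : p ≠ 0 := (zero_lt_one.trans_le hp).ne'
  calc ‖∫ y, f y ∂ν‖ₑ ^ p.toReal ≤ eLpNorm f p ν ^ p.toReal := by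
        refine ENNReal.rpow_le_rpow ((enorm_integral_le_lintegral_enorm f).trans ?_)
          ENNReal.toReal_nonneg
        rw [← eLpNorm_one_eq_lintegral_enorm]
        exact eLpNorm_le_eLpNorm_of_exponent_le hp hf
    _ = ∫⁻ y, ‖f y‖ₑ ^ p.toReal ∂ν := by
        rw [eLpNorm_eq_lintegral_rpow_enorm_toReal hp0 hp_top, ← ENNReal.rpow_mul,
          one_div_mul_cancel (ENNReal.toReal_pos hp0 hp_top).ne', ENNReal.rpow_one]

lemma memLp_integral_prod {α β : Type*} [MeasurableSpace α] [MeasurableSpace β] {μ : Measure α}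
    {ν : Measure β} [IsProbabilityMeasure ν] {p : ENNReal} (hp : 1 ≤ p) (hp_top : p ≠ ⊤)
    {F : α × β → ℝ} (hF : MemLp F p (μ.prod ν)) :
    MemLp (fun x => ∫ y, F (x, y) ∂ν) p μ := by
  have hp0 : p ≠ 0 := (zero_lt_one.trans_le hp).ne'
  refine ⟨hF.aestronglyMeasurable.integral_prod_right', ?_⟩
  rw [eLpNorm_lt_top_iff_lintegral_rpow_enorm_lt_top hp0 hp_top]
  refine (lintegral_mono_ae ?_).trans_lt
    ((lintegral_prod _ (hF.aestronglyMeasurable.enorm.pow_const p.toReal)).symm.trans_lt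
      (lintegral_rpow_enorm_lt_top_of_eLpNorm_lt_top hp0 hp_top hF.eLpNorm_lt_top))
  filter_upwards [hF.aestronglyMeasurable.prodMk_left] with x hx
  exact enorm_integral_rpow_le hp hp_top hx

section Component

variable {E ι κ : Type*} [MeasurableSpace E] [Fintype ι] [DecidableEq ι] [Fintype κ]
  [DecidableEq κ] {P : Measure E} {F : (ι → E) → ℝ} {p : ENNReal}

/-- The conditional mean of `F(X)` given `X_i = x_i` for `i ∈ S`, where the `X_i` are i.i.d. with
law `P`. -/
noncomputable def partialMean (P : Measure E) (F : (ι → E) → ℝ) (S : Finset ι) (x : ι → E) : ℝ :=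
  ∫ y, F (S.piecewise x y) ∂Measure.pi fun _ => P

/-- The component of `F` belonging to the set `A` of variables in the Hoeffding decomposition. -/
noncomputable def component (P : Measure E) (F : (ι → E) → ℝ) (A : Finset ι) (x : ι → E) : ℝ :=
  alternatingSum (fun B => partialMean P F B x) A

variable [IsProbabilityMeasure P]

lemma sum_component (F : (ι → E) → ℝ) (x : ι → E) : ∑ A, component P F A x = F x := by
  unfold component
  rw [← Finset.powerset_univ, sum_powerset_alternatingSum]
  simp [partialMean]

lemma partialMean_comp_embedding (hF : Measurable F) (e : ι ↪ κ) (S : Finset ι) (x : κ → E) :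
    partialMean P (fun x : κ → E => F fun i => x (e i)) (S.map e) x
      = partialMean P F S fun i => x (e i) := by
  have h_pres := measurePreserving_comp_injective (P := P) e.injective
  have h_arg : ∀ y : κ → E, (fun i => (S.map e).piecewise x y (e i))
      = S.piecewise (fun i => x (e i)) fun i => y (e i) := fun y => by
    ext1 i; by_cases hi : i ∈ S <;> simp [hi]
  have h_meas : Measurable fun y : ι → E => F (S.piecewise (fun i => x (e i)) y) := by
    refine hF.comp (measurable_pi_lambda _ fun i => ?_)
    by_cases hi : i ∈ S <;> simp only [hi, Finset.piecewise_eq_of_mem,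
      Finset.piecewise_eq_of_notMem, not_false_eq_true] <;> fun_prop
  unfold partialMean
  rw [← h_pres.map_eq, integral_map h_pres.measurable.aemeasurable h_meas.aestronglyMeasurable]
  simp only [h_arg]

lemma component_comp_embedding (hF : Measurable F) (e : ι ↪ κ) (A : Finset ι) (x : κ → E) :
    component P (fun x : κ → E => F fun i => x (e i)) (A.map e) x
      = component P F A fun i => x (e i) := by
  simp only [component, alternatingSum_map, partialMean_comp_embedding hF]

lemma memLp_comp_piecewise (hF : MemLp F p (Measure.pi fun _ => P)) (S : Finset ι) :
    MemLp (fun z : (ι → E) × (ι → E) => F (S.piecewise z.1 z.2)) p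
      ((Measure.pi fun _ => P).prod (Measure.pi fun _ => P)) :=
  hF.comp_measurePreserving (measurePreserving_piecewise S)

lemma memLp_partialMean (hp : 1 ≤ p) (hp_top : p ≠ ⊤) (hF : MemLp F p (Measure.pi fun _ => P))
    (S : Finset ι) : MemLp (partialMean P F S) p (Measure.pi fun _ => P) :=
  memLp_integral_prod hp hp_top (memLp_comp_piecewise hF S)

lemma memLp_component (hp : 1 ≤ p) (hp_top : p ≠ ⊤) (hF : MemLp F p (Measure.pi fun _ => P))
    (A : Finset ι) : MemLp (component P F A) p (Measure.pi fun _ => P) :=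
  memLp_finsetSum _ fun B _ => (memLp_partialMean hp hp_top hF B).const_mul _

variable {G : (ι → E) → ℝ}

lemma integral_partialMean_mul (hF : MemLp F 2 (Measure.pi fun _ => P))
    (hG : MemLp G 2 (Measure.pi fun _ => P)) (B : Finset ι) :
    ∫ x, partialMean P F B x * G x ∂(Measure.pi fun _ => P)
      = ∫ z : (ι → E) × (ι → E), F (B.piecewise z.1 z.2) * G z.1
          ∂(Measure.pi fun _ => P).prod (Measure.pi fun _ => P) := by
  have h_int : Integrable (fun z : (ι → E) × (ι → E) => F (B.piecewise z.1 z.2) * G z.1)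
      ((Measure.pi fun _ => P).prod (Measure.pi fun _ => P)) :=
    BerryEsseen.integrable_fun_mul (memLp_comp_piecewise hF B)
      (hG.comp_measurePreserving measurePreserving_fst)
  rw [integral_prod _ h_int]
  simp only [integral_mul_const, partialMean]

-- Exchange the `t`-th entries of the two independent samples.
lemma integral_partialMean_insert_mul (hF : MemLp F 2 (Measure.pi fun _ => P))
    (hG : MemLp G 2 (Measure.pi fun _ => P)) {t : ι} (hGt : ∀ x e, G (Function.update x t e) = G x)
    {B : Finset ι} (ht : t ∉ B) :
    ∫ x, partialMean P F (insert t B) x * G x ∂(Measure.pi fun _ => P)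
      = ∫ x, partialMean P F B x * G x ∂(Measure.pi fun _ => P) := by
  have h_swap := measurePreserving_swap_piecewise (P := P) {t}
  have h_meas : AEStronglyMeasurable
      (fun z : (ι → E) × (ι → E) => F ((insert t B).piecewise z.1 z.2) * G z.1)
      ((Measure.pi fun _ => P).prod (Measure.pi fun _ => P)) :=
    (memLp_comp_piecewise hF _).aestronglyMeasurable.mul
      (hG.comp_measurePreserving measurePreserving_fst).aestronglyMeasurable
  rw [integral_partialMean_mul hF hG, integral_partialMean_mul hF hG]
  conv_lhs => rw [← h_swap.map_eq]
  rw [integral_map h_swap.measurable.aemeasurable (h_swap.map_eq.symm ▸ h_meas)]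
  refine integral_congr_ae (.of_forall fun z => ?_)
  have h_arg : (insert t B).piecewise (({t} : Finset ι).piecewise z.2 z.1)
      (({t} : Finset ι).piecewise z.1 z.2) = B.piecewise z.1 z.2 := by
    ext1 i
    rcases eq_or_ne i t with rfl | hi
    · simp [ht]
    · by_cases hiB : i ∈ B <;> simp [hi, hiB]
  simp only
  rw [h_arg, Finset.piecewise_singleton, hGt]

lemma integral_component_mul_eq_zero (hF : MemLp F 2 (Measure.pi fun _ => P))
    (hG : MemLp G 2 (Measure.pi fun _ => P)) {t : ι} (hGt : ∀ x e, G (Function.update x t e) = G x)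
    {A : Finset ι} (ht : t ∈ A) :
    ∫ x, component P F A x * G x ∂(Measure.pi fun _ => P) = 0 := by
  have h_int : ∀ B, Integrable (fun x => partialMean P F B x * G x) (Measure.pi fun _ => P) :=
    fun B => BerryEsseen.integrable_fun_mul
      (memLp_partialMean one_le_two ENNReal.ofNat_ne_top hF B) hG
  have h_diff : ∀ B, Integrable (fun x => (partialMean P F (insert t B) x - partialMean P F B x)
      * G x) (Measure.pi fun _ => P) := fun B => by
    simp only [sub_mul]
    exact (h_int _).sub (h_int _)
  have h_zero : ∀ B ∈ (A.erase t).powerset, ∫ x, (partialMean P F (insert t B) x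
      - partialMean P F B x) * G x ∂(Measure.pi fun _ => P) = 0 := fun B hB => by
    have htB : t ∉ B := fun h => Finset.notMem_erase t A (Finset.mem_powerset.1 hB h)
    simp only [sub_mul]
    rw [integral_sub (h_int _) (h_int _), integral_partialMean_insert_mul hF hG hGt htB, sub_self]
  rw [← Finset.insert_erase ht]
  simp only [component, alternatingSum_insert _ (Finset.notMem_erase t A)]
  simp only [alternatingSum, Finset.sum_mul, mul_assoc]
  rw [integral_finsetSum _ fun B _ => (h_diff B).const_mul _]
  refine Finset.sum_eq_zero fun B hB => ?_
  rw [integral_const_mul, h_zero B hB, mul_zero]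

end Component

/-! ### The Hoeffding decomposition of a U-statistic -/

section Projections

variable {E : Type*} [MeasurableSpace E] {P : Measure E} {m n r : ℕ} {h : (Fin m → E) → ℝ}

lemma hoeffdingProj_eq_alternatingSum (P : Measure E) (h : (Fin m → E) → ℝ) (z : Fin r → E) :
    hoeffdingProj P h r z = alternatingSum (fun A => mixedMean P h A z) Finset.univ := by
  rw [alternatingSum, Finset.powerset_univ, Finset.card_univ, Fintype.card_fin, hoeffdingProj]

lemma mixedMean_castLE (P : Measure E) (h : (Fin m → E) → ℝ) (hr : r ≤ m) (A : Finset (Fin r))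
    (x : Fin m → E) :
    mixedMean P h A (fun j => x (Fin.castLE hr j))
      = partialMean P h (A.map (Fin.castLEEmb hr)) x := by
  unfold mixedMean partialMean
  congr! 3 with y
  ext1 i
  by_cases hi : i.val < r
  · obtain ⟨j, rfl⟩ : ∃ j, i = Fin.castLEEmb hr j := ⟨⟨i, hi⟩, rfl⟩
    by_cases hj : j ∈ A <;> simp [hj]
  · have h_notMem : i ∉ A.map (Fin.castLEEmb hr) := fun hiA => by
      obtain ⟨j, _, rfl⟩ := Finset.mem_map.1 hiA
      exact hi j.isLt
    simp [hi, h_notMem]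

lemma hoeffdingProj_castLE (P : Measure E) (h : (Fin m → E) → ℝ) (hr : r ≤ m) (x : Fin m → E) :
    hoeffdingProj P h r (fun j => x (Fin.castLE hr j))
      = component P h (Finset.univ.map (Fin.castLEEmb hr)) x := by
  simp only [hoeffdingProj_eq_alternatingSum, component, alternatingSum_map, mixedMean_castLE]

lemma exists_hoeffdingProj_eq_component [IsProbabilityMeasure P] (hh : Measurable h) (hr : r ≤ m)
    (hmn : m ≤ n) (j : Fin r ↪ Fin n) :
    ∃ i : Fin m ↪ Fin n, ∀ x : Fin n → E, hoeffdingProj P h r (fun k => x (j k))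
      = component P (fun x => h fun k => x (i k)) (Finset.univ.map j) x := by
  obtain ⟨σ, hσ⟩ := Equiv.Perm.exists_extending_pair (Fin.castLE (hr.trans hmn)) j
    (Fin.castLE_injective _) j.injective
  let i : Fin m ↪ Fin n := (Fin.castLEEmb hmn).trans σ.toEmbedding
  have hi : ∀ k, i (Fin.castLE hr k) = j k := hσ
  refine ⟨i, fun x => ?_⟩
  have h_map : Finset.univ.map j = (Finset.univ.map (Fin.castLEEmb hr)).map i := by
    rw [Finset.map_map]
    exact congrArg (Finset.map · Finset.univ) (Function.Embedding.ext fun k => (hi k).symm)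
  rw [h_map, component_comp_embedding hh, ← hoeffdingProj_castLE]
  simp only [hi]

lemma component_map_of_symm [IsProbabilityMeasure P] (hh : Measurable h)
    (h_symm : ∀ (σ : Equiv.Perm (Fin m)) x, h (fun i => x (σ i)) = h x) (j : Fin r ↪ Fin m)
    (x : Fin m → E) :
    component P h (Finset.univ.map j) x = hoeffdingProj P h r fun k => x (j k) := by
  have hr : r ≤ m := by simpa using Fintype.card_le_of_embedding j
  obtain ⟨i, hi⟩ := exists_hoeffdingProj_eq_component (P := P) hh hr le_rfl j
  have h_perm : (fun x : Fin m → E => h fun k => x (i k)) = h :=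
    funext (h_symm (Equiv.ofBijective i (Finite.injective_iff_bijective.1 i.injective)))
  rw [hi, h_perm]

lemma hoeffdingProj_zero (P : Measure E) (h : (Fin m → E) → ℝ) (z : Fin 0 → E) :
    hoeffdingProj P h 0 z = ∫ y, h y ∂Measure.pi fun _ => P := by
  simp [hoeffdingProj, mixedMean]

lemma hoeffdingProj_one (P : Measure E) (h : (Fin m → E) → ℝ) (z : Fin 1 → E) :
    hoeffdingProj P h 1 z = projKernel P h (z 0) - ∫ y, h y ∂Measure.pi fun _ => P := by
  have h_singleton : mixedMean P h {0} z = projKernel P h (z 0) := by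
    unfold mixedMean projKernel
    congr! 3 with y
    ext1 i
    by_cases hi : i.val = 0 <;> simp [hi]
  rw [hoeffdingProj_eq_alternatingSum, Finset.univ_unique, ← insert_empty_eq,
    alternatingSum_insert _ (Finset.notMem_empty _), alternatingSum_empty]
  simp [← h_singleton, mixedMean]

lemma measurable_mixedMean [SigmaFinite P] (hh : Measurable h) (A : Finset (Fin r)) :
    Measurable (mixedMean P h A) := by
  have h_arg : Measurable fun z : (Fin r → E) × (Fin m → E) => h fun i => if hi : i.val < r then
      (if ⟨i.val, hi⟩ ∈ A then z.1 ⟨i.val, hi⟩ else z.2 i) else z.2 i := by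
    refine hh.comp (measurable_pi_lambda _ fun i => ?_)
    split_ifs <;> fun_prop
  exact h_arg.stronglyMeasurable.integral_prod_right.measurable

lemma measurable_hoeffdingProj [SigmaFinite P] (hh : Measurable h) (r : ℕ) :
    Measurable (hoeffdingProj P h r) :=
  Finset.measurable_fun_sum _ fun A _ => (measurable_mixedMean hh A).const_mul _

end Projections

section Term

variable {E : Type*} [MeasurableSpace E] {P : Measure E} {m n : ℕ} {h : (Fin m → E) → ℝ}

/-- The Hoeffding projection of `h` of order `|A|` at the observations with index in `A`. -/
noncomputable def hoeffdingTerm (P : Measure E) (h : (Fin m → E) → ℝ) (A : Finset (Fin n))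
    (x : Fin n → E) : ℝ :=
  hoeffdingProj P h A.card fun j => x (A.orderEmbOfFin rfl j)

lemma measurable_hoeffdingTerm [SigmaFinite P] (hh : Measurable h) (A : Finset (Fin n)) :
    Measurable (hoeffdingTerm P h A) :=
  (measurable_hoeffdingProj hh A.card).comp (by fun_prop)

lemma hoeffdingTerm_update {A : Finset (Fin n)} {t : Fin n} (ht : t ∉ A) (x : Fin n → E) (e : E) :
    hoeffdingTerm P h A (Function.update x t e) = hoeffdingTerm P h A x := by
  have h_ne : ∀ j, A.orderEmbOfFin rfl j ≠ t := fun j hj => ht (hj ▸ A.orderEmbOfFin_mem rfl j)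
  simp only [hoeffdingTerm, Function.update_of_ne (h_ne _)]

lemma hoeffdingTerm_image {r : ℕ} {i : Fin r → Fin n} (hi : StrictMono i) (x : Fin n → E) :
    hoeffdingTerm P h (Finset.univ.image i) x = hoeffdingProj P h r fun j => x (i j) := by
  have h_card : (Finset.univ.image i).card = r := by
    rw [Finset.card_image_of_injective _ hi.injective, Finset.card_univ, Fintype.card_fin]
  have h_mem : ∀ j, i j ∈ Finset.univ.image i := fun j =>
    Finset.mem_image_of_mem i (Finset.mem_univ j)
  unfold hoeffdingTerm
  generalize Finset.univ.image i = A at h_card h_mem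
  subst h_card
  rw [← Finset.orderEmbOfFin_unique rfl h_mem hi]

lemma hoeffdingTerm_empty (P : Measure E) (h : (Fin m → E) → ℝ) (x : Fin n → E) :
    hoeffdingTerm P h ∅ x = ∫ y, h y ∂Measure.pi fun _ => P :=
  hoeffdingProj_zero P h _

lemma hoeffdingTerm_singleton (P : Measure E) (h : (Fin m → E) → ℝ) (t : Fin n) (x : Fin n → E) :
    hoeffdingTerm P h {t} x = projKernel P h (x t) - ∫ y, h y ∂Measure.pi fun _ => P := by
  have h_image : ({t} : Finset (Fin n)) = Finset.univ.image fun _ : Fin 1 => t := by simp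
  rw [h_image, hoeffdingTerm_image (Subsingleton.strictMono _), hoeffdingProj_one]

/-- The second moment of the Hoeffding projection of order `r`. -/
noncomputable def projVar (P : Measure E) (h : (Fin m → E) → ℝ) (r : ℕ) : ℝ :=
  ∫ z, hoeffdingProj P h r z ^ 2 ∂Measure.pi fun _ => P

lemma projVar_nonneg (P : Measure E) (h : (Fin m → E) → ℝ) (r : ℕ) : 0 ≤ projVar P h r :=
  integral_nonneg fun _ => sq_nonneg _

variable [IsProbabilityMeasure P]

lemma exists_hoeffdingTerm_eq_component (hh : Measurable h) (hmn : m ≤ n) {A : Finset (Fin n)}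
    (hA : A.card ≤ m) :
    ∃ i : Fin m ↪ Fin n, ∀ x, hoeffdingTerm P h A x
      = component P (fun x => h fun k => x (i k)) A x := by
  obtain ⟨i, hi⟩ := exists_hoeffdingProj_eq_component (P := P) hh hA hmn
    (A.orderEmbOfFin rfl).toEmbedding
  refine ⟨i, fun x => (hi x).trans ?_⟩
  rw [Finset.map_orderEmbOfFin_univ]

lemma memLp_hoeffdingTerm (hh : Measurable h) (h2 : MemLp h 2 (Measure.pi fun _ => P))
    (hmn : m ≤ n) {A : Finset (Fin n)} (hA : A.card ≤ m) :
    MemLp (hoeffdingTerm P h A) 2 (Measure.pi fun _ => P) := by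
  obtain ⟨i, hi⟩ := exists_hoeffdingTerm_eq_component (P := P) hh hmn hA
  rw [funext hi]
  exact memLp_component one_le_two ENNReal.ofNat_ne_top
    (h2.comp_measurePreserving (measurePreserving_comp_injective i.injective)) A

lemma integral_hoeffdingTerm_mul_eq_zero (hh : Measurable h)
    (h2 : MemLp h 2 (Measure.pi fun _ => P)) (hmn : m ≤ n) {A : Finset (Fin n)} (hA : A.card ≤ m)
    {G : (Fin n → E) → ℝ} (hG : MemLp G 2 (Measure.pi fun _ => P)) {t : Fin n}
    (hGt : ∀ x e, G (Function.update x t e) = G x) (ht : t ∈ A) :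
    ∫ x, hoeffdingTerm P h A x * G x ∂(Measure.pi fun _ => P) = 0 := by
  obtain ⟨i, hi⟩ := exists_hoeffdingTerm_eq_component (P := P) hh hmn hA
  simp only [hi]
  exact integral_component_mul_eq_zero
    (h2.comp_measurePreserving (measurePreserving_comp_injective i.injective)) hG hGt ht

lemma integral_hoeffdingTerm_mul_hoeffdingTerm (hh : Measurable h)
    (h2 : MemLp h 2 (Measure.pi fun _ => P)) (hmn : m ≤ n) {A B : Finset (Fin n)}
    (hA : A.card ≤ m) (hB : B.card ≤ m) (hAB : A ≠ B) :
    ∫ x, hoeffdingTerm P h A x * hoeffdingTerm P h B x ∂(Measure.pi fun _ => P) = 0 := by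
  wlog h_sub : ¬A ⊆ B generalizing A B
  · simp only [mul_comm (hoeffdingTerm P h A _)]
    exact this hB hA hAB.symm fun hBA => hAB ((not_not.1 h_sub).antisymm hBA)
  obtain ⟨t, htA, htB⟩ := Finset.not_subset.1 h_sub
  exact integral_hoeffdingTerm_mul_eq_zero hh h2 hmn hA (memLp_hoeffdingTerm hh h2 hmn hB)
    (hoeffdingTerm_update htB) htA

lemma integral_hoeffdingTerm_sq (hh : Measurable h) (A : Finset (Fin n)) :
    ∫ x, hoeffdingTerm P h A x ^ 2 ∂(Measure.pi fun _ => P) = projVar P h A.card := by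
  have h_pres := measurePreserving_comp_injective (P := P) (A.orderEmbOfFin rfl).injective
  rw [projVar, ← h_pres.map_eq, integral_map h_pres.measurable.aemeasurable
    ((measurable_hoeffdingProj hh _).pow_const 2).aestronglyMeasurable]
  rfl

lemma component_eq_hoeffdingTerm (hh : Measurable h)
    (h_symm : ∀ (σ : Equiv.Perm (Fin m)) x, h (fun i => x (σ i)) = h x) {i : Fin m → Fin n}
    (hi : StrictMono i) (B : Finset (Fin m)) (x : Fin n → E) :
    component P h B (fun j => x (i j)) = hoeffdingTerm P h (B.image i) x := by
  have h_map := Finset.map_orderEmbOfFin_univ B rfl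
  have h_image : B.image i = Finset.univ.image fun j => i (B.orderEmbOfFin rfl j) := by
    conv_lhs => rw [← h_map, Finset.map_eq_image, Finset.image_image]
    rfl
  rw [h_image, hoeffdingTerm_image (i := fun j => i (B.orderEmbOfFin rfl j))
    (hi.comp (B.orderEmbOfFin rfl).strictMono)]
  conv_lhs => rw [← h_map]
  exact component_map_of_symm hh h_symm _ _

lemma sum_powerset_hoeffdingTerm (hh : Measurable h)
    (h_symm : ∀ (σ : Equiv.Perm (Fin m)) x, h (fun i => x (σ i)) = h x) {i : Fin m → Fin n}
    (hi : StrictMono i) (x : Fin n → E) :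
    ∑ A ∈ (Finset.univ.image i).powerset, hoeffdingTerm P h A x = h fun j => x (i j) := by
  have h_image : ∀ B : Finset (Fin m), B.image i = B.map ⟨i, hi.injective⟩ := fun B => by
    rw [Finset.map_eq_image]; rfl
  rw [h_image, sum_powerset_map, Finset.powerset_univ, ← sum_component (P := P) h]
  simp only [component_eq_hoeffdingTerm hh h_symm hi, h_image]

end Term

section IndexSet

variable {n r : ℕ} {i : Fin r → Fin n}

lemma mem_indexSet : i ∈ indexSet n r ↔ StrictMono i := by simp [indexSet]

lemma image_mem_powersetCard (hi : StrictMono i) :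
    Finset.univ.image i ∈ Finset.powersetCard r Finset.univ := by
  rw [Finset.mem_powersetCard_univ, Finset.card_image_of_injective _ hi.injective,
    Finset.card_univ, Fintype.card_fin]

lemma sum_indexSet (n r : ℕ) (F : Finset (Fin n) → ℝ) :
    ∑ i ∈ indexSet n r, F (Finset.univ.image i)
      = ∑ S ∈ Finset.powersetCard r Finset.univ, F S := by
  refine Finset.sum_bij (fun i _ => Finset.univ.image i)
    (fun i hi => image_mem_powersetCard (mem_indexSet.1 hi)) ?_ ?_ fun _ _ => rfl
  · intro i hi j hj hij
    exact (StrictMono.range_inj (mem_indexSet.1 hi) (mem_indexSet.1 hj)).1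
      (by simpa using congrArg (fun S : Finset (Fin n) => (S : Set (Fin n))) hij)
  · intro S hS
    have h_card := Finset.mem_powersetCard_univ.1 hS
    refine ⟨S.orderEmbOfFin h_card, mem_indexSet.2 (S.orderEmbOfFin h_card).strictMono, ?_⟩
    exact Finset.image_orderEmbOfFin_univ S h_card

end IndexSet

section Weight

variable {m n r : ℕ}

/-- The coefficient of a Hoeffding term of order `r` in the U-statistic. -/
noncomputable def weight (n m r : ℕ) : ℝ := m.choose r / n.choose r

lemma weight_of_lt (hr : m < r) : weight n m r = 0 := by
  rw [weight, Nat.choose_eq_zero_of_lt hr, Nat.cast_zero, zero_div]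

lemma weight_one : weight n m 1 = m / n := by simp [weight]

lemma weight_self (hr : r ≤ m) : weight m m r = 1 :=
  div_self (Nat.cast_ne_zero.2 (Nat.choose_pos hr).ne')

lemma weight_nonneg (n m r : ℕ) : 0 ≤ weight n m r := by unfold weight; positivity

lemma weight_succ (hrm : r ≤ m) (hrn : r < n) :
    weight n m (r + 1) = weight n m r * ((m - r) / (n - r)) := by
  have h_succ : ∀ k, r ≤ k → (k.choose (r + 1) : ℝ) = k.choose r * (k - r) / (r + 1) :=
    fun k hk => by
      rw [eq_div_iff (by positivity), ← Nat.cast_sub hk]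
      exact_mod_cast Nat.choose_succ_right_eq k r
  rw [weight, weight, h_succ m hrm, h_succ n hrn.le, div_div_div_cancel_right₀ (by positivity),
    mul_div_mul_comm]

lemma succ_mul_weight_succ_le (hmn : 2 * m < n) (hr : 1 ≤ r) (hrm : r ≤ m) :
    ((r + 1 : ℕ) : ℝ) * weight n m (r + 1) ≤ r * weight n m r := by
  have hr1 : (1 : ℝ) ≤ r := by exact_mod_cast hr
  have hrm' : (r : ℝ) ≤ m := by exact_mod_cast hrm
  have hmn' : (2 * m : ℝ) < n := by exact_mod_cast hmn
  have h_ratio : ((r + 1 : ℕ) : ℝ) * ((m - r) / (n - r)) ≤ r := by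
    rw [← mul_div_assoc, div_le_iff₀ (by linarith)]
    push_cast
    nlinarith
  rw [weight_succ hrm (by omega), mul_left_comm, mul_comm (r : ℝ)]
  exact mul_le_mul_of_nonneg_left h_ratio (weight_nonneg n m r)

lemma mul_weight_le (hmn : 2 * m < n) (hr : 2 ≤ r) (hrm : r ≤ m) :
    r * weight n m r ≤ 2 * (m * (m - 1) / (n * (n - 1))) := by
  induction r, hr using Nat.le_induction with
  | base =>
    rw [weight, Nat.cast_choose_two, Nat.cast_choose_two, div_div_div_cancel_right₀ two_ne_zero,
      Nat.cast_ofNat]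
  | succ r hr ih =>
    exact (succ_mul_weight_succ_le hmn (by omega) (by omega)).trans (ih (by omega))

lemma inv_choose_mul_card_filter (hmn : m ≤ n) (A : Finset (Fin n)) :
    (n.choose m : ℝ)⁻¹ * ((Finset.powersetCard m Finset.univ).filter (A ⊆ ·)).card
      = weight n m A.card := by
  rcases le_or_gt A.card m with hA | hA
  · have hAn : A.card ≤ n := hA.trans hmn
    have hm0 : (n.choose m : ℝ) ≠ 0 := Nat.cast_ne_zero.2 (Nat.choose_pos hmn).ne'
    have hA0 : (n.choose A.card : ℝ) ≠ 0 := Nat.cast_ne_zero.2 (Nat.choose_pos hAn).ne'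
    rw [Finset.card_filter_powersetCard_subset _ _ _ (Finset.subset_univ A) hA, weight,
      inv_mul_eq_div, div_eq_div_iff hm0 hA0, Finset.card_univ, Fintype.card_fin, mul_comm,
      mul_comm (m.choose A.card : ℝ)]
    exact_mod_cast (Nat.choose_mul hA).symm
  · rw [weight_of_lt hA, Finset.filter_eq_empty_iff.2, Finset.card_empty, Nat.cast_zero, mul_zero]
    intro S hS hAS
    exact (Finset.card_le_card hAS).not_gt (Finset.mem_powersetCard_univ.1 hS ▸ hA)

end Weight

section Sum

variable {E : Type*} [MeasurableSpace E] {P : Measure E} {m n : ℕ} {h : (Fin m → E) → ℝ}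

/-- The part of the Hoeffding decomposition of the U-statistic made up of the terms belonging to
the sets of observations in `J`. -/
noncomputable def hoeffdingSum (P : Measure E) (h : (Fin m → E) → ℝ) (J : Finset (Finset (Fin n)))
    (x : Fin n → E) : ℝ :=
  ∑ A ∈ J, weight n m A.card * hoeffdingTerm P h A x

/-- The sets of observations which index the nonlinear terms of the Hoeffding decomposition. -/
def higherSets (n m : ℕ) : Finset (Finset (Fin n)) :=
  Finset.univ.filter fun A => 2 ≤ A.card ∧ A.card ≤ m

lemma mem_higherSets {A : Finset (Fin n)} : A ∈ higherSets n m ↔ 2 ≤ A.card ∧ A.card ≤ m := by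
  simp [higherSets]

lemma sum_higherSets (F : Finset (Fin n) → ℝ) :
    ∑ A ∈ higherSets n m, F A
      = ∑ r ∈ Finset.Icc 2 m, ∑ A ∈ Finset.powersetCard r Finset.univ, F A := by
  rw [← Finset.sum_fiberwise_of_maps_to (g := Finset.card) (t := Finset.Icc 2 m)
    fun A hA => Finset.mem_Icc.2 (mem_higherSets.1 hA)]
  refine Finset.sum_congr rfl fun r hr => Finset.sum_congr ?_ fun _ _ => rfl
  ext A
  rw [Finset.mem_filter, mem_higherSets, Finset.mem_powersetCard_univ]
  exact and_iff_right_of_imp fun hA => hA ▸ Finset.mem_Icc.1 hr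

lemma hoeffdingRemainder_eq_hoeffdingSum (P : Measure E) (h : (Fin m → E) → ℝ) (x : Fin n → E) :
    hoeffdingRemainder P h (fun i (y : Fin n → E) => y i) x
      = hoeffdingSum P h (higherSets n m) x := by
  have h_uStat : ∀ r, uStat (hoeffdingProj P h r) (fun i (y : Fin n → E) => y i) x
      = (n.choose r : ℝ)⁻¹ * ∑ A ∈ Finset.powersetCard r Finset.univ, hoeffdingTerm P h A x :=
    fun r => by
      rw [uStat, ← sum_indexSet]
      exact congrArg _ <| Finset.sum_congr rfl fun i hi =>
        (hoeffdingTerm_image (mem_indexSet.1 hi) x).symm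
  rw [hoeffdingRemainder, hoeffdingSum, sum_higherSets]
  refine Finset.sum_congr rfl fun r _ => ?_
  rw [h_uStat, ← mul_assoc, Finset.mul_sum, ← div_eq_mul_inv]
  refine Finset.sum_congr rfl fun A hA => ?_
  rw [Finset.mem_powersetCard_univ.1 hA, weight]

lemma uStat_eq_hoeffdingSum_univ [IsProbabilityMeasure P] (hh : Measurable h)
    (h_symm : ∀ (σ : Equiv.Perm (Fin m)) x, h (fun i => x (σ i)) = h x) (hmn : m ≤ n)
    (x : Fin n → E) :
    uStat h (fun i (y : Fin n → E) => y i) x = hoeffdingSum P h Finset.univ x := by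
  have h_kernel : ∑ i ∈ indexSet n m, h (fun j => x (i j))
      = ∑ S ∈ Finset.powersetCard m Finset.univ, ∑ A ∈ S.powerset, hoeffdingTerm P h A x := by
    rw [← sum_indexSet]
    exact Finset.sum_congr rfl fun i hi =>
      (sum_powerset_hoeffdingTerm hh h_symm (mem_indexSet.1 hi) x).symm
  have h_comm : ∑ S ∈ Finset.powersetCard m Finset.univ, ∑ A ∈ S.powerset, hoeffdingTerm P h A x
      = ∑ A : Finset (Fin n), ∑ _S ∈ (Finset.powersetCard m Finset.univ).filter (A ⊆ ·),
          hoeffdingTerm P h A x :=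
    Finset.sum_comm' fun S A => by simp
  rw [uStat, h_kernel, h_comm, Finset.mul_sum]
  refine Finset.sum_congr rfl fun A _ => ?_
  rw [Finset.sum_const, nsmul_eq_mul, ← mul_assoc, inv_choose_mul_card_filter hmn]

lemma hoeffdingSum_univ_of_integral_eq_zero (h0 : ∫ y, h y ∂(Measure.pi fun _ => P) = 0)
    (x : Fin n → E) :
    hoeffdingSum P h Finset.univ x
      = m / n * ∑ t, projKernel P h (x t) + hoeffdingSum P h (higherSets n m) x := by
  have h_linear : ∑ A ∈ Finset.powersetCard 1 Finset.univ, weight n m A.card * hoeffdingTerm P h A x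
      = m / n * ∑ t, projKernel P h (x t) := by
    simp [Finset.powersetCard_one, hoeffdingTerm_singleton, h0, weight_one, Finset.mul_sum]
  have h_disj : Disjoint (Finset.powersetCard 1 Finset.univ) (higherSets n m) := by
    refine Finset.disjoint_left.2 fun A hA hA' => ?_
    have := (mem_higherSets.1 hA').1
    rw [Finset.mem_powersetCard_univ.1 hA] at this
    omega
  rw [← h_linear, hoeffdingSum, hoeffdingSum, ← Finset.sum_union h_disj]
  refine (Finset.sum_subset (Finset.subset_univ _) fun A _ hA => ?_).symm
  rw [Finset.mem_union, Finset.mem_powersetCard_univ, mem_higherSets] at hA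
  rcases A.eq_empty_or_nonempty with rfl | hA0
  · rw [hoeffdingTerm_empty, h0, mul_zero]
  · have := hA0.card_pos
    rw [weight_of_lt (by omega), zero_mul]

lemma hoeffdingSum_sub_hoeffdingSum_filter (J : Finset (Finset (Fin n))) (t : Fin n)
    (x : Fin n → E) :
    hoeffdingSum P h J x - hoeffdingSum P h (J.filter (t ∉ ·)) x
      = hoeffdingSum P h (J.filter (t ∈ ·)) x := by
  unfold hoeffdingSum
  rw [← Finset.sum_filter_add_sum_filter_not J (t ∈ ·), add_sub_cancel_right]

lemma hoeffdingSum_filter_update (J : Finset (Finset (Fin n))) (t : Fin n) (x : Fin n → E) (e : E) :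
    hoeffdingSum P h (J.filter (t ∉ ·)) (Function.update x t e)
      = hoeffdingSum P h (J.filter (t ∉ ·)) x :=
  Finset.sum_congr rfl fun A hA => by rw [hoeffdingTerm_update (Finset.mem_filter.1 hA).2]

lemma measurable_hoeffdingSum [SigmaFinite P] (hh : Measurable h) (J : Finset (Finset (Fin n))) :
    Measurable (hoeffdingSum P h J) :=
  Finset.measurable_fun_sum _ fun A _ => (measurable_hoeffdingTerm hh A).const_mul _

section Moments

variable [IsProbabilityMeasure P] (hh : Measurable h) (h2 : MemLp h 2 (Measure.pi fun _ => P))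
  (hmn : m ≤ n) {J : Finset (Finset (Fin n))} (hJ : ∀ A ∈ J, A.card ≤ m)

include hh h2 hmn hJ

lemma memLp_hoeffdingSum : MemLp (hoeffdingSum P h J) 2 (Measure.pi fun _ => P) :=
  memLp_finsetSum _ fun A hA => (memLp_hoeffdingTerm hh h2 hmn (hJ A hA)).const_mul _

lemma integral_hoeffdingSum_sq :
    ∫ x, hoeffdingSum P h J x ^ 2 ∂(Measure.pi fun _ => P)
      = ∑ A ∈ J, weight n m A.card ^ 2 * projVar P h A.card := by
  have h_int : ∀ A ∈ J, ∀ B ∈ J, Integrable (fun x => weight n m A.card * weight n m B.card *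
      (hoeffdingTerm P h A x * hoeffdingTerm P h B x)) (Measure.pi fun _ => P) :=
    fun A hA B hB => (BerryEsseen.integrable_fun_mul (memLp_hoeffdingTerm hh h2 hmn (hJ A hA))
      (memLp_hoeffdingTerm hh h2 hmn (hJ B hB))).const_mul _
  have h_expand : ∀ x : Fin n → E, hoeffdingSum P h J x ^ 2 = ∑ A ∈ J, ∑ B ∈ J,
      weight n m A.card * weight n m B.card * (hoeffdingTerm P h A x * hoeffdingTerm P h B x) :=
    fun x => by
      rw [hoeffdingSum, sq, Finset.sum_mul_sum]
      exact Finset.sum_congr rfl fun A _ => Finset.sum_congr rfl fun B _ =>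
        mul_mul_mul_comm _ _ _ _
  simp only [h_expand]
  rw [integral_finsetSum _ fun A hA => integrable_finsetSum _ fun B hB => h_int A hA B hB]
  refine Finset.sum_congr rfl fun A hA => ?_
  rw [integral_finsetSum _ fun B hB => h_int A hA B hB, Finset.sum_eq_single_of_mem A hA]
  · simp only [integral_const_mul, ← sq, integral_hoeffdingTerm_sq hh]
  · intro B hB hBA
    rw [integral_const_mul, integral_hoeffdingTerm_mul_hoeffdingTerm hh h2 hmn (hJ A hA) (hJ B hB)
      hBA.symm, mul_zero]

end Moments

end Sum

/-- A centred symmetric kernel of order `m` with a finite second moment, for i.i.d. observations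
with law `P`. -/
structure IsCenteredKernel {E : Type*} [MeasurableSpace E] {m : ℕ} (P : Measure E)
    (h : (Fin m → E) → ℝ) : Prop where
  measurable : Measurable h
  symm : ∀ (σ : Equiv.Perm (Fin m)) x, h (fun i => x (σ i)) = h x
  memLp : MemLp h 2 (Measure.pi fun _ => P)
  integral_eq_zero : ∫ y, h y ∂(Measure.pi fun _ => P) = 0

namespace IsCenteredKernel

variable {E : Type*} [MeasurableSpace E] {P : Measure E} [IsProbabilityMeasure P] {m n : ℕ}
  {h : (Fin m → E) → ℝ}

lemma uStat_eq (hh : IsCenteredKernel P h) (hmn : m ≤ n) (x : Fin n → E) :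
    uStat h (fun i (y : Fin n → E) => y i) x
      = m / n * ∑ t, projKernel P h (x t) + hoeffdingSum P h (higherSets n m) x := by
  rw [uStat_eq_hoeffdingSum_univ (P := P) hh.measurable hh.symm hmn,
    hoeffdingSum_univ_of_integral_eq_zero hh.integral_eq_zero]

lemma hoeffdingSum_univ (hh : IsCenteredKernel P h) (x : Fin m → E) :
    hoeffdingSum P h Finset.univ x = h x := by
  have h_card : ∀ A : Finset (Fin m), A.card ≤ m := fun A => by simpa using A.card_le_univ
  have h_kernel := sum_powerset_hoeffdingTerm (P := P) hh.measurable hh.symm (i := id)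
    strictMono_id x
  simpa [hoeffdingSum, weight_self (h_card _)] using h_kernel

lemma sigmaH_sq (hh : IsCenteredKernel P h) :
    sigmaH P h ^ 2 = ∑ r ∈ Finset.range (m + 1), m.choose r * projVar P h r := by
  have h_card : ∀ A : Finset (Fin m), A.card ≤ m := fun A => by simpa using A.card_le_univ
  have h_sq := integral_hoeffdingSum_sq (P := P) (n := m) hh.measurable hh.memLp le_rfl
    (J := Finset.univ) fun A _ => h_card A
  simp only [hh.hoeffdingSum_univ, weight_self (h_card _), one_pow, one_mul] at h_sq
  rw [sigmaH, Real.sq_sqrt (variance_nonneg _ _), variance_of_integral_eq_zero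
    hh.measurable.aemeasurable hh.integral_eq_zero, h_sq, ← Finset.powerset_univ,
    Finset.sum_powerset_apply_card]
  simp

lemma sum_card_mul_sq_weight_mul_projVar_le (hh : IsCenteredKernel P h) (hm : 1 ≤ m)
    (hmn : 2 * m < n) :
    ∑ A ∈ higherSets n m, A.card * (weight n m A.card ^ 2 * projVar P h A.card)
      ≤ 2 * (m * (m - 1) / (n * (n - 1))) * sigmaH P h ^ 2 := by
  have hm' : (0 : ℝ) ≤ m - 1 := sub_nonneg.2 (by exact_mod_cast hm)
  have hn' : (0 : ℝ) ≤ n - 1 := sub_nonneg.2 (by exact_mod_cast (by omega : 1 ≤ n))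
  have h_nonneg : ∀ r, 0 ≤ m.choose r * projVar P h r := fun r =>
    mul_nonneg (Nat.cast_nonneg _) (projVar_nonneg P h r)
  have h_sub : Finset.Icc 2 m ⊆ Finset.range (m + 1) := fun r hr =>
    Finset.mem_range_succ_iff.2 (Finset.mem_Icc.1 hr).2
  have h_order : ∀ r ∈ Finset.Icc 2 m, ∑ A ∈ Finset.powersetCard r (Finset.univ : Finset (Fin n)),
      A.card * (weight n m A.card ^ 2 * projVar P h A.card)
        = r * weight n m r * (m.choose r * projVar P h r) := fun r hr => by
    have hr0 : (n.choose r : ℝ) ≠ 0 := Nat.cast_ne_zero.2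
      (Nat.choose_pos (by have := (Finset.mem_Icc.1 hr).2; omega)).ne'
    rw [Finset.sum_congr rfl fun A hA => by rw [Finset.mem_powersetCard_univ.1 hA],
      Finset.sum_const, Finset.card_powersetCard, Finset.card_univ, Fintype.card_fin,
      nsmul_eq_mul, weight]
    field_simp
  rw [sum_higherSets, Finset.sum_congr rfl h_order, hh.sigmaH_sq, Finset.mul_sum]
  refine (Finset.sum_le_sum fun r hr => ?_).trans
    (Finset.sum_le_sum_of_subset_of_nonneg h_sub fun r _ _ => mul_nonneg ?_ (h_nonneg r))
  · exact mul_le_mul_of_nonneg_right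
      (mul_weight_le hmn (Finset.mem_Icc.1 hr).1 (Finset.mem_Icc.1 hr).2) (h_nonneg r)
  · positivity

lemma integral_hoeffdingSum_higherSets_sq_le (hh : IsCenteredKernel P h) (hm : 1 ≤ m)
    (hmn : 2 * m < n) :
    ∫ x : Fin n → E, hoeffdingSum P h (higherSets n m) x ^ 2 ∂(Measure.pi fun _ => P)
      ≤ 2 * (m * (m - 1) / (n * (n - 1))) * sigmaH P h ^ 2 := by
  rw [integral_hoeffdingSum_sq hh.measurable hh.memLp (by omega)
    fun A hA => (mem_higherSets.1 hA).2]
  refine (Finset.sum_le_sum fun A hA => ?_).trans (hh.sum_card_mul_sq_weight_mul_projVar_le hm hmn)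
  have h_card : 1 ≤ A.card := one_le_two.trans (mem_higherSets.1 hA).1
  exact le_mul_of_one_le_left (mul_nonneg (sq_nonneg _) (projVar_nonneg P h _))
    (by exact_mod_cast h_card)

lemma sum_integral_hoeffdingSum_sub_sq_le (hh : IsCenteredKernel P h) (hm : 1 ≤ m)
    (hmn : 2 * m < n) :
    ∑ t, ∫ x : Fin n → E, (hoeffdingSum P h (higherSets n m) x
        - hoeffdingSum P h ((higherSets n m).filter (t ∉ ·)) x) ^ 2 ∂(Measure.pi fun _ => P)
      ≤ 2 * (m * (m - 1) / (n * (n - 1))) * sigmaH P h ^ 2 := by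
  refine le_of_eq_of_le ?_ (hh.sum_card_mul_sq_weight_mul_projVar_le hm hmn)
  have h_sq : ∀ t, ∫ x : Fin n → E, hoeffdingSum P h ((higherSets n m).filter (t ∈ ·)) x ^ 2
      ∂(Measure.pi fun _ => P) = ∑ A ∈ higherSets n m,
        if t ∈ A then weight n m A.card ^ 2 * projVar P h A.card else 0 := fun t => by
    rw [integral_hoeffdingSum_sq hh.measurable hh.memLp (by omega) fun A hA =>
      (mem_higherSets.1 (Finset.mem_filter.1 hA).1).2, Finset.sum_filter]
  simp only [hoeffdingSum_sub_hoeffdingSum_filter, h_sq]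
  rw [Finset.sum_comm]
  refine Finset.sum_congr rfl fun A _ => ?_
  rw [← Finset.sum_filter, Finset.filter_univ_mem, Finset.sum_const, nsmul_eq_mul]

end IsCenteredKernel

/-! ### Berry-Esseen bounds for U-statistics -/

section Independence

variable {E β ι : Type*} [MeasurableSpace E] [MeasurableSpace β] [Fintype ι] [DecidableEq ι]
  {P : Measure E} [IsProbabilityMeasure P]

lemma indepFun_eval_of_update {F : (ι → E) → β} (hF : Measurable F) {t : ι}
    (hFt : ∀ x e, F (Function.update x t e) = F x) :
    IndepFun (fun x => x t) F (Measure.pi fun _ => P) := by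
  have h_pres := measurePreserving_piecewise (P := P) {t}
  have h_comp : (fun x => (x t, F x)) ∘ (fun z : (ι → E) × (ι → E) => ({t} : Finset ι).piecewise
      z.1 z.2) = Prod.map (fun x => x t) F := by
    ext1 z
    simp only [Function.comp_apply, Finset.piecewise_singleton, hFt, Function.update_self]
    rfl
  rw [indepFun_iff_map_prod_eq_prod_map_map (measurable_pi_apply t).aemeasurable
    hF.aemeasurable, Measure.map_prod_map _ _ (measurable_pi_apply t) hF, ← h_comp,
    ← Measure.map_map (by fun_prop) h_pres.measurable, h_pres.map_eq]

end Independence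

section StdSummand

variable {E : Type*} [MeasurableSpace E] {P : Measure E} {n : ℕ} {φ : E → ℝ}

/-- The summands of the standardized sum of `φ` over an i.i.d. sample of size `n` from the law `P`,
realized on the canonical space. -/
noncomputable def stdSummand (P : Measure E) (φ : E → ℝ) (n : ℕ) (t : Fin n) (y : Fin n → E) : ℝ :=
  φ (y t) / (√n * √Var[φ; P])

lemma measurable_stdSummand (hφ : Measurable φ) (t : Fin n) : Measurable (stdSummand P φ n t) :=
  (hφ.comp (measurable_pi_apply t)).div_const _

variable [IsProbabilityMeasure P] (hφ : Measurable φ)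

include hφ

lemma integral_abs_stdSummand_pow_three (t : Fin n) :
    ∫ y, |stdSummand P φ n t y| ^ 3 ∂(Measure.pi fun _ => P)
      = (∫ e, |φ e| ^ 3 ∂P) / (√n * √Var[φ; P]) ^ 3 := by
  unfold stdSummand
  rw [integral_comp_eval (F := fun e => |φ e / (√n * √Var[φ; P])| ^ 3)
    ((hφ.div_const _).abs.pow_const 3).aestronglyMeasurable]
  simp only [abs_div, div_pow, abs_of_nonneg (by positivity : 0 ≤ √n * √Var[φ; P])]
  rw [integral_div]

lemma lyapunov_stdSummand :
    BerryEsseen.lyapunov (stdSummand P φ n) (Measure.pi fun _ => P)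
      = (∫ e, |φ e| ^ 3 ∂P) / (√n * √Var[φ; P] ^ 3) := by
  rw [BerryEsseen.lyapunov]
  simp only [integral_abs_stdSummand_pow_three hφ]
  rw [Finset.sum_const, Finset.card_univ, Fintype.card_fin, nsmul_eq_mul]
  rcases n.eq_zero_or_pos with rfl | hn
  · simp
  · have hn' : (0 : ℝ) < n := by exact_mod_cast hn
    nth_rewrite 1 [← Real.mul_self_sqrt hn'.le]
    field_simp

variable (h0 : ∫ e, φ e ∂P = 0) (hσ : 0 < √Var[φ; P])

include h0 hσ

lemma integral_stdSummand_sq (t : Fin n) :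
    ∫ y, stdSummand P φ n t y ^ 2 ∂(Measure.pi fun _ => P) = 1 / n := by
  have hn : (0 : ℝ) < n := by exact_mod_cast t.pos
  unfold stdSummand
  rw [integral_comp_eval (F := fun e => (φ e / (√n * √Var[φ; P])) ^ 2)
    ((hφ.div_const _).pow_const 2).aestronglyMeasurable]
  simp only [div_pow, mul_pow, Real.sq_sqrt hn.le, Real.sq_sqrt (variance_nonneg φ P)]
  rw [integral_div, ← variance_of_integral_eq_zero hφ.aemeasurable h0]
  have := Real.sqrt_pos.1 hσ
  field_simp

lemma isStdSum_stdSummand (hn : 0 < n) (h3 : MemLp φ 3 P) :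
    BerryEsseen.IsStdSum (stdSummand P φ n) (Measure.pi fun _ => P) where
  measurable := measurable_stdSummand hφ
  indep := iIndepFun_pi (μ := fun _ : Fin n => P) (X := fun _ e => φ e / (√n * √Var[φ; P]))
    fun _ => (hφ.div_const _).aemeasurable
  memLp t := by
    unfold stdSummand
    simp only [div_eq_inv_mul]
    exact (h3.comp_measurePreserving (measurePreserving_eval (fun _ : Fin n => P) t)).const_mul _
  mean t := by
    unfold stdSummand
    rw [integral_div, integral_comp_eval hφ.aestronglyMeasurable, h0, zero_div]
  var := by
    have hn' : (n : ℝ) ≠ 0 := by exact_mod_cast hn.ne'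
    simp [integral_stdSummand_sq hφ h0 hσ, hn']

lemma integral_abs_stdSummand_le_lyapunov (h3 : MemLp φ 3 P) (t : Fin n) :
    ∫ y, |stdSummand P φ n t y| ∂(Measure.pi fun _ => P)
      ≤ BerryEsseen.lyapunov (stdSummand P φ n) (Measure.pi fun _ => P) := by
  have hn : (0 : ℝ) < n := by exact_mod_cast t.pos
  have h_le := (isStdSum_stdSummand hφ h0 hσ t.pos h3).integral_sq_mul_integral_abs_le t
  rw [integral_stdSummand_sq hφ h0 hσ, integral_abs_stdSummand_pow_three hφ, one_div_mul_eq_div,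
    div_le_iff₀' hn] at h_le
  refine h_le.trans_eq ?_
  simp [BerryEsseen.lyapunov, integral_abs_stdSummand_pow_three hφ]

end StdSummand

section LeaveOneOut

variable {E : Type*} [MeasurableSpace E] {P : Measure E} {m n : ℕ} {φ : E → ℝ}
  {h : (Fin m → E) → ℝ}

lemma truncSum_stdSummand_sub_update (φ : E → ℝ) (t : Fin n) (y : Fin n → E) (e : E) :
    BerryEsseen.truncSum (stdSummand P φ n) (Function.update y t e)
        - BerryEsseen.trunc (stdSummand P φ n t (Function.update y t e))
      = BerryEsseen.truncSum (stdSummand P φ n) y - BerryEsseen.trunc (stdSummand P φ n t y) := by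
  unfold BerryEsseen.truncSum
  rw [← Finset.sum_erase_eq_sub (Finset.mem_univ t), ← Finset.sum_erase_eq_sub (Finset.mem_univ t)]
  refine Finset.sum_congr rfl fun s hs => ?_
  rw [stdSummand, Function.update_of_ne (Finset.ne_of_mem_erase hs), stdSummand]

lemma isLeaveOneOut_hoeffdingSum [IsProbabilityMeasure P] (hφ : Measurable φ) (hh : Measurable h)
    (h2 : MemLp h 2 (Measure.pi fun _ => P)) (hmn : m ≤ n) {J : Finset (Finset (Fin n))}
    (hJ : ∀ A ∈ J, A.card ≤ m) (K : ℝ) :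
    BerryEsseen.IsLeaveOneOut (stdSummand P φ n) (fun y => K * hoeffdingSum P h J y)
      (fun t y => K * hoeffdingSum P h (J.filter (t ∉ ·)) y) (Measure.pi fun _ => P) where
  measurable := (measurable_hoeffdingSum hh J).const_mul K
  measurable_loo t := (measurable_hoeffdingSum hh _).const_mul K
  memLp := (memLp_hoeffdingSum hh h2 hmn hJ).const_mul K
  memLp_loo t := (memLp_hoeffdingSum hh h2 hmn fun A hA =>
    hJ A (Finset.mem_filter.1 hA).1).const_mul K
  indep t := by
    have h_trunc : ∀ s, Measurable fun y => BerryEsseen.trunc (stdSummand P φ n s y) := fun s =>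
      BerryEsseen.measurable_trunc.comp (measurable_stdSummand hφ s)
    refine (indepFun_eval_of_update (((Finset.measurable_fun_sum _ fun s _ => h_trunc s).sub
      (h_trunc t)).prodMk ((measurable_hoeffdingSum hh _).const_mul K)) fun y e => ?_).comp
      (φ := fun e => φ e / (√n * √Var[φ; P])) (ψ := id) (hφ.div_const _) measurable_id
    exact Prod.ext (truncSum_stdSummand_sub_update φ t y e)
      (congrArg (K * ·) (hoeffdingSum_filter_update J t y e))

end LeaveOneOut

section ProjKernel

variable {E : Type*} [MeasurableSpace E] {P : Measure E} {m : ℕ} {h : (Fin m → E) → ℝ}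

lemma measurable_projKernel [SigmaFinite P] (hh : Measurable h) : Measurable (projKernel P h) := by
  have h_proj : projKernel P h
      = fun e => hoeffdingProj P h 1 (fun _ => e) + ∫ y, h y ∂Measure.pi fun _ => P :=
    funext fun e => by rw [hoeffdingProj_one, sub_add_cancel]
  rw [h_proj]
  exact ((measurable_hoeffdingProj hh 1).comp (by fun_prop)).add_const _

variable [IsProbabilityMeasure P]

lemma memLp_projKernel (hm : 1 ≤ m) (hh : Measurable h) {p : ENNReal} (hp : 1 ≤ p) (hp_top : p ≠ ⊤)
    (h_memLp : MemLp h p (Measure.pi fun _ => P)) : MemLp (projKernel P h) p P := by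
  have h_eval := measurePreserving_eval (fun _ : Fin m => P) ⟨0, hm⟩
  have h_mean : projKernel P h ∘ Function.eval ⟨0, hm⟩ = partialMean P h {⟨0, hm⟩} := by
    ext1 x
    refine congrArg (fun F : (Fin m → E) → Fin m → E => ∫ y, h (F y) ∂_) ?_
    ext y i
    by_cases hi : i = ⟨0, hm⟩
    · subst hi
      simp
    · simp [hi, mt Fin.ext hi]
  have h_comp : MemLp (projKernel P h ∘ Function.eval (⟨0, hm⟩ : Fin m)) p
      (Measure.pi fun _ => P) := by
    rw [h_mean]
    exact memLp_partialMean hp hp_top h_memLp _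
  rwa [← memLp_map_measure_iff (measurable_projKernel hh).aestronglyMeasurable
    h_eval.measurable.aemeasurable, h_eval.map_eq] at h_comp

lemma IsCenteredKernel.integral_projKernel (hh : IsCenteredKernel P h) (hm : 1 ≤ m) :
    ∫ e, projKernel P h e ∂P = 0 := by
  have h_term := integral_hoeffdingTerm_mul_eq_zero hh.measurable hh.memLp le_rfl
    (A := {⟨0, hm⟩}) (by simpa using hm) (memLp_const 1) (fun _ _ => rfl)
    (Finset.mem_singleton_self _)
  simp only [hoeffdingTerm_singleton, hh.integral_eq_zero, sub_zero, mul_one] at h_term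
  rwa [integral_comp_eval (measurable_projKernel hh.measurable).aestronglyMeasurable] at h_term

end ProjKernel

lemma sqrt_sq_mul_remainder_bound_le {m n : ℕ} (hm : 1 ≤ m) (hmn : 2 * m < n) {σg σh : ℝ}
    (hg : 0 < σg) (hh : 0 ≤ σh) :
    √((√n / (m * σg)) ^ 2 * (2 * (m * (m - 1) / (n * (n - 1))) * σh ^ 2))
      ≤ (√2 + 2) * (m - 1) * σh / (√(m * (n - m + 1)) * σg) := by
  have hm1 : (1 : ℝ) ≤ m := by exact_mod_cast hm
  have hn1 : 2 * (m : ℝ) + 1 ≤ n := by exact_mod_cast hmn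
  have h_m : (0 : ℝ) ≤ m - 1 := by linarith
  have h_nm : (0 : ℝ) < n - m + 1 := by linarith
  have h_n : (0 : ℝ) < n - 1 := by linarith
  have h_n0 : (0 : ℝ) < n := by linarith
  have h_four : 4 ≤ (√2 + 2) ^ 2 := by nlinarith [Real.sqrt_nonneg 2]
  have h_lhs : (√n / (m * σg)) ^ 2 * (2 * (m * (m - 1) / (n * (n - 1))) * σh ^ 2)
      = 2 * (m - 1) / (n - 1) * (σh ^ 2 / (m * σg ^ 2)) := by
    rw [div_pow, Real.sq_sqrt (Nat.cast_nonneg n)]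
    field_simp
  have h_rhs : ((√2 + 2) * (m - 1) * σh / (√(m * (n - m + 1)) * σg)) ^ 2
      = (√2 + 2) ^ 2 * (m - 1) ^ 2 / (n - m + 1) * (σh ^ 2 / (m * σg ^ 2)) := by
    rw [div_pow, mul_pow, mul_pow, mul_pow, Real.sq_sqrt (by positivity)]
    field_simp
  rw [Real.sqrt_le_iff, h_lhs, h_rhs]
  refine ⟨by positivity, mul_le_mul_of_nonneg_right ?_ (by positivity)⟩
  rcases hm.eq_or_lt with rfl | hm2
  · simp
  · have hm2' : (2 : ℝ) ≤ m := by exact_mod_cast hm2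
    refine div_le_div₀ (by positivity) ?_ h_nm (by linarith)
    nlinarith [mul_le_mul_of_nonneg_right h_four (sq_nonneg ((m : ℝ) - 1))]

namespace IsCenteredKernel

variable {E : Type*} [MeasurableSpace E] {P : Measure E} [IsProbabilityMeasure P] {m n : ℕ}
  {h : (Fin m → E) → ℝ}

lemma looError_hoeffdingSum_le (hh : IsCenteredKernel P h) (hm : 1 ≤ m) (hmn : 2 * m < n)
    {ξ : Fin n → (Fin n → E) → ℝ} (hξ : ∑ t, ∫ y, ξ t y ^ 2 ∂(Measure.pi fun _ => P) = 1) (K : ℝ) :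
    BerryEsseen.looError ξ (fun y => K * hoeffdingSum P h (higherSets n m) y)
        (fun t y => K * hoeffdingSum P h ((higherSets n m).filter (t ∉ ·)) y)
        (Measure.pi fun _ => P)
      ≤ 2 * √(K ^ 2 * (2 * (m * (m - 1) / (n * (n - 1))) * sigmaH P h ^ 2)) := by
  rw [BerryEsseen.looError, two_mul]
  refine add_le_add (Real.sqrt_le_sqrt ?_) ((Real.sum_sqrt_mul_sqrt_le _
    (fun t => integral_nonneg fun y => sq_nonneg _)
    (fun t => integral_nonneg fun y => sq_nonneg _)).trans ?_)
  · simp only [mul_pow, integral_const_mul]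
    exact mul_le_mul_of_nonneg_left (hh.integral_hoeffdingSum_higherSets_sq_le hm hmn)
      (sq_nonneg K)
  · rw [hξ, Real.sqrt_one, one_mul]
    refine Real.sqrt_le_sqrt ?_
    simp only [← mul_sub, mul_pow, integral_const_mul]
    rw [← Finset.mul_sum]
    exact mul_le_mul_of_nonneg_left (hh.sum_integral_hoeffdingSum_sub_sq_le hm hmn) (sq_nonneg K)

lemma mul_uStat_eq (hh : IsCenteredKernel P h) (hm : 1 ≤ m) (hmn : m ≤ n) (y : Fin n → E) :
    √n / (m * sigmaG P h) * uStat h (fun i (y : Fin n → E) => y i) y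
      = ∑ t, stdSummand P (projKernel P h) n t y
        + √n / (m * sigmaG P h) * hoeffdingRemainder P h (fun i (y : Fin n → E) => y i) y := by
  have hm' : (m : ℝ) ≠ 0 := by exact_mod_cast (Nat.one_le_iff_ne_zero.1 hm)
  have hn' : (0 : ℝ) < √n := Real.sqrt_pos.2 (by exact_mod_cast hm.trans hmn)
  have h_coeff : √n / (m * sigmaG P h) * (m / n) = (√n * sigmaG P h)⁻¹ := by
    nth_rewrite 2 [← Real.mul_self_sqrt (Nat.cast_nonneg n)]
    field_simp
  rw [hh.uStat_eq hmn, hoeffdingRemainder_eq_hoeffdingSum, mul_add, ← mul_assoc, h_coeff,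
    inv_mul_eq_div, Finset.sum_div]
  rfl

theorem uStat_berry_esseen_canonical (hh : IsCenteredKernel P h) (hg : MemLp (projKernel P h) 3 P)
    (hm : 1 ≤ m) (hmn : 2 * m < n) (hσ : 0 < sigmaG P h) (x : ℝ) :
    |(Measure.pi fun _ : Fin n => P).real {y | √n / (m * sigmaG P h) *
          uStat h (fun i (y : Fin n → E) => y i) y ≤ x} - cdf (gaussianReal 0 1) x|
      ≤ 3500 * (absThirdMomentG P h / (√n * sigmaG P h ^ 3))
        + (Measure.pi fun _ : Fin n => P).real {y | (|x| + 1) / 3 < |√n / (m * sigmaG P h) *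
            hoeffdingRemainder P h (fun i (y : Fin n → E) => y i) y|}
        + 28 * Real.exp 2 * Real.exp (-|x| / 6) *
          ((√2 + 2) * (m - 1) * sigmaH P h / (√(m * (n - m + 1)) * sigmaG P h)) := by
  have hφ := measurable_projKernel (P := P) hh.measurable
  have h_std := isStdSum_stdSummand hφ (hh.integral_projKernel hm) hσ (by omega : 0 < n) hg
  have h_loo := isLeaveOneOut_hoeffdingSum (n := n) hφ hh.measurable hh.memLp (by omega)
    (fun A hA => (mem_higherSets.1 hA).2) (√n / (m * sigmaG P h))
  have h_error := (hh.looError_hoeffdingSum_le hm hmn h_std.var (√n / (m * sigmaG P h))).trans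
    (mul_le_mul_of_nonneg_left
      (sqrt_sq_mul_remainder_bound_le hm hmn hσ (Real.sqrt_nonneg _)) zero_le_two)
  have h_exp : Real.exp (-|x| / 3) ≤ Real.exp (-|x| / 6) :=
    Real.exp_le_exp.2 (by linarith [abs_nonneg x])
  have h_main := h_std.nonlinear_berry_esseen h_std.lyapunov_pos le_rfl
    (integral_abs_stdSummand_le_lyapunov hφ (hh.integral_projKernel hm) hσ hg) h_loo x
  simp only [← hoeffdingRemainder_eq_hoeffdingSum] at h_main
  simp only [← hh.mul_uStat_eq hm (by omega : m ≤ n)] at h_main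
  rw [lyapunov_stdSummand hφ] at h_main
  refine h_main.trans (add_le_add_right ?_ _)
  calc _ ≤ 14 * Real.exp 2 * Real.exp (-|x| / 6) * (2 *
        ((√2 + 2) * (m - 1) * sigmaH P h / (√(m * (n - m + 1)) * sigmaG P h))) := by
        simp only [hoeffdingRemainder_eq_hoeffdingSum]
        gcongr
        exact BerryEsseen.looError_nonneg _ _ _ _
    _ = _ := by ring

end IsCenteredKernel

section Transfer

variable {E : Type*} [MeasurableSpace E] {m n : ℕ}

lemma measurable_uStat {k : (Fin m → E) → ℝ} (hk : Measurable k) :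
    Measurable (uStat k fun i (y : Fin n → E) => y i) :=
  (Finset.measurable_fun_sum _ fun _ _ => hk.comp (by fun_prop)).const_mul _

lemma measurable_hoeffdingRemainder {P : Measure E} [SigmaFinite P] {h : (Fin m → E) → ℝ}
    (hh : Measurable h) : Measurable (hoeffdingRemainder P h fun i (y : Fin n → E) => y i) :=
  Finset.measurable_fun_sum _ fun r _ =>
    (measurable_uStat (measurable_hoeffdingProj hh r)).const_mul _

end Transfer

/-! ### Kernels of polynomials in a covariance matrix -/

section ProdComp

variable {E ι κ : Type*} [MeasurableSpace E] [Fintype ι] [Fintype κ] {P : Measure E}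
  [IsProbabilityMeasure P] {e : κ → ι} {φ : κ → E → ℝ}

lemma memLp_prod_comp (he : Function.Injective e) {p : ENNReal} (hp : p ≠ 0) (hp_top : p ≠ ⊤)
    (hφ : ∀ k, MemLp (φ k) p P) :
    MemLp (fun x : ι → E => ∏ k, φ k (x (e k))) p (Measure.pi fun _ => P) := by
  refine MemLp.comp_measurePreserving (g := fun y : κ → E => ∏ k, φ k (y k)) ?_
    (measurePreserving_comp_injective he)
  have h_meas : AEStronglyMeasurable (fun y : κ → E => ∏ k, φ k (y k))
      (Measure.pi fun _ => P) := Finset.aestronglyMeasurable_fun_prod _ fun k _ =>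
    (hφ k).aestronglyMeasurable.comp_measurePreserving (measurePreserving_eval _ k)
  rw [← integrable_norm_rpow_iff h_meas hp hp_top]
  simp only [norm_prod, ← Real.finsetProd_rpow _ _ fun _ _ => norm_nonneg _]
  exact Integrable.fintype_prod fun k =>
    (integrable_norm_rpow_iff (hφ k).aestronglyMeasurable hp hp_top).2 (hφ k)

lemma integral_prod_comp (he : Function.Injective e) (hφ : ∀ k, AEStronglyMeasurable (φ k) P) :
    ∫ x : ι → E, ∏ k, φ k (x (e k)) ∂(Measure.pi fun _ => P) = ∏ k, ∫ y, φ k y ∂P := by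
  have h_indep := (iIndepFun_pi (μ := fun _ : ι => P) (X := fun _ => id)
    fun _ => aemeasurable_id).precomp he
  refine (h_indep.integral_fun_prod_comp (fun k =>
    (measurable_pi_apply (X := fun _ : ι => E) (e k)).aemeasurable) fun k => ?_).trans
    (Finset.prod_congr rfl fun k _ => integral_comp_eval (hφ k) (e k))
  rw [show (fun x : ι → E => id (x (e k))) = Function.eval (e k) from rfl,
    (measurePreserving_eval (fun _ : ι => P) (e k)).map_eq]
  exact hφ k

end ProdComp

namespace CovPoly

variable {p m : ℕ} {P : Measure (EuclideanSpace ℝ (Fin p))}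
  {Θ : Matrix (Fin p) (Fin p) ℝ}

lemma kernel_comp_perm (f : CovPoly p m) (σ : Equiv.Perm (Fin m))
    (x : Fin m → EuclideanSpace ℝ (Fin p)) : f.kernel (fun i => x (σ i)) = f.kernel x :=
  congrArg ((m.factorial : ℝ)⁻¹ * ·) (Fintype.sum_equiv (Equiv.mulLeft σ) _ _ fun _ => rfl)

lemma measurable_kernel (f : CovPoly p m) : Measurable f.kernel := by
  unfold kernel preKernel thetaHat
  fun_prop

variable [IsProbabilityMeasure P]

lemma memLp_preKernel_comp {q : ENNReal} (hq : q ≠ 0) (hq_top : q ≠ ⊤)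
    (hP : ∀ w, MemLp (thetaHat w) q P) (f : CovPoly p m) {σ : Fin m → Fin m}
    (hσ : Function.Injective σ) :
    MemLp (fun x => f.preKernel fun i => x (σ i)) q (Measure.pi fun _ => P) := by
  unfold preKernel
  refine (memLp_const f.a₀).add <| memLp_finsetSum _ fun r _ => memLp_finsetSum _ fun w _ => ?_
  exact (memLp_prod_comp (hσ.comp (Fin.castLE_injective r.isLt)) hq hq_top
    fun i => hP (w i)).const_mul (f.a r w)

lemma memLp_kernel {q : ENNReal} (hq : q ≠ 0) (hq_top : q ≠ ⊤)
    (hP : ∀ w, MemLp (thetaHat w) q P) (f : CovPoly p m) :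
    MemLp f.kernel q (Measure.pi fun _ => P) :=
  (memLp_finsetSum _ fun σ _ => memLp_preKernel_comp hq hq_top hP f σ.injective).const_mul _

variable (hP : ∀ w, Integrable (thetaHat w) P)
  (hP_mean : ∀ w : UpperPair p, ∫ x, thetaHat w x ∂P = Θ w.val.1 w.val.2)

include hP hP_mean

lemma integral_preKernel_comp (f : CovPoly p m) {σ : Fin m → Fin m} (hσ : Function.Injective σ) :
    ∫ x, f.preKernel (fun i => x (σ i)) ∂(Measure.pi fun _ => P) = f.eval Θ := by
  have h_inj : ∀ r : Fin m, Function.Injective fun i : Fin (r.val + 1) => σ (Fin.castLE r.isLt i) :=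
    fun r => hσ.comp (Fin.castLE_injective r.isLt)
  have h_int : ∀ (r : Fin m) (w : Fin (r.val + 1) → UpperPair p), Integrable
      (fun x : Fin m → EuclideanSpace ℝ (Fin p) =>
        f.a r w * ∏ i, thetaHat (w i) (x (σ (Fin.castLE r.isLt i)))) (Measure.pi fun _ => P) :=
    fun r w => (memLp_one_iff_integrable.1 (memLp_prod_comp (h_inj r) one_ne_zero
      ENNReal.one_ne_top fun i => memLp_one_iff_integrable.2 (hP (w i)))).const_mul _
  have h_int_sum := fun r => integrable_finsetSum Finset.univ fun w _ => h_int r w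
  unfold preKernel eval
  rw [integral_add (integrable_const _) (integrable_finsetSum _ fun r _ => h_int_sum r),
    integral_finsetSum _ fun r _ => h_int_sum r]
  congr 1
  · simp
  · refine Finset.sum_congr rfl fun r _ => ?_
    rw [integral_finsetSum _ fun w _ => h_int r w]
    refine Finset.sum_congr rfl fun w _ => ?_
    rw [integral_const_mul, integral_prod_comp (h_inj r) fun i => (hP (w i)).aestronglyMeasurable]
    simp only [hP_mean]

lemma integral_kernel (f : CovPoly p m) : ∫ x, f.kernel x ∂(Measure.pi fun _ => P) = f.eval Θ := by
  have h_int : ∀ σ : Equiv.Perm (Fin m), Integrable (fun x => f.preKernel fun i => x (σ i))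
      (Measure.pi fun _ => P) := fun σ =>
    memLp_one_iff_integrable.1 <| memLp_preKernel_comp one_ne_zero ENNReal.one_ne_top
      (fun w => memLp_one_iff_integrable.2 (hP w)) f σ.injective
  unfold kernel
  rw [integral_const_mul, integral_finsetSum _ fun σ _ => h_int σ]
  simp only [integral_preKernel_comp hP hP_mean f (Equiv.injective _)]
  rw [Finset.sum_const, Finset.card_univ, Fintype.card_perm, Fintype.card_fin, nsmul_eq_mul,
    inv_mul_cancel_left₀ (by exact_mod_cast m.factorial_ne_zero)]

end CovPoly

section MultivariateGaussian

variable {p m : ℕ} {Θ : Matrix (Fin p) (Fin p) ℝ}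

lemma memLp_eval_multivariateGaussian (Θ : Matrix (Fin p) (Fin p) ℝ) {q : ENNReal} (hq : q ≠ ⊤)
    (u : Fin p) : MemLp (fun x : EuclideanSpace ℝ (Fin p) => x u) q (multivariateGaussian 0 Θ) :=
  (EuclideanSpace.proj u : EuclideanSpace ℝ (Fin p) →L[ℝ] ℝ).comp_memLp'
    (IsGaussian.memLp_id (multivariateGaussian 0 Θ) q hq)

lemma memLp_thetaHat (Θ : Matrix (Fin p) (Fin p) ℝ) {q : ENNReal} (hq : q ≠ ⊤) (w : UpperPair p) :
    MemLp (thetaHat w) q (multivariateGaussian 0 Θ) := by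
  have : ENNReal.HolderTriple (2 * q) (2 * q) q := ⟨by
    rw [ENNReal.mul_inv (by simp) (by simp), ← add_mul, ENNReal.inv_two_add_inv_two, one_mul]⟩
  have hq' : 2 * q ≠ ⊤ := ENNReal.mul_ne_top ENNReal.ofNat_ne_top hq
  exact (memLp_eval_multivariateGaussian Θ hq' w.val.2).mul
    (memLp_eval_multivariateGaussian Θ hq' w.val.1)

lemma integral_eval_multivariateGaussian (Θ : Matrix (Fin p) (Fin p) ℝ) (u : Fin p) :
    ∫ x : EuclideanSpace ℝ (Fin p), x u ∂multivariateGaussian 0 Θ = 0 := by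
  simpa using (EuclideanSpace.proj u : EuclideanSpace ℝ (Fin p) →L[ℝ] ℝ).integral_comp_comm
    (IsGaussian.integrable_id (μ := multivariateGaussian 0 Θ))

lemma integral_thetaHat (hΘ : Θ.PosSemidef) (w : UpperPair p) :
    ∫ x, thetaHat w x ∂multivariateGaussian 0 Θ = Θ w.val.1 w.val.2 := by
  have h_cov := covariance_eval_multivariateGaussian (μ := 0) hΘ w.val.1 w.val.2
  rwa [covariance_eq_sub (memLp_eval_multivariateGaussian Θ ENNReal.ofNat_ne_top _)
    (memLp_eval_multivariateGaussian Θ ENNReal.ofNat_ne_top _),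
    integral_eval_multivariateGaussian, zero_mul, sub_zero] at h_cov

lemma isCenteredKernel_kernel (hΘ : Θ.PosSemidef) {f : CovPoly p m} (hf : f.eval Θ = 0) :
    IsCenteredKernel (multivariateGaussian 0 Θ) f.kernel where
  measurable := f.measurable_kernel
  symm := f.kernel_comp_perm
  memLp := f.memLp_kernel two_ne_zero ENNReal.ofNat_ne_top (memLp_thetaHat Θ ENNReal.ofNat_ne_top)
  integral_eq_zero := (f.integral_kernel (fun w => memLp_one_iff_integrable.1
    (memLp_thetaHat Θ ENNReal.one_ne_top w)) (integral_thetaHat hΘ)).trans hf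

lemma memLp_projKernel_kernel (Θ : Matrix (Fin p) (Fin p) ℝ) (hm : 1 ≤ m) (f : CovPoly p m) :
    MemLp (projKernel (multivariateGaussian 0 Θ) f.kernel) 3 (multivariateGaussian 0 Θ) :=
  memLp_projKernel hm f.measurable_kernel (by norm_num) ENNReal.ofNat_ne_top
    (f.memLp_kernel three_ne_zero ENNReal.ofNat_ne_top (memLp_thetaHat Θ ENNReal.ofNat_ne_top))

end MultivariateGaussian

end GaussUStat

theorem lemma5_general :
    ∃ C₁ C₂ : ℝ, 0 < C₁ ∧ 0 < C₂ ∧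
      ∀ (E : Type*) [MeasurableSpace E] (P : Measure E) [IsProbabilityMeasure P] (m n : ℕ),
        1 ≤ m → 2 * m < n →
      ∀ h : (Fin m → E) → ℝ, GaussUStat.IsCenteredKernel P h →
        MemLp (GaussUStat.projKernel P h) 3 P → 0 < GaussUStat.sigmaG P h →
      ∀ (Ω : Type*) [MeasurableSpace Ω] (μ : Measure Ω) (X : Fin n → Ω → E),
        iIndepFun X μ → (∀ i, HasLaw (X i) P μ) →
      ∀ x : ℝ,
        |μ.real {ω | √n / (m * GaussUStat.sigmaG P h) * GaussUStat.uStat h X ω ≤ x}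
            - cdf (gaussianReal 0 1) x|
          ≤ C₁ * (GaussUStat.absThirdMomentG P h / (√n * GaussUStat.sigmaG P h ^ 3))
            + μ.real {ω | (|x| + 1) / 3 < |√n / (m * GaussUStat.sigmaG P h) *
                GaussUStat.hoeffdingRemainder P h X ω|}
            + C₂ * Real.exp (-|x| / 6) * ((√2 + 2) * ((m : ℝ) - 1) * GaussUStat.sigmaH P h /
                (√(m * ((n : ℝ) - m + 1)) * GaussUStat.sigmaG P h)) := by
  refine ⟨3500, 28 * Real.exp 2, by norm_num, by positivity, ?_⟩
  intro E _ P _ m n hm hmn h hh hg hσ Ω _ μ X hX hX_law x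
  have h_law : HasLaw (fun ω i => X i ω) (Measure.pi fun _ : Fin n => P) μ := hX.hasLaw_pi hX_law
  have h_prob : ∀ s : Set (Fin n → E), MeasurableSet s →
      (Measure.pi fun _ => P).real s = μ.real ((fun ω i => X i ω) ⁻¹' s) := fun s hs => by
    rw [← h_law.map_eq, map_measureReal_apply_of_aemeasurable h_law.aemeasurable hs]
  have h_main := hh.uStat_berry_esseen_canonical hg hm hmn hσ x
  rwa [h_prob _ (measurableSet_le ((GaussUStat.measurable_uStat hh.measurable).const_mul _)
      measurable_const),
    h_prob _ (measurableSet_lt measurable_const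
      ((GaussUStat.measurable_hoeffdingRemainder hh.measurable).const_mul _).abs)] at h_main

theorem lemma5 :
    ∃ C₁ C₂ : ℝ, 0 < C₁ ∧ 0 < C₂ ∧
      ∀ (p m n : ℕ), 1 ≤ m → 2 * m < n →
      ∀ (f : GaussUStat.CovPoly p m) (Θ : Matrix (Fin p) (Fin p) ℝ), Θ.PosDef → f.eval Θ = 0 →
      ∀ (P : Measure (EuclideanSpace ℝ (Fin p))), P = multivariateGaussian 0 Θ →
      ∀ (σg σh : ℝ), σg = GaussUStat.sigmaG P f.kernel → σh = GaussUStat.sigmaH P f.kernel →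
        0 < σg →
      ∀ (Ω : Type*) [MeasurableSpace Ω] (μ : Measure Ω) [IsProbabilityMeasure μ]
        (X : Fin n → Ω → EuclideanSpace ℝ (Fin p)),
        iIndepFun X μ → (∀ i, HasLaw (X i) P μ) →
      ∀ x : ℝ,
        |μ.real {ω | √n / (m * σg) * GaussUStat.uStat f.kernel X ω ≤ x}
            - cdf (gaussianReal 0 1) x|
          ≤ C₁ * (GaussUStat.absThirdMomentG P f.kernel / (√n * σg ^ 3))
            + μ.real {ω | (|x| + 1) / 3 <
                |√n / (m * σg) * GaussUStat.hoeffdingRemainder P f.kernel X ω|}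
            + C₂ * Real.exp (-|x| / 6) *
                ((√2 + 2) * ((m : ℝ) - 1) * σh / (√(m * ((n : ℝ) - m + 1)) * σg)) := by
  obtain ⟨C₁, C₂, hC₁, hC₂, h_bound⟩ := lemma5_general
  refine ⟨C₁, C₂, hC₁, hC₂, ?_⟩
  rintro p m n hm hmn f Θ hΘ hf P rfl σg σh rfl rfl hσ Ω _ μ _ X hX hX_law x
  exact h_bound _ _ m n hm hmn f.kernel (GaussUStat.isCenteredKernel_kernel hΘ.posSemidef hf)
    (GaussUStat.memLp_projKernel_kernel Θ hm f) hσ Ω μ X hX hX_law x
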